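/- Let $R$ be a complete discrete valuation ring with maximal ideal $\mathfrak m$, residue field $k$, quotient field $K$ and normalized valuation $v_K$, and put $|a|_K=\exp(-v_K(a))$. Let $X$ be a connected smooth separated $K$-scheme of finite type. Let $X^{\mathrm{an}}$ be the set of pairs $(x,|\cdot|)$ with $x\in X$ and $|\cdot|$ an absolute value on the residue field $\kappa(x)$ extending $|\cdot|_K$, with the coarsest topology such that $X^{\mathrm{an}}\to X$ is continuous and, for every open $U\subseteq X$ and $f\in\mathcal O_X(U)$, the function $|f|$ is continuous on the inverse image of $U$. Let $\mathcal X$ be an $sncd$-model of $X$: a flat separated $R$-scheme of finite type with an isomorphism $\mathcal X_K\cong X$ over $K$, such that $\mathcal X$ is regular and the special fiber $\mathcal X_k=\sum_{i\in I}N_iE_i$ is a divisor with strict normal crossings (each multiplicity $N_i$ is positive, properness is not assumed, and $\mathcal X_k$ may be empty). For non-empty $J\subseteq I$ put $E_J=\bigcap_{i\in J}E_i$. **Monomial points.** Let $J\subseteq I$ be non-empty, let $\xi$ be a generic point of $E_J$, and let $\alpha\in\mathbb R_{>0}^J$ satisfy $\sum_{i\in J}\alpha_iN_i=1$. The monomial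 point associated with $(\mathcal X,(E_i)_{i\in J},\alpha,\xi)$ is the point of $X^{\mathrm{an}}$ over the generic point of $X$ with absolute value $\exp(-v)$ on the function field $K(X)$, where $v$ is the unique extension to $K(X)$ of the smallest real valuation $\mathcal O_{\mathcal X,\xi}\setminus\{0\}\to\mathbb R_{\ge0}$ that takes the value $\alpha_i$ on each local equation of $E_i$ at $\xi$, for all $i\in J$. The Berkovich skeleton $\mathrm{Sk}(\mathcal X)\subseteq X^{\mathrm{an}}$ is the set of all these points, with the subspace topology. **Dual complex.** $|\Delta(\mathcal X_k)|$ is the topological space obtained by gluing one simplex with vertex set $J$ for each non-empty $J\subseteq I$ and each connected component $C$ of $E_J$, where the simplex of $C\subseteq E_J$ is a face of the simplex of $C'\subseteq E_{J'}$ if and only if $C\supseteq C'$. **Proposition.** There is a unique map $$\Phi\colon |\Delta(\mathcal X_k)|\to \mathrm{Sk}(\mathcal X)$$ which sends the vertex of each $E_i$ to the divisorial point given by the valuation $\frac1{N_i}\mathrm{ord}_{E_i}$, and which sends the point with barycentric coordinates $(\beta_i)_{i\in J}$, all $\beta_i>0$, in the interior of the simplex of a connected component $C$ of $E_J$, to the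 monomial point associated with $(\mathcal X,(E_i)_{i\in J},(\beta_i/N_i)_{i\in J},\xi)$, where $\xi$ is the generic point of $C$. This map $\Phi$ is a homeomorphism. -/

import Mathlib

open CategoryTheory AlgebraicGeometry IsLocalRing
open scoped ENNReal

universe u

namespace BerkovichSkeleton

noncomputable section

section Field

variable (R : Type u) [CommRing R] [IsDomain R] [IsDiscreteValuationRing R]

/-- The absolute value `|a| = exp (-v a)` on the fraction field `K` of a discrete valuation
ring `R`, where `v` is the discrete valuation with value group `ℤ`. -/
def fieldAbs (K : Type u) [Field K] [Algebra R K] [IsFractionRing R K] : AbsoluteValue K ℝ :=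
  IsDedekindDomain.HeightOneSpectrum.adicAbv (K := K)
    (⟨maximalIdeal R, inferInstance, IsDiscreteValuationRing.not_a_field R⟩ :
      IsDedekindDomain.HeightOneSpectrum R)
    (b := ⟨Real.exp 1, (Real.exp_pos 1).le⟩)
    (show (1 : ℝ) < Real.exp 1 from Real.one_lt_exp_iff.mpr one_pos)

end Field

section Analytification

variable (R : Type u) [CommRing R] [IsDomain R] [IsDiscreteValuationRing R]
variable {K : Type u} [Field K] [Algebra R K] [IsFractionRing R K]
variable {X : Scheme.{u}} (sX : X ⟶ Spec (.of K))

/-- The structure map from `K` to the residue field of the `K`-scheme `X` at `x`. -/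
def toResidueField (x : X) : CommRingCat.of K ⟶ X.residueField x :=
  Spec.preimage (X.fromSpecResidueField x ≫ sX)

/-- A point of the Berkovich analytification of the `K`-scheme `X`: a point of `X` together with
an absolute value on its residue field that extends the one on `K`. -/
structure Analytification where
  /-- the underlying point of `X` -/
  pt : X
  /-- the absolute value on the residue field -/
  abs : AbsoluteValue (X.residueField pt) ℝ
  abs_toResidueField : ∀ a : K, abs ((toResidueField sX pt).hom a) = fieldAbs R K a

/-- The Berkovich topology: the coarsest topology for which the map to `X` is continuous and,
for every open `U` in `X` and every regular function `f` on `U`, the function `|f|` is continuous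
on the (open) inverse image of `U`. -/
instance : TopologicalSpace (Analytification R sX) :=
  TopologicalSpace.generateFrom
    ({S | ∃ U : X.Opens, S = {x | x.pt ∈ U}} ∪
     {S | ∃ (U : X.Opens) (f : Γ(X, U)) (V : Set ℝ), IsOpen V ∧
        S = {x | ∃ h : x.pt ∈ U, x.abs ((X.evaluation U x.pt h).hom f) ∈ V}})

/-- Birational points: those lying over the generic point of `X`. -/
def Analytification.IsBirational {sX : X ⟶ Spec (.of K)} (x : Analytification R sX) : Prop :=
  IsGenericPoint x.pt (Set.univ : Set X)

end Analytification

/-- `Z` is an irreducible component of the subset `S`. -/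
def IsComponentOf {T : Type*} [TopologicalSpace T] (Z S : Set T) : Prop :=
  Maximal (fun W : Set T => IsIrreducible W ∧ W ⊆ S) Z

/-- A real valuation on `A`, with values in `ℝ≥0 ∪ {∞}`, and infinite only at zero. -/
def IsRealValuation {A : Type*} [CommRing A] (v : AddValuation A ℝ≥0∞) : Prop :=
  ∀ f : A, v f = ⊤ → f = 0

/-- An `R`-model of the `K`-scheme `X`: a flat separated `R`-scheme of finite type whose generic
fibre is identified with `X` over `K`. -/
structure Model (R : Type u) [CommRing R] {K : Type u} [Field K] [Algebra R K]
    {X : Scheme.{u}} (sX : X ⟶ Spec (.of K)) where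
  /-- the total space -/
  total : Scheme.{u}
  /-- the structure morphism -/
  str : total ⟶ Spec (.of R)
  /-- the inclusion of the generic fibre -/
  incl : X ⟶ total
  isPullback : IsPullback incl sX str (Spec.map (CommRingCat.ofHom (algebraMap R K)))
  flat : Flat str
  isSeparated : IsSeparated str
  locallyOfFiniteType : LocallyOfFiniteType str
  quasiCompact : QuasiCompact str

namespace Model

variable {R : Type u} [CommRing R] [IsDomain R] [IsDiscreteValuationRing R]
variable {K : Type u} [Field K] [Algebra R K] [IsFractionRing R K]
variable {X : Scheme.{u}} {sX : X ⟶ Spec (.of K)} (M : Model R sX)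

/-- The special fibre, as a (closed) subset of the total space. -/
def specialFiber : Set M.total := M.str ⁻¹' {closedPoint R}

/-- The structure map from `R` to the local ring at `x`. -/
def toStalk (x : M.total) : CommRingCat.of R ⟶ M.total.presheaf.stalk x :=
  Spec.preimage (M.total.fromSpecStalk x ≫ M.str)

/-- The ideal of the special fibre in the local ring at `x`; it is generated by the image of a
uniformizer of `R`. -/
def specialIdeal (x : M.total) : Ideal (M.total.presheaf.stalk x) :=
  (maximalIdeal R).map (M.toStalk x).hom

/-- The total space is regular, and the special fibre is a divisor with strict normal crossings:
around each of its points it is defined by a monomial in a regular system of local parameters of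
the local ring of the total space. -/
structure IsSncd : Prop where
  regular : ∀ x : M.total, IsRegularLocalRing (M.total.presheaf.stalk x)
  snc : ∀ x ∈ M.specialFiber, ∃ (d : ℕ) (z : Fin d → M.total.presheaf.stalk x) (N : Fin d → ℕ),
    ringKrullDim (M.total.presheaf.stalk x) = d ∧
    Ideal.span (Set.range z) = maximalIdeal (M.total.presheaf.stalk x) ∧
    M.specialIdeal x = Ideal.span {∏ j, z j ^ N j}

/-- The irreducible components `E i` of the special fibre. -/
abbrev Component : Type u := {E : Set M.total // IsComponentOf E M.specialFiber}

/-- The generic point of a component of the special fibre. -/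
def genericPt (i : M.Component) : M.total := i.2.1.1.genericPoint

/-- The multiplicity of a component: the length of the local ring of the special fibre at the
generic point of the component. -/
def mult (i : M.Component) : ℕ :=
  (Module.length (M.total.presheaf.stalk (M.genericPt i))
    (M.total.presheaf.stalk (M.genericPt i) ⧸ M.specialIdeal (M.genericPt i))).toNat

/-- The intersection `E J` of the components in `J`. -/
def stratum (J : Finset M.Component) : Set M.total := ⋂ i ∈ J, i.1

/-- The ideal of the closed subset `Z` (with its reduced structure) in the local ring at `x`: the
germs that vanish at all those points of `Z` that specialize to `x`. -/
def idealAt (Z : Set M.total) (x : M.total) : Ideal (M.total.presheaf.stalk x) :=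
  ⨅ (y : M.total) (h : y ⤳ x) (_ : y ∈ Z),
    (maximalIdeal (M.total.presheaf.stalk y)).comap (M.total.presheaf.stalkSpecializes h).hom

/-- Evaluation at a point `p` of `X` of the germs at a specialization `ξ` of `p` in the model. -/
def evalAt (p : X) (ξ : M.total) (h : M.incl p ⤳ ξ) :
    M.total.presheaf.stalk ξ ⟶ X.residueField p :=
  M.total.presheaf.stalkSpecializes h ≫ M.incl.stalkMap p ≫ X.residue p

/-- `v` is a real valuation on the local ring at `ξ` which takes the value `α i` on every local
equation of `E i` at `ξ`, for all `i` in `J`. -/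
def HasWeights (J : Finset M.Component) (α : J → ℝ) (ξ : M.total)
    (v : AddValuation (M.total.presheaf.stalk ξ) ℝ≥0∞) : Prop :=
  IsRealValuation v ∧ ∀ (i : J) (t : M.total.presheaf.stalk ξ),
    Ideal.span {t} = M.idealAt i.1.1 ξ → v t = ENNReal.ofReal (α i)

/-- `v` is the minimal real valuation with the prescribed weights. -/
def IsMonomialValuation (J : Finset M.Component) (α : J → ℝ) (ξ : M.total)
    (v : AddValuation (M.total.presheaf.stalk ξ) ℝ≥0∞) : Prop :=
  M.HasWeights J α ξ v ∧ ∀ w, M.HasWeights J α ξ w → ∀ f, v f ≤ w f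

/-- `x` is the monomial point associated with the components `E i`, `i ∈ J`, positive weights `α`
with `∑ α i * N i = 1` and a generic point `ξ` of the intersection of the `E i`: the birational
point whose absolute value is `exp (-v)`, where `v` is the corresponding monomial valuation. -/
structure IsMonomialPoint (J : Finset M.Component) (α : J → ℝ) (ξ : M.total)
    (x : Analytification R sX) : Prop where
  nonempty : J.Nonempty
  pos : ∀ i, 0 < α i
  sum_eq_one : ∑ i, α i * M.mult i.1 = 1
  generic : IsComponentOf (closure {ξ}) (M.stratum J)
  birational : x.IsBirational
  abs_eq : ∃ (h : M.incl x.pt ⤳ ξ) (v : AddValuation (M.total.presheaf.stalk ξ) ℝ≥0∞),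
    M.IsMonomialValuation J α ξ v ∧
    ∀ f, f ≠ 0 → x.abs ((M.evalAt x.pt ξ h).hom f) = Real.exp (-(v f).toReal)

/-- `x` is the divisorial point associated with the component `E i`, that is, the birational point
that corresponds to the valuation `ord / N`, where `ord` is the order of vanishing along `E i` and
`N` is the multiplicity of `E i`. -/
structure IsDivisorialPoint (i : M.Component) (x : Analytification R sX) : Prop where
  birational : x.IsBirational
  abs_eq : ∃ h : M.incl x.pt ⤳ M.genericPt i, ∀ f, f ≠ 0 →
    x.abs ((M.evalAt x.pt (M.genericPt i) h).hom f) =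
      Real.exp (-(((Ring.ord (M.total.presheaf.stalk (M.genericPt i)) f).toNat : ℝ) / M.mult i))

/-- The Berkovich skeleton: the set of points that are monomial with respect to the model, with
the topology induced by the Berkovich topology. -/
def skeleton : Set (Analytification R sX) :=
  {x | ∃ (J : Finset M.Component) (α : J → ℝ) (ξ : M.total), M.IsMonomialPoint J α ξ x}

/-- The simplices of the dual complex: the connected components `C` of the intersections `E J`,
for non-empty `J`. -/
structure Simplex where
  /-- the set of vertices -/
  J : Finset M.Component
  nonempty : J.Nonempty
  /-- the corresponding connected component -/
  C : Set M.total
  isConnectedComponent : ∃ x ∈ M.stratum J, C = connectedComponentIn (M.stratum J) x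

/-- The disjoint union of the geometric simplices; a point is a simplex together with a tuple of
barycentric coordinates. -/
abbrev SimplexPoint : Type u := Σ σ : M.Simplex, stdSimplex ℝ σ.J

/-- The identifications along faces: when `τ.C ⊇ σ.C`, the simplex of `τ` is a face of the simplex
of `σ`, included by extending barycentric coordinates by zero. -/
inductive FaceRel : M.SimplexPoint → M.SimplexPoint → Prop
  | face (τ σ : M.Simplex) (hJ : τ.J ⊆ σ.J) (hC : σ.C ⊆ τ.C) (y : stdSimplex ℝ τ.J) :
      FaceRel ⟨τ, y⟩ ⟨σ, stdSimplex.map (fun i : τ.J => (⟨i.1, hJ i.2⟩ : σ.J)) y⟩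

/-- The (topological realization of the) dual complex of the special fibre: the simplices glued
along their faces, with the quotient topology. -/
def DualComplex : Type u := Quot M.FaceRel

instance : TopologicalSpace M.DualComplex :=
  inferInstanceAs (TopologicalSpace (Quot M.FaceRel))

/-- The point of the dual complex with barycentric coordinates `y` in the simplex `σ`. -/
def DualComplex.mk (σ : M.Simplex) (y : stdSimplex ℝ σ.J) : M.DualComplex :=
  Quot.mk M.FaceRel ⟨σ, y⟩

/-- The defining properties of the canonical map from the dual complex to the skeleton: it sends
the vertex of `E i` to the divisorial point of `E i`, and the point in the interior of the simplex
of `C` with barycentric coordinates `y` to the monomial point associated with the weights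
`y i / N i` and the generic point of `C`. -/
structure IsCanonicalMap (Φ : M.DualComplex → M.skeleton) : Prop where
  vertex : ∀ (σ : M.Simplex) (i : M.Component), σ.J = {i} → ∀ y : stdSimplex ℝ σ.J,
    M.IsDivisorialPoint i (Φ (DualComplex.mk M σ y)).1
  interior : ∀ (σ : M.Simplex) (y : stdSimplex ℝ σ.J), (∀ i, 0 < y i) →
    ∃ ξ : M.total, IsGenericPoint ξ σ.C ∧
      M.IsMonomialPoint σ.J (fun i => y i / M.mult i.1) ξ (Φ (DualComplex.mk M σ y)).1

end Model

end

end BerkovichSkeleton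

/-! A monomial point carries three data: its centre `ξ` on the model, the set `J` of components
through `ξ`, and the weights. A point in the interior of a simplex carries the same data, because
connected components of strata turn out to be irreducible and so correspond to their generic points.
It remains to construct the monomial points, to glue along faces, to recover the data from the
point, and to compare topologies.

Algebra. Let `z` be a regular system of parameters of a local ring. Every element is a finite sum of
monomials in `z` with unit coefficients (`IsParamSystem.exists_expansion`), and a monomial lies in a
monomial ideal only if a generator divides it (`IsParamSystem.exists_le_of_monomial_mem`). Hence,
for positive weights, the least weight in an expansion does not depend on the expansion, and it is
multiplicative (`IsParamSystem.order_mul_of_pos`). Since one expansion serves for all weights, the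
order is continuous in the weights; a limit allows weights to be zero. The resulting valuation is
the smallest one with the given weights (`IsParamSystem.valuation_le`).

Geometry. At the generic point of a stratum the local equations of the components form such a system
(`IsSncd.exists_chart`), and the normalization of the weights says that a uniformizer has value 1.
When some weights are zero, the point is the monomial point of a face
(`HasValuation.isMonomialPoint`), which makes the maps on the simplices compatible.

Conversely, the model is separated, so the centre is determined by the point
(`Model.center_unique`); it determines `J`, and the absolute values of the local equations give the
weights. So the canonical map is bijective. It is continuous, its source is a quotient of finitely
many simplices, hence compact, and its target is Hausdorff, so it is a homeomorphism. -/

open scoped NNReal Topology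

universe v

namespace BerkovichSkeleton

/-! ### Regular systems of parameters -/

/-- The family `z` is a regular system of parameters of the local ring `A`: it generates the
maximal ideal, and it has no more than `dim A` members. -/
structure IsParamSystem {A ι : Type*} [CommRing A] [IsLocalRing A] [Fintype ι] (z : ι → A) :
    Prop where
  span_eq : Ideal.span (Set.range z) = maximalIdeal A
  card_le : (Fintype.card ι : WithBot ℕ∞) ≤ ringKrullDim A

section ParamSystem

variable {A ι : Type*} [CommRing A] [IsLocalRing A] [Fintype ι]
  {z : ι → A}

theorem IsParamSystem.mem (hz : IsParamSystem z) (i : ι) : z i ∈ maximalIdeal A :=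
  hz.span_eq ▸ Ideal.subset_span ⟨i, rfl⟩

theorem ringKrullDim_le_card_of_span_eq [IsNoetherianRing A]
    (h : Ideal.span (Set.range z) = maximalIdeal A) :
    ringKrullDim A ≤ (Fintype.card ι : WithBot ℕ∞) := by
  classical
  refine (ringKrullDim_le_spanFinrank_maximalIdeal A).trans ?_
  have h1 : (maximalIdeal A).spanFinrank ≤ (Set.range z).ncard := by
    rw [← h]
    exact Submodule.spanFinrank_span_le_ncard_of_finite (Set.finite_range z)
  have h2 : (Set.range z).ncard ≤ Fintype.card ι := by
    rw [← Set.image_univ]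
    exact (Set.ncard_image_le Set.finite_univ).trans (by simp [Set.ncard_univ])
  exact_mod_cast h1.trans h2

theorem span_image_le_maximalIdeal (hz : IsParamSystem z) (T : Finset ι) :
    Ideal.span (z '' T) ≤ maximalIdeal A := by
  rw [← hz.span_eq]
  exact Ideal.span_mono (Set.image_subset_range _ _)

/-- The quotient by some members of a system of parameters generates, with the remaining ones, the
maximal ideal of a local ring. -/
theorem span_range_mk_eq {A ι : Type*} [CommRing A] [IsLocalRing A] {z : ι → A}
    {B : Type*} [CommRing B] [IsLocalRing B] (f : A →+* B)
    (hf : Function.Surjective f) (h : Ideal.span (Set.range z) = maximalIdeal A)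
    (p : ι → Prop) (hp : ∀ i, ¬ p i → f (z i) = 0) :
    Ideal.span (Set.range fun i : {i // p i} => f (z i)) = maximalIdeal B := by
  have : maximalIdeal B = (maximalIdeal A).map f := by
    have := IsLocalRing.of_surjective' f hf
    have hl : IsLocalHom f := hf.isLocalHom f
    refine (IsLocalRing.eq_maximalIdeal ?_).symm
    rcases Ideal.map_eq_top_or_isMaximal_of_surjective f hf
      (maximalIdeal.isMaximal A) with h | h
    · have : (maximalIdeal A).map f ≤ maximalIdeal B :=
        ((local_hom_TFAE f).out 0 2).mp hl
      exact absurd (top_le_iff.mp (h ▸ this)) (maximalIdeal.isMaximal B).ne_top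
    · exact h
  rw [this, ← h, Ideal.map_span]
  apply le_antisymm
  · apply Ideal.span_mono
    rintro _ ⟨i, rfl⟩
    exact ⟨z i, ⟨i, rfl⟩, rfl⟩
  · rw [Ideal.span_le]
    rintro _ ⟨_, ⟨i, rfl⟩, rfl⟩
    by_cases hi : p i
    · exact Ideal.subset_span ⟨⟨i, hi⟩, rfl⟩
    · rw [hp i hi]
      exact zero_mem _

theorem isLocalRing_quotient {I : Ideal A} (h : I ≤ maximalIdeal A) : IsLocalRing (A ⧸ I) := by
  have : Nontrivial (A ⧸ I) :=
    Ideal.Quotient.nontrivial_iff.mpr fun h' =>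
      (maximalIdeal.isMaximal A).ne_top (top_le_iff.mp (h' ▸ h))
  exact IsLocalRing.of_surjective' (Ideal.Quotient.mk I) Ideal.Quotient.mk_surjective

/-- Killing the members in `T` lowers the dimension by at most `T.card`, while the number of
remaining generators drops by exactly that much. -/
theorem IsParamSystem.quotient [IsNoetherianRing A] (hz : IsParamSystem z) (T : Finset ι)
    [IsLocalRing (A ⧸ Ideal.span (z '' T))] [Fintype {i // i ∉ T}] :
    IsParamSystem fun i : {i // i ∉ T} => Ideal.Quotient.mk (Ideal.span (z '' T)) (z i) := by
  classical
  refine ⟨span_range_mk_eq _ Ideal.Quotient.mk_surjective hz.span_eq (fun i => i ∉ T) ?_, ?_⟩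
  · intro i hi
    rw [Ideal.Quotient.eq_zero_iff_mem]
    exact Ideal.subset_span ⟨i, by simpa using hi, rfl⟩
  · have h1 := ringKrullDim_le_ringKrullDim_quotient_add_card (T.image z) (by
      rw [IsLocalRing.ringJacobson_eq_maximalIdeal]
      intro x hx
      simp only [Finset.coe_image] at hx
      obtain ⟨i, -, rfl⟩ := hx
      exact hz.mem i)
    rw [Finset.coe_image] at h1
    have h2 := hz.card_le.trans h1
    have h3 : Fintype.card {i // i ∉ T} + T.card = Fintype.card ι := by
      rw [Fintype.card_subtype_compl, Fintype.card_coe]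
      exact Nat.sub_add_cancel T.card_le_univ
    have h4 : (T.image z).card ≤ T.card := Finset.card_image_le
    have h5 : ((Fintype.card {i // i ∉ T} + T.card : ℕ) : WithBot ℕ∞) ≤
        ringKrullDim (A ⧸ Ideal.span (z '' T)) + (T.card : WithBot ℕ∞) := by
      rw [h3]
      refine h2.trans ?_
      gcongr
    push_cast at h5
    exact (WithBot.add_le_add_iff_right' (WithBot.natCast_ne_bot _) fun h =>
      ENat.natCast_ne_top T.card (WithBot.coe_injective h)).mp h5

/-- A chain of primes of length `n` survives in the quotient by its smallest member. -/
theorem exists_isPrime_ringKrullDim_le {A : Type*} [CommRing A] {n : ℕ}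
    (h : (n : WithBot ℕ∞) ≤ ringKrullDim A) :
    ∃ Q : Ideal A, Q.IsPrime ∧ (n : WithBot ℕ∞) ≤ ringKrullDim (A ⧸ Q) := by
  obtain ⟨l, hl⟩ := Order.le_krullDim_iff.mp h
  refine ⟨l.head.asIdeal, l.head.2, ?_⟩
  rw [ringKrullDim_quotient]
  refine Order.le_krullDim_iff.mpr ⟨⟨l.length, fun i => ⟨l i, ?_⟩, fun i => l.step i⟩, hl⟩
  exact (LTSeries.head_le l i : l.head ≤ l i)

/-- Primality turns `Q ≤ (x)` into `Q ≤ x Q`, and Nakayama's lemma applies. -/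
theorem eq_bot_of_le_span_singleton [IsNoetherianRing A] {Q : Ideal A} [Q.IsPrime] {x : A}
    (hx : x ∈ maximalIdeal A) (hxQ : x ∉ Q) (h : Q ≤ Ideal.span {x}) : Q = ⊥ := by
  refine Submodule.eq_bot_of_le_smul_of_le_jacobson_bot (Ideal.span {x}) Q
    (IsNoetherian.noetherian Q) ?_ ?_
  · intro q hq
    obtain ⟨a, rfl⟩ := Ideal.mem_span_singleton'.mp (h hq)
    have ha : a ∈ Q := (Ideal.IsPrime.mem_or_mem ‹_› hq).resolve_right hxQ
    rw [mul_comm]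
    exact Submodule.smul_mem_smul (Ideal.mem_span_singleton_self x) ha
  · rw [Ideal.span_le, Set.singleton_subset_iff]
    exact (IsLocalRing.maximalIdeal_le_jacobson _) hx

/-- Induction on the number of parameters. By induction `A ⧸ (z j)` is a domain, of dimension at
most `n`. Choose a prime `Q` with `dim A ⧸ Q ≥ n + 1`. Then `z j ∉ Q`, and dimension counting forces
`Q ≤ (z j)`, so `Q = ⊥` by `eq_bot_of_le_span_singleton`. -/
theorem isDomain_of_card {n : ℕ} : ∀ {A : Type u} {ι : Type v} [CommRing A] [IsLocalRing A]
    [IsNoetherianRing A] [Fintype ι] {z : ι → A}, IsParamSystem z → Fintype.card ι = n →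
    IsDomain A := by
  classical
  induction n with
  | zero =>
    intro A ι _ _ _ _ z hz h0
    have := Fintype.card_eq_zero_iff.mp h0
    have h : maximalIdeal A = ⊥ := by rw [← hz.span_eq, Set.range_eq_empty, Ideal.span_empty]
    exact (IsLocalRing.isField_iff_maximalIdeal_eq.mpr h).isDomain
  | succ n ih =>
    intro A ι _ _ _ _ z hz hn
    obtain ⟨j⟩ : Nonempty ι := Fintype.card_pos_iff.mp (by omega)
    have hle := span_image_le_maximalIdeal hz {j}
    have hloc := isLocalRing_quotient hle
    have hq := hz.quotient {j}
    have hcard : Fintype.card {i // i ∉ ({j} : Finset ι)} = n := by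
      rw [Fintype.card_subtype_compl, Fintype.card_coe, Finset.card_singleton, hn]
      rfl
    have hdom := ih hq hcard
    have hdim := ringKrullDim_le_card_of_span_eq hq.span_eq
    rw [hcard] at hdim
    have hI : Ideal.span (z '' ({j} : Finset ι)) = Ideal.span {z j} := by simp
    have hdom : IsDomain (A ⧸ Ideal.span {z j}) := hI ▸ hdom
    have hdim : ringKrullDim (A ⧸ Ideal.span {z j}) ≤ n := hI ▸ hdim
    obtain ⟨Q, hQ, hQd⟩ := exists_isPrime_ringKrullDim_le (hn ▸ hz.card_le)
    have hlt : ¬ (((n + 1 : ℕ) : WithBot ℕ∞) ≤ n) := by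
      norm_cast
      omega
    have hjQ : z j ∉ Q := fun hj => hlt <| hQd.trans <| by
      refine le_trans ?_ hdim
      exact ringKrullDim_le_of_surjective
        (Ideal.Quotient.factor (S := Ideal.span {z j}) (T := Q)
          (by rwa [Ideal.span_le, Set.singleton_subset_iff]))
        (Ideal.Quotient.factor_surjective _)
    -- Otherwise some `q ∈ Q` is nonzero in the domain `A ⧸ P`, so `dim A ⧸ (Q + (z j)) < dim A ⧸ P
    -- ≤ n`. As `dim A ⧸ Q` exceeds the left side by at most one, this contradicts `hQd`.
    have hQle : Q ≤ Ideal.span {z j} := by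
      by_contra hne
      obtain ⟨q, hqQ, hqj⟩ := SetLike.not_le_iff_exists.mp hne
      set P := Ideal.span {z j} with hP
      have hlocQ : IsLocalRing (A ⧸ Q) := isLocalRing_quotient (le_maximalIdeal hQ.ne_top)
      have hzQ : Ideal.Quotient.mk Q (z j) ∈ maximalIdeal (A ⧸ Q) := by
        have hl : IsLocalHom (Ideal.Quotient.mk Q) :=
          Function.Surjective.isLocalHom _ Ideal.Quotient.mk_surjective
        rw [mem_maximalIdeal, mem_nonunits_iff, isUnit_map_iff, ← mem_nonunits_iff,
          ← mem_maximalIdeal]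
        exact hz.mem j
      have h1 : ringKrullDim (A ⧸ Q) ≤
          ringKrullDim ((A ⧸ Q) ⧸ Ideal.span {Ideal.Quotient.mk Q (z j)}) + 1 := by
        have := ringKrullDim_le_ringKrullDim_quotient_add_card {Ideal.Quotient.mk Q (z j)} (by
          rw [IsLocalRing.ringJacobson_eq_maximalIdeal]
          simpa using hzQ)
        rwa [Finset.coe_singleton, Finset.card_singleton, Nat.cast_one] at this
      have h2 : ringKrullDim ((A ⧸ Q) ⧸ Ideal.span {Ideal.Quotient.mk Q (z j)}) + 1 ≤
          ringKrullDim (A ⧸ P) := by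
        let g : (A ⧸ P) →+* ((A ⧸ Q) ⧸ Ideal.span {Ideal.Quotient.mk Q (z j)}) :=
          Ideal.Quotient.lift P ((Ideal.Quotient.mk _).comp (Ideal.Quotient.mk Q)) (by
            intro a ha
            obtain ⟨b, rfl⟩ := Ideal.mem_span_singleton'.mp ha
            rw [RingHom.comp_apply, Ideal.Quotient.eq_zero_iff_mem, map_mul]
            exact Ideal.mul_mem_left _ _ (Ideal.mem_span_singleton_self _))
        refine ringKrullDim_succ_le_of_surjective g ?_ (r := Ideal.Quotient.mk P q) ?_ ?_
        · exact Ideal.Quotient.lift_surjective_of_surjective _ _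
            (Ideal.Quotient.mk_surjective.comp Ideal.Quotient.mk_surjective)
        · exact mem_nonZeroDivisors_of_ne_zero (by rwa [Ne, Ideal.Quotient.eq_zero_iff_mem])
        · rw [Ideal.Quotient.lift_mk, RingHom.comp_apply,
            Ideal.Quotient.eq_zero_iff_mem.mpr hqQ, map_zero]
      have h3 := (hQd.trans h1).trans (h2.trans hdim)
      exact hlt h3
    have hbot := eq_bot_of_le_span_singleton (hz.mem j) hjQ hQle
    have : IsDomain (A ⧸ Q) := (Ideal.Quotient.isDomain_iff_prime Q).mpr hQ
    exact ((Ideal.quotEquivOfEq hbot).trans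
      (RingEquiv.quotientBot A)).symm.toMulEquiv.isDomain

end ParamSystem

section ParamSystem

variable {A : Type u} {ι : Type v} [CommRing A] [IsLocalRing A] [IsNoetherianRing A] [Fintype ι]
  {z : ι → A}

theorem IsParamSystem.isDomain (hz : IsParamSystem z) : IsDomain A := isDomain_of_card hz rfl

theorem IsParamSystem.isPrime_span (hz : IsParamSystem z) (T : Finset ι) :
    (Ideal.span (z '' T)).IsPrime := by
  classical
  have := isLocalRing_quotient (span_image_le_maximalIdeal hz T)
  have := (hz.quotient T).isDomain
  exact (Ideal.Quotient.isDomain_iff_prime _).mp this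

/-- A member of a system of parameters does not lie in the ideal generated by other members. -/
theorem IsParamSystem.notMem_span (hz : IsParamSystem z) {T : Finset ι} {i : ι} (hi : i ∉ T) :
    z i ∉ Ideal.span (z '' T) := by
  classical
  intro h
  have := isLocalRing_quotient (span_image_le_maximalIdeal hz T)
  have hq := hz.quotient T
  have h0 : Ideal.Quotient.mk (Ideal.span (z '' T)) (z i) = 0 :=
    Ideal.Quotient.eq_zero_iff_mem.mpr h
  -- If `z i` vanishes in the quotient, the other parameters generate its maximal ideal, and they
  -- are fewer than its dimension.
  have h1 := ringKrullDim_le_card_of_span_eq (span_range_mk_eq (RingHom.id _)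
    Function.surjective_id hq.span_eq (fun k => k ≠ ⟨i, hi⟩) (by
      intro k hk
      obtain rfl := not_not.mp hk
      exact h0))
  have h2 : Fintype.card {i // i ∉ T} ≤
      Fintype.card {k : {i // i ∉ T} // k ≠ ⟨i, hi⟩} := by exact_mod_cast hq.card_le.trans h1
  exact absurd h2 (not_le.mpr (Fintype.card_subtype_lt (x := ⟨i, hi⟩) (by simp)))

end ParamSystem

/-! ### Monomial ideals in a system of parameters -/

section Monomial

variable {A : Type u} {ι : Type v} [CommRing A] [Fintype ι]

/-- The monomial with exponents `β` in the elements `z`. -/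
def monomial (z : ι → A) (β : ι → ℕ) : A := ∏ i, z i ^ β i

@[simp] theorem monomial_zero (z : ι → A) : monomial z 0 = 1 := by simp [monomial]

theorem monomial_add (z : ι → A) (β γ : ι → ℕ) :
    monomial z (β + γ) = monomial z β * monomial z γ := by
  simp [monomial, pow_add, Finset.prod_mul_distrib]

theorem monomial_single [DecidableEq ι] (z : ι → A) (i : ι) (n : ℕ) :
    monomial z (Pi.single i n) = z i ^ n := by
  rw [monomial, Finset.prod_eq_single i]
  · simp
  · intro j _ hj
    simp [hj]
  · simp

/-- Isolates the generator with index `j`, so that inductions can change its exponent alone. -/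
theorem span_image_pow_update {A ι : Type*} [CommRing A] [DecidableEq ι] (z : ι → A)
    {T : Finset ι} (a : ι → ℕ) {j : ι}
    (hj : j ∈ T) (n : ℕ) :
    Ideal.span ((fun i => z i ^ Function.update a j n i) '' T) =
      Ideal.span ((fun i => z i ^ a i) '' (T.erase j : Finset ι)) ⊔ Ideal.span {z j ^ n} := by
  rw [← Ideal.span_union]
  congr 1
  conv_lhs => rw [← Finset.insert_erase hj, Finset.coe_insert, Set.image_insert_eq]
  rw [Function.update_self, Set.union_singleton]
  congr 1
  refine Set.image_congr fun i hi => ?_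
  rw [Function.update_of_ne (Finset.ne_of_mem_erase hi)]

end Monomial

section ParamSystem

variable {A : Type u} {ι : Type v} [CommRing A] [IsLocalRing A] [IsNoetherianRing A] [Fintype ι]
  {z : ι → A}

/-- A member of a system of parameters is a nonzerodivisor modulo powers of other members. -/
theorem IsParamSystem.mem_of_mul_mem (hz : IsParamSystem z) (n : ℕ) :
    ∀ (T : Finset ι) (a : ι → ℕ), (∀ j ∈ T, 1 ≤ a j) → ∑ j ∈ T, a j ≤ n → ∀ i ∉ T, ∀ f : A,
      z i * f ∈ Ideal.span ((fun j => z j ^ a j) '' T) →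
      f ∈ Ideal.span ((fun j => z j ^ a j) '' T) := by
  classical
  induction n with
  | zero =>
    intro T a h1 hs i hi f hf
    have hT : T = ∅ := by
      by_contra hne
      obtain ⟨j, hj⟩ := Finset.nonempty_iff_ne_empty.mpr hne
      have := Finset.single_le_sum (f := a) (fun _ _ => Nat.zero_le _) hj
      have := h1 j hj
      omega
    subst hT
    have h := (hz.isPrime_span ∅).mem_or_mem (x := z i) (y := f) (by simpa using hf)
    simpa using h.resolve_left (hz.notMem_span hi)
  | succ n ih =>
    intro T a h1 hs i hi f hf
    by_cases hall : ∀ j ∈ T, a j = 1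
    · have e : (fun j => z j ^ a j) '' T = z '' T :=
        Set.image_congr fun j hj => by rw [hall j hj, pow_one]
      rw [e] at hf ⊢
      exact ((hz.isPrime_span T).mem_or_mem hf).resolve_left (hz.notMem_span hi)
    push Not at hall
    obtain ⟨j, hj, hj1⟩ := hall
    have hsum : ∀ m, ∑ k ∈ T, Function.update a j m k = m + ∑ k ∈ T.erase j, a k := fun m => by
      rw [← Finset.add_sum_erase T _ hj, Function.update_self]
      congr 1
      exact Finset.sum_congr rfl fun k hk => by
        rw [Function.update_of_ne (Finset.ne_of_mem_erase hk)]
    have hs' : a j + ∑ k ∈ T.erase j, a k ≤ n + 1 := by rwa [Finset.add_sum_erase T _ hj]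
    obtain ⟨b, hb⟩ : ∃ b, a j = b + 1 := ⟨a j - 1, by have := h1 j hj; omega⟩
    have hb1 : 1 ≤ b := by omega
    have hup : ∀ m, 1 ≤ m → ∀ k ∈ T, 1 ≤ Function.update a j m k := fun m hm k hk => by
      by_cases hkj : k = j
      · subst hkj; rwa [Function.update_self]
      · rw [Function.update_of_ne hkj]; exact h1 k hk
    have ihb := ih T (Function.update a j b) (hup b hb1) (by rw [hsum]; omega) i hi
    have ih1 := ih T (Function.update a j 1) (hup 1 le_rfl) (by rw [hsum]; omega) i hi
    have ihe := ih (T.erase j) a (fun k hk => h1 k (Finset.mem_of_mem_erase hk)) (by omega) j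
      (Finset.notMem_erase j T)
    simp only [span_image_pow_update z a hj] at ihb ih1
    have ea := span_image_pow_update z a hj (a j)
    rw [Function.update_eq_self] at ea
    rw [ea, hb] at hf ⊢
    set I := Ideal.span ((fun i => z i ^ a i) '' (T.erase j : Finset ι))
    -- Three smaller cases combine. Exponent `b` at `j` gives `f = g + h * z j ^ b` with `g ∈ I`.
    -- Since `z j` can be cancelled modulo `I`, `z i * h` lies in `I + (z j)`. Exponent 1 at `j`
    -- then gives `h ∈ I + (z j)`, which raises the power of `z j` to `b + 1`.
    have hfb : f ∈ I ⊔ Ideal.span {z j ^ b} := by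
      refine ihb f ((sup_le_sup_left ?_ I) hf)
      rw [Ideal.span_singleton_le_span_singleton]
      exact pow_dvd_pow _ (Nat.le_succ b)
    obtain ⟨g, hg, _, hk, rfl⟩ := Submodule.mem_sup.mp hfb
    obtain ⟨h, rfl⟩ := Ideal.mem_span_singleton'.mp hk
    obtain ⟨g', hg', _, hk', e⟩ := Submodule.mem_sup.mp hf
    obtain ⟨k, rfl⟩ := Ideal.mem_span_singleton'.mp hk'
    have key : ∀ m, ∀ y, z j ^ m * y ∈ I → y ∈ I := by
      intro m
      induction m with
      | zero => intro y hy; simpa using hy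
      | succ m ihm =>
        intro y hy
        exact ihm y (ihe _ (by rwa [pow_succ', mul_assoc] at hy))
    have h2 : z i * h - z j * k ∈ I := by
      refine key b _ ?_
      have : z j ^ b * (z i * h - z j * k) = g' - z i * g := by
        linear_combination (-1 : A) * e
      rw [this]
      exact sub_mem hg' (Ideal.mul_mem_left _ _ hg)
    have h3 : h ∈ I ⊔ Ideal.span {z j ^ 1} := by
      refine ih1 h ?_
      have : z i * h = (z i * h - z j * k) + k * z j ^ 1 := by ring
      rw [this]
      exact add_mem (Ideal.mem_sup_left h2)
        (Ideal.mem_sup_right (Ideal.mem_span_singleton'.mpr ⟨k, rfl⟩))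
    obtain ⟨p, hp, _, hq, rfl⟩ := Submodule.mem_sup.mp h3
    obtain ⟨q, rfl⟩ := Ideal.mem_span_singleton'.mp hq
    have : g + (p + q * z j ^ 1) * z j ^ b = (g + p * z j ^ b) + q * z j ^ (b + 1) := by ring
    rw [this]
    exact add_mem (Ideal.mem_sup_left (add_mem hg (Ideal.mul_mem_right _ _ hp)))
      (Ideal.mem_sup_right (Ideal.mem_span_singleton'.mpr ⟨q, rfl⟩))

/-- Start from `1`, which is not in the maximal ideal, and add one factor at a time: `z i ^ β i` can
be cancelled modulo powers of the other parameters, which lowers the exponent `β i + 1` in the ideal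
to 1. -/
theorem IsParamSystem.prod_notMem (hz : IsParamSystem z) (β : ι → ℕ) (T : Finset ι) :
    haveI := Classical.decEq ι
    ∏ j ∈ T, z j ^ β j ∉ Ideal.span (Set.range fun j => z j ^ (if j ∈ T then β j + 1 else 1)) := by
  classical
  induction T using Finset.induction_on with
  | empty =>
    simp only [Finset.notMem_empty, if_false, pow_one, Finset.prod_empty]
    rw [hz.span_eq]
    exact fun h => (Ideal.ne_top_iff_one _).mp (maximalIdeal.isMaximal A).ne_top h
  | insert i T hi ih =>
    intro hmem
    apply ih
    rw [Finset.prod_insert hi] at hmem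
    set a : ι → ℕ := fun j => if j ∈ insert i T then β j + 1 else 1 with ha
    set b : ι → ℕ := fun j => if j ∈ T then β j + 1 else 1 with hb
    have hbi : b i = 1 := by simp [hb, hi]
    have hai : a i = β i + 1 := by simp [ha]
    have hab : ∀ j, j ≠ i → b j = a j := fun j hj => by simp [ha, hb, hj]
    have hba : b = Function.update a i 1 := by
      funext j
      by_cases hj : j = i
      · subst hj; simpa using hbi
      · rw [Function.update_of_ne hj, hab j hj]
    have ea := span_image_pow_update z a (Finset.mem_univ i) (a i)
    have eb := span_image_pow_update z a (Finset.mem_univ i) 1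
    rw [Function.update_eq_self, Finset.coe_univ, Set.image_univ] at ea
    rw [← hba, Finset.coe_univ, Set.image_univ] at eb
    change _ ∈ Ideal.span (Set.range fun j => z j ^ b j)
    change _ ∈ Ideal.span (Set.range fun j => z j ^ a j) at hmem
    rw [eb]
    rw [ea, hai] at hmem
    set I := Ideal.span ((fun i => z i ^ a i) '' (Finset.univ.erase i : Finset ι))
    set P := ∏ j ∈ T, z j ^ β j
    have key : ∀ m, ∀ y, z i ^ m * y ∈ I → y ∈ I := by
      intro m
      induction m with
      | zero => intro y hy; simpa using hy
      | succ m ihm =>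
        intro y hy
        refine ihm y (hz.mem_of_mul_mem _ (Finset.univ.erase i) a ?_ le_rfl i
          (Finset.notMem_erase _ _) _ (by rwa [pow_succ', mul_assoc] at hy))
        intro j _
        simp only [ha]
        split_ifs <;> omega
    obtain ⟨g, hg, _, hk, e⟩ := Submodule.mem_sup.mp hmem
    obtain ⟨k, rfl⟩ := Ideal.mem_span_singleton'.mp hk
    have h2 : P - z i * k ∈ I := by
      refine key (β i) _ ?_
      have : z i ^ β i * (P - z i * k) = g := by linear_combination (-1 : A) * e
      rwa [this]
    have : P = (P - z i * k) + k * z i ^ 1 := by ring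
    rw [this]
    exact add_mem (Ideal.mem_sup_left h2)
      (Ideal.mem_sup_right (Ideal.mem_span_singleton'.mpr ⟨k, rfl⟩))

/-- Ideals generated by monomials in a regular system of parameters contain no monomials besides the
obvious ones. -/
theorem IsParamSystem.exists_le_of_monomial_mem (hz : IsParamSystem z) {S : Set (ι → ℕ)}
    {β : ι → ℕ} (h : monomial z β ∈ Ideal.span (monomial z '' S)) : ∃ γ ∈ S, γ ≤ β := by
  classical
  by_contra! hS
  -- If no `γ ∈ S` is at most `β`, each generator is divisible by some `z j ^ (β j + 1)`.
  refine hz.prod_notMem β Finset.univ ((Ideal.span_le.mpr ?_) h)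
  rintro _ ⟨γ, hγ, rfl⟩
  obtain ⟨j, hj⟩ : ∃ j, ¬ γ j ≤ β j := by
    by_contra! h'
    exact hS γ hγ h'
  have h1 : z j ^ (β j + 1) ∣ monomial z γ :=
    (pow_dvd_pow _ (by omega)).trans (Finset.dvd_prod_of_mem _ (Finset.mem_univ j))
  refine Ideal.mem_of_dvd _ h1 (Ideal.subset_span ⟨j, ?_⟩)
  simp

end ParamSystem

/-! ### Expansions with unit coefficients -/

section Expansion

variable {A : Type u} {ι : Type v} [CommRing A] [Fintype ι]

theorem span_range_pow_le (z : ι → A) (n : ℕ) :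
    Ideal.span (Set.range z) ^ n ≤ Ideal.span (monomial z '' {γ | ∑ i, γ i = n}) := by
  classical
  induction n with
  | zero =>
    have h : monomial z 0 ∈ Ideal.span (monomial z '' {γ | ∑ i, γ i = 0}) :=
      Ideal.subset_span (Set.mem_image_of_mem _ (by simp))
    rw [monomial_zero] at h
    rw [pow_zero, Ideal.one_eq_top, (Ideal.eq_top_iff_one _).mpr h]
  | succ n ih =>
    rw [pow_succ]
    refine (Ideal.mul_mono_left ih).trans ?_
    rw [Ideal.span_mul_span', Ideal.span_le]
    rintro _ ⟨_, ⟨γ, hγ, rfl⟩, _, ⟨i, rfl⟩, rfl⟩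
    refine Ideal.subset_span ⟨γ + Pi.single i 1, ?_, ?_⟩
    · have hγ : ∑ i, γ i = n := hγ
      simp [Finset.sum_add_distrib, hγ]
    · simp [monomial_add, monomial_single]

theorem exists_sum_monomial_of_mem_pow [DecidableEq ι] (z : ι → A) (n : ℕ) {f : A}
    (hf : f ∈ Ideal.span (Set.range z) ^ n) :
    ∃ a : (ι → ℕ) → A, ∑ γ ∈ Finset.univ.piAntidiag n, a γ * monomial z γ = f := by
  have h := span_range_pow_le z n hf
  have e : ({γ | ∑ i, γ i = n} : Set (ι → ℕ)) = (Finset.univ.piAntidiag n : Finset (ι → ℕ)) := by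
    ext γ
    simp
  rw [e] at h
  exact (Submodule.mem_span_image_finset_iff_exists_fun' A).mp h

theorem monomial_mem_pow [IsLocalRing A] {z : ι → A} (hz : ∀ i, z i ∈ maximalIdeal A)
    (β : ι → ℕ) : monomial z β ∈ maximalIdeal A ^ (∑ i, β i) := by
  rw [← Finset.prod_pow_eq_pow_sum]
  exact Ideal.prod_mem_prod fun i _ => Ideal.pow_mem_pow (hz i) _

theorem monomial_mem_maximalIdeal [IsLocalRing A] {z : ι → A} (hz : ∀ i, z i ∈ maximalIdeal A)
    {β : ι → ℕ} (hβ : β ≠ 0) : monomial z β ∈ maximalIdeal A := by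
  refine Ideal.pow_le_self ?_ (monomial_mem_pow hz β)
  contrapose! hβ
  funext i
  exact (Finset.sum_eq_zero_iff.mp hβ) i (Finset.mem_univ i)

/-- Krull's intersection theorem in `A ⧸ I`. -/
theorem mem_of_forall_mem_sup_pow [IsLocalRing A] [IsNoetherianRing A] {I : Ideal A} {f : A}
    {n : ℕ} (h : ∀ k, n ≤ k → f ∈ I ⊔ maximalIdeal A ^ k) : f ∈ I := by
  have h0 := Ideal.iInf_pow_smul_eq_bot_of_isLocalRing (M := A ⧸ I) (maximalIdeal A)
    (maximalIdeal.isMaximal A).ne_top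
  rw [← Ideal.Quotient.eq_zero_iff_mem, ← Submodule.mem_bot A, ← h0, Submodule.mem_iInf]
  intro k
  have hk : f ∈ I ⊔ maximalIdeal A ^ k :=
    (sup_le_sup_left (Ideal.pow_le_pow_right (le_max_right n k)) I) (h (max n k) (le_max_left _ _))
  obtain ⟨a, ha, b, hb, rfl⟩ := Submodule.mem_sup.mp hk
  rw [map_add, Ideal.Quotient.eq_zero_iff_mem.mpr ha, zero_add]
  have := Submodule.smul_mem_smul hb (Submodule.mem_top (x := (1 : A ⧸ I)) (R := A))
  rwa [← Algebra.algebraMap_eq_smul_one] at this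

/-- Among all approximations of `f` modulo `𝔪 * (S) + 𝔪 ^ n`, with `(S)` the ideal generated by the
monomials in `S`, take one for which `(S)` is maximal. Refining the precision from `k` to `k + 1`
could only add monomials outside `(S)`, which would enlarge that ideal. So `S` serves for every
precision, and Krull's theorem removes the power of `𝔪`. -/
theorem IsParamSystem.exists_approximate_expansion [IsLocalRing A] [IsNoetherianRing A]
    {z : ι → A} (hz : IsParamSystem z) (f : A) :
    ∃ (S : Finset (ι → ℕ)) (c : (ι → ℕ) → Aˣ), f - ∑ β ∈ S, (c β : A) * monomial z β ∈
      maximalIdeal A * Ideal.span (monomial z '' S) := by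
  classical
  let Q : Finset (ι → ℕ) → ((ι → ℕ) → Aˣ) → ℕ → Prop := fun S c n =>
    (∀ β ∈ S, ∑ i, β i < n) ∧ f - ∑ β ∈ S, (c β : A) * monomial z β ∈
      maximalIdeal A * Ideal.span (monomial z '' S) ⊔ maximalIdeal A ^ n
  let F : Set (Ideal A) := {I | ∃ S c n, Q S c n ∧ I = Ideal.span (monomial z '' S)}
  obtain ⟨I, ⟨S, c, n, hQ, rfl⟩, hmax⟩ :=
    set_has_maximal_iff_noetherian.mpr ‹IsNoetherianRing A› F
      ⟨_, ∅, 1, 0, ⟨by simp, by simp⟩, rfl⟩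
  refine ⟨S, c, mem_of_forall_mem_sup_pow (n := n) fun k hk => ?_⟩
  induction k, hk using Nat.le_induction with
  | base => exact hQ.2
  | succ k hk ih =>
    obtain ⟨u, hu, w, hw, e⟩ := Submodule.mem_sup.mp ih
    obtain ⟨a, rfl⟩ := exists_sum_monomial_of_mem_pow z k (by rwa [hz.span_eq])
    set D : Finset (ι → ℕ) := Finset.univ.piAntidiag k with hD
    have hDk : ∀ γ ∈ D, ∑ i, γ i = k := fun γ hγ => by simpa [hD] using hγ
    -- These are the only terms of degree `k` that matter: a non-unit coefficient puts the term in
    -- `𝔪 ^ (k + 1)`, and a proper multiple of a monomial from `S` lies in `𝔪 * (S)`.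
    set T := D.filter fun γ => IsUnit (a γ) ∧ ∀ β ∈ S, ¬ β ≤ γ with hT
    have hST : Disjoint S T := by
      rw [Finset.disjoint_left]
      intro β hβ hβT
      have h1 := hDk β (Finset.mem_filter.mp hβT).1
      have h2 := hQ.1 β hβ
      omega
    let c' : (ι → ℕ) → Aˣ := fun γ => if γ ∈ S then c γ else if h : IsUnit (a γ) then h.unit else 1
    have hrest : ∑ γ ∈ D \ T, a γ * monomial z γ ∈
        maximalIdeal A * Ideal.span (monomial z '' S) ⊔ maximalIdeal A ^ (k + 1) := by
      refine Ideal.sum_mem _ fun γ hγ => ?_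
      obtain ⟨hγD, hγT⟩ := Finset.mem_sdiff.mp hγ
      by_cases hu : IsUnit (a γ)
      · have : ∃ β ∈ S, β ≤ γ := by
          by_contra! h
          exact hγT (Finset.mem_filter.mpr ⟨hγD, hu, h⟩)
        obtain ⟨β, hβ, hle⟩ := this
        refine Ideal.mem_sup_left (Ideal.mul_mem_left _ _ ?_)
        rw [← tsub_add_cancel_of_le hle, monomial_add]
        refine Ideal.mul_mem_mul (monomial_mem_maximalIdeal hz.mem ?_)
          (Ideal.subset_span ⟨β, hβ, rfl⟩)
        intro h0
        have : γ ≤ β := tsub_eq_zero_iff_le.mp h0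
        have := le_antisymm hle this
        subst this
        have h1 := hDk β hγD
        have h2 := hQ.1 β hβ
        omega
      · refine Ideal.mem_sup_right ?_
        rw [pow_succ', ← hDk γ hγD]
        exact Ideal.mul_mem_mul hu (monomial_mem_pow hz.mem γ)
    have hsum : f - ∑ β ∈ S ∪ T, (c' β : A) * monomial z β =
        u + ∑ γ ∈ D \ T, a γ * monomial z γ := by
      rw [Finset.sum_union hST]
      have e1 : ∑ β ∈ S, (c' β : A) * monomial z β = ∑ β ∈ S, (c β : A) * monomial z β :=
        Finset.sum_congr rfl fun β hβ => by simp [c', hβ]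
      have e2 : ∑ β ∈ T, (c' β : A) * monomial z β = ∑ β ∈ T, a β * monomial z β :=
        Finset.sum_congr rfl fun β hβ => by
          have h1 := (Finset.mem_filter.mp hβ).2.1
          simp [c', Finset.disjoint_right.mp hST hβ, h1]
      rw [e1, e2, ← sub_sub, ← e, ← Finset.sum_sdiff (Finset.filter_subset _ D : T ⊆ D)]
      ring
    have hle : Ideal.span (monomial z '' S) ≤ Ideal.span (monomial z '' (S ∪ T : Finset _)) :=
      Ideal.span_mono (Set.image_mono (by simp))
    have hT0 : T = ∅ := by
      rw [Finset.eq_empty_iff_forall_notMem]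
      intro γ hγ
      have hQ' : Q (S ∪ T) c' (k + 1) := by
        refine ⟨fun β hβ => ?_, ?_⟩
        · rcases Finset.mem_union.mp hβ with h | h
          · have := hQ.1 β h
            omega
          · have := hDk β (Finset.mem_filter.mp h).1
            omega
        · rw [hsum]
          exact add_mem (Ideal.mem_sup_left (Ideal.mul_mono_right hle hu))
            (sup_le_sup_right (Ideal.mul_mono_right hle) _ hrest)
      have := hmax _ ⟨S ∪ T, c', k + 1, hQ', rfl⟩
      have heq := eq_of_le_of_not_lt hle this
      have hmem : monomial z γ ∈ Ideal.span (monomial z '' S) := by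
        rw [heq]
        exact Ideal.subset_span ⟨γ, by simp [hγ], rfl⟩
      obtain ⟨β, hβ, hβγ⟩ := hz.exists_le_of_monomial_mem hmem
      exact (Finset.mem_filter.mp hγ).2.2 β hβ hβγ
    rw [← e]
    refine add_mem (Ideal.mem_sup_left hu) ?_
    rwa [hT0, Finset.sdiff_empty] at hrest

/-- Every element of a regular local ring is a finite sum of monomials in a given regular system of
parameters with units as coefficients. -/
theorem IsParamSystem.exists_expansion [IsLocalRing A] [IsNoetherianRing A]
    {z : ι → A} (hz : IsParamSystem z) (f : A) :
    ∃ (S : Finset (ι → ℕ)) (c : (ι → ℕ) → Aˣ), f = ∑ β ∈ S, (c β : A) * monomial z β := by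
  classical
  obtain ⟨S, c, h⟩ := hz.exists_approximate_expansion f
  -- The error is a combination of the same monomials with coefficients in the maximal ideal; adding
  -- these to the coefficients leaves them units.
  have : ∃ m : (ι → ℕ) → A, (∀ β, m β ∈ maximalIdeal A) ∧
      ∑ β ∈ S, m β * monomial z β = f - ∑ β ∈ S, (c β : A) * monomial z β := by
    rw [← smul_eq_mul, Set.image_eq_range] at h
    obtain ⟨a, ha, e⟩ := (Submodule.mem_ideal_smul_span_iff_exists_sum _ _ _).mp h
    refine ⟨fun β => if hβ : β ∈ S then a ⟨β, hβ⟩ else 0, fun β => ?_, ?_⟩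
    · dsimp only
      split_ifs
      · exact ha _
      · exact zero_mem _
    · rw [← e, Finsupp.sum_fintype _ _ (by simp), ← Finset.sum_coe_sort]
      exact Finset.sum_congr rfl fun β _ => by simp
  obtain ⟨m, hm, e⟩ := this
  have hu : ∀ β, IsUnit ((c β : A) + m β) := fun β => by
    by_contra hn
    have h1 : (c β : A) + m β ∈ maximalIdeal A := hn
    have h2 : (c β : A) ∈ maximalIdeal A := by simpa using sub_mem h1 (hm β)
    exact h2 (c β).isUnit
  refine ⟨S, fun β => (hu β).unit, ?_⟩
  simp only [IsUnit.unit_spec, add_mul, Finset.sum_add_distrib, e]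
  ring

end Expansion

/-! ### Weights of exponents -/

section Weight

variable {ι : Type v} [Fintype ι]

/-- The weight of the exponents `β`, when the `i`-th variable has weight `α i`. -/
def weight (α : ι → ℝ≥0) (β : ι → ℕ) : ℝ≥0 := ∑ i, α i * β i

theorem weight_add (α : ι → ℝ≥0) (β γ : ι → ℕ) : weight α (β + γ) = weight α β + weight α γ := by
  simp [weight, mul_add, Finset.sum_add_distrib]

theorem weight_mono (α : ι → ℝ≥0) {β γ : ι → ℕ} (h : β ≤ γ) : weight α β ≤ weight α γ :=
  Finset.sum_le_sum fun i _ => mul_le_mul_right (Nat.cast_le.mpr (h i)) _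

theorem weight_single [DecidableEq ι] (α : ι → ℝ≥0) (i : ι) (n : ℕ) :
    weight α (Pi.single i n) = α i * n := by
  rw [weight, Finset.sum_eq_single i] <;> simp +contextual

theorem eq_of_weight_le {α : ι → ℝ≥0} (hα : ∀ i, 0 < α i) {β γ : ι → ℕ} (h : β ≤ γ)
    (hw : weight α γ ≤ weight α β) : β = γ := by
  rw [← tsub_add_cancel_of_le h, weight_add] at hw
  have h0 : weight α (γ - β) = 0 := by
    have : weight α (γ - β) + weight α β ≤ 0 + weight α β := by rwa [zero_add]
    exact le_antisymm (le_of_add_le_add_right this) zero_le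
  refine le_antisymm h fun i => ?_
  have h1 := (Finset.sum_eq_zero_iff.mp h0) i (Finset.mem_univ i)
  rcases mul_eq_zero.mp h1 with h2 | h2
  · exact absurd h2 (hα i).ne'
  · have : (γ - β) i = 0 := by exact_mod_cast h2
    exact tsub_eq_zero_iff_le.mp this

theorem continuous_weight (β : ι → ℕ) : Continuous fun α : ι → ℝ≥0 => weight α β := by
  unfold weight
  fun_prop

/-- Two finite sets of exponents have elements `β`, `γ` of minimal weight whose sum is not the sum of
other elements of minimal weight. -/
theorem exists_extremal (α : ι → ℝ≥0) {S T : Finset (ι → ℕ)} (hS : S.Nonempty) (hT : T.Nonempty) :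
    ∃ β ∈ S, ∃ γ ∈ T, (∀ β' ∈ S, weight α β ≤ weight α β') ∧ (∀ γ' ∈ T, weight α γ ≤ weight α γ') ∧
      ∀ β' ∈ S, ∀ γ' ∈ T, β' + γ' = β + γ → β' = β ∧ γ' = γ := by
  classical
  -- An arbitrary order of the variables provides a lexicographic order. The lexicographically least
  -- among the exponents of minimal weight do the job, since both weight and lexicographic order are
  -- compatible with addition.
  let e := Fintype.equivFin ι
  let lo : LinearOrder ι := LinearOrder.lift' e e.injective
  have hmin : ∀ U : Finset (ι → ℕ), U.Nonempty → ∃ β ∈ U, (∀ β' ∈ U, weight α β ≤ weight α β') ∧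
      ∀ β' ∈ U, weight α β' ≤ weight α β → toLex β ≤ toLex β' := fun U hU => by
    obtain ⟨β₀, hβ₀, h0⟩ := Finset.exists_min_image U (weight α) hU
    obtain ⟨β, hβ, h1⟩ := Finset.exists_min_image (U.filter fun β => weight α β ≤ weight α β₀) toLex
      ⟨β₀, by simp [hβ₀]⟩
    rw [Finset.mem_filter] at hβ
    refine ⟨β, hβ.1, fun β' h' => hβ.2.trans (h0 β' h'), fun β' h' hw => h1 β' ?_⟩
    exact Finset.mem_filter.mpr ⟨h', hw.trans hβ.2⟩
  obtain ⟨β, hβ, hβ1, hβ2⟩ := hmin S hS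
  obtain ⟨γ, hγ, hγ1, hγ2⟩ := hmin T hT
  refine ⟨β, hβ, γ, hγ, hβ1, hγ1, fun β' hβ' γ' hγ' h => ?_⟩
  have hw : weight α β' + weight α γ' = weight α β + weight α γ := by
    rw [← weight_add, h, weight_add]
  have hb : toLex β ≤ toLex β' := hβ2 β' hβ' <| by
    have := hγ1 γ' hγ'
    by_contra! hlt
    exact absurd hw (add_lt_add_of_lt_of_le hlt this).ne'
  have hc : toLex γ ≤ toLex γ' := hγ2 γ' hγ' <| by
    have := hβ1 β' hβ'
    by_contra! hlt
    exact absurd hw (add_lt_add_of_le_of_lt this hlt).ne'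
  have h' : toLex β' + toLex γ' = toLex β + toLex γ := congrArg toLex h
  have hb' : toLex β = toLex β' := by
    refine hb.eq_of_not_lt fun hlt => absurd h' (add_lt_add_of_lt_of_le hlt hc).ne'
  have : β' = β := (toLex.injective hb').symm
  subst this
  exact ⟨rfl, add_left_cancel h⟩

end Weight

/-- Weights `α ≥ 0` are limits of positive weights. -/
theorem tendsto_add_weight {ι : Type*} (α : ι → ℝ≥0) :
    Filter.Tendsto (fun (e : ℝ≥0) i => α i + e) (𝓝[>] 0) (𝓝 α) := by
  have : Continuous fun (e : ℝ≥0) i => α i + e := by fun_prop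
  have h := this.tendsto 0
  simp only [add_zero] at h
  exact h.mono_left nhdsWithin_le_nhds

section WeightIdeal

variable {A : Type u} {ι : Type v} [CommRing A] [Fintype ι]
  {z : ι → A}

/-- The elements of weight at least `t`, for variables of positive weights. -/
def weightIdeal (z : ι → A) (α : ι → ℝ≥0) (t : ℝ≥0∞) : Ideal A :=
  Ideal.span (monomial z '' {β | t ≤ weight α β})

theorem mul_mem_weightIdeal {α : ι → ℝ≥0} {s t : ℝ≥0∞} {f g : A} (hf : f ∈ weightIdeal z α s)
    (hg : g ∈ weightIdeal z α t) : f * g ∈ weightIdeal z α (s + t) := by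
  have h := Ideal.mul_mem_mul hf hg
  rw [weightIdeal, weightIdeal, Ideal.span_mul_span'] at h
  refine Ideal.span_mono ?_ h
  rintro _ ⟨_, ⟨β, hβ, rfl⟩, _, ⟨γ, hγ, rfl⟩, rfl⟩
  refine ⟨β + γ, ?_, monomial_add z β γ⟩
  simp only [Set.mem_ofPred_eq, weight_add, ENNReal.coe_add]
  exact add_le_add hβ hγ

theorem sum_mem_weightIdeal (z : ι → A) (α : ι → ℝ≥0) (S : Finset (ι → ℕ)) (c : (ι → ℕ) → A) :
    ∑ β ∈ S, c β * monomial z β ∈ weightIdeal z α (S.inf fun β => (weight α β : ℝ≥0∞)) :=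
  Ideal.sum_mem _ fun β hβ => Ideal.mul_mem_left _ _ <| Ideal.subset_span
    ⟨β, Finset.inf_le (f := fun β => (weight α β : ℝ≥0∞)) hβ, rfl⟩

end WeightIdeal

/-! ### Monomial valuations -/

section Valuation

variable {A : Type u} {ι : Type v} [CommRing A] [IsLocalRing A] [IsNoetherianRing A] [Fintype ι]
  {z : ι → A}

/-- A monomial of weight less than `t` is not congruent to a combination of monomials of at least the
same weight modulo elements of weight at least `t`. -/
theorem IsParamSystem.notMem_of_weight_lt (hz : IsParamSystem z) {α : ι → ℝ≥0} (hα : ∀ i, 0 < α i)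
    {κ : Type*} {U : Finset κ} (δ : κ → ι → ℕ) (c : κ → A) {k : κ} (hk : k ∈ U)
    (hu : IsUnit (c k)) (hmin : ∀ l ∈ U, weight α (δ k) ≤ weight α (δ l))
    (hne : ∀ l ∈ U, δ l = δ k → l = k) {t : ℝ≥0∞} (ht : weight α (δ k) < t) :
    ∑ l ∈ U, c l * monomial z (δ l) ∉ weightIdeal z α t := by
  classical
  intro h
  -- The generators allowed once the term `k` is isolated. One of them would have to divide
  -- `monomial z (δ k)`: those of weight at least `t` are too heavy, and another `δ l` of no smaller
  -- weight would have to equal `δ k`.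
  let V : Set (ι → ℕ) := {β | t ≤ weight α β} ∪ δ '' (U.erase k : Finset κ)
  have h1 : monomial z (δ k) ∈ Ideal.span (monomial z '' V) := by
    rw [← Finset.add_sum_erase U _ hk] at h
    have h2 : ∑ l ∈ U.erase k, c l * monomial z (δ l) ∈ Ideal.span (monomial z '' V) :=
      Ideal.sum_mem _ fun l hl => Ideal.mul_mem_left _ _ <| Ideal.subset_span
        ⟨δ l, Or.inr ⟨l, hl, rfl⟩, rfl⟩
    have h3 : weightIdeal z α t ≤ Ideal.span (monomial z '' V) :=
      Ideal.span_mono (Set.image_mono Set.subset_union_left)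
    have h4 := (Submodule.add_mem_iff_left _ h2).mp (h3 h)
    exact (Ideal.unit_mul_mem_iff_mem _ hu).mp h4
  obtain ⟨γ, hγ, hle⟩ := hz.exists_le_of_monomial_mem h1
  rcases hγ with hγ | ⟨l, hl, rfl⟩
  · exact absurd (lt_of_lt_of_le ht hγ) (not_lt.mpr (by exact_mod_cast weight_mono α hle))
  · have hl' : l ∈ U ∧ l ≠ k := by
      have := Finset.mem_erase.mp hl
      exact ⟨this.2, this.1⟩
    exact hl'.2 (hne l hl'.1 (eq_of_weight_le hα hle (hmin l hl'.1)))

/-- The left side depends only on the sum, so the least weight is the same for all expansions with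
unit coefficients. A term of least weight cannot be absorbed by heavier monomials. -/
theorem IsParamSystem.mem_weightIdeal_iff (hz : IsParamSystem z) {α : ι → ℝ≥0}
    (hα : ∀ i, 0 < α i) (S : Finset (ι → ℕ)) (c : (ι → ℕ) → Aˣ) (t : ℝ≥0∞) :
    ∑ β ∈ S, (c β : A) * monomial z β ∈ weightIdeal z α t ↔
      t ≤ S.inf fun β => (weight α β : ℝ≥0∞) := by
  constructor
  · intro h
    rcases S.eq_empty_or_nonempty with rfl | hS
    · simp
    obtain ⟨β, hβ, hmin⟩ := Finset.exists_min_image S (weight α) hS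
    by_contra! hlt
    have hlt : weight α β < t :=
      lt_of_le_of_lt (Finset.le_inf fun γ hγ => by exact_mod_cast hmin γ hγ) hlt
    exact hz.notMem_of_weight_lt hα id (fun β => (c β : A)) hβ (c β).isUnit hmin (fun _ _ h => h)
      hlt h
  · intro h
    refine Ideal.span_mono (Set.image_mono fun β hβ => h.trans hβ)
      (sum_mem_weightIdeal z α S fun β => (c β : A))

/-- The exponents in a chosen expansion of `f` with unit coefficients. -/
noncomputable def IsParamSystem.support (hz : IsParamSystem z) (f : A) : Finset (ι → ℕ) :=
  (hz.exists_expansion f).choose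

/-- The coefficients in a chosen expansion of `f` with unit coefficients. -/
noncomputable def IsParamSystem.coeff (hz : IsParamSystem z) (f : A) : (ι → ℕ) → Aˣ :=
  (hz.exists_expansion f).choose_spec.choose

theorem IsParamSystem.sum_coeff (hz : IsParamSystem z) (f : A) :
    ∑ β ∈ hz.support f, (hz.coeff f β : A) * monomial z β = f :=
  (hz.exists_expansion f).choose_spec.choose_spec.symm

theorem IsParamSystem.support_nonempty (hz : IsParamSystem z) {f : A} (hf : f ≠ 0) :
    (hz.support f).Nonempty := by
  rw [Finset.nonempty_iff_ne_empty]
  intro h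
  have := hz.sum_coeff f
  rw [h, Finset.sum_empty] at this
  exact hf this.symm

/-- The minimal weight of the monomials in an expansion of `f` with unit coefficients. -/
noncomputable def IsParamSystem.order (hz : IsParamSystem z) (α : ι → ℝ≥0) (f : A) : ℝ≥0∞ :=
  (hz.support f).inf fun β => (weight α β : ℝ≥0∞)

/-- The chosen expansion does not involve the weights, so the order is a minimum of finitely many
linear functions of `α`. -/
theorem IsParamSystem.continuous_order (hz : IsParamSystem z) (f : A) :
    Continuous fun α => hz.order α f :=
  Continuous.finset_inf_apply fun β _ => ENNReal.continuous_coe.comp (continuous_weight β)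

theorem IsParamSystem.order_ne_top (hz : IsParamSystem z) (α : ι → ℝ≥0) {f : A} (hf : f ≠ 0) :
    hz.order α f ≠ ⊤ := by
  obtain ⟨β, hβ⟩ := hz.support_nonempty hf
  exact ne_top_of_le_ne_top ENNReal.coe_ne_top (Finset.inf_le hβ)

theorem IsParamSystem.mem_weightIdeal_iff_le_order (hz : IsParamSystem z) {α : ι → ℝ≥0}
    (hα : ∀ i, 0 < α i) (f : A) (t : ℝ≥0∞) : f ∈ weightIdeal z α t ↔ t ≤ hz.order α f := by
  have := hz.mem_weightIdeal_iff hα (hz.support f) (hz.coeff f) t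
  rwa [hz.sum_coeff] at this

theorem IsParamSystem.order_zero (hz : IsParamSystem z) (α : ι → ℝ≥0) : hz.order α 0 = ⊤ := by
  have h : ∀ α : ι → ℝ≥0, (∀ i, 0 < α i) → hz.order α 0 = ⊤ := fun α hα =>
    top_le_iff.mp ((hz.mem_weightIdeal_iff_le_order hα 0 ⊤).mp (zero_mem _))
  -- Weights equal to 1 already show that the chosen expansion is empty, which settles all other
  -- weights, zero included.
  have hS : hz.support (0 : A) = ∅ := by
    by_contra hne
    obtain ⟨β, hβ⟩ := Finset.nonempty_iff_ne_empty.mpr hne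
    have h1 := Finset.inf_le (f := fun β => (weight (1 : ι → ℝ≥0) β : ℝ≥0∞)) hβ
    exact ne_top_of_le_ne_top ENNReal.coe_ne_top h1 (h 1 fun _ => one_pos)
  simp [order, hS]

/-- For the extremal pair of `exists_extremal` the monomial with exponents `β + γ` arises only once
in the product, with a unit coefficient, so it cannot cancel. The other inequality is
multiplicativity of the weight ideals. -/
theorem IsParamSystem.order_mul_of_pos (hz : IsParamSystem z) {α : ι → ℝ≥0} (hα : ∀ i, 0 < α i)
    (f g : A) : hz.order α (f * g) = hz.order α f + hz.order α g := by
  by_cases hf : f = 0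
  · simp [hf, hz.order_zero]
  by_cases hg : g = 0
  · simp [hg, hz.order_zero]
  apply le_antisymm
  · obtain ⟨β, hβ, γ, hγ, h1, h2, h3⟩ :=
      exists_extremal α (hz.support_nonempty hf) (hz.support_nonempty hg)
    have hfβ : (weight α β : ℝ≥0∞) ≤ hz.order α f :=
      Finset.le_inf fun β' h' => by exact_mod_cast h1 β' h'
    have hgγ : (weight α γ : ℝ≥0∞) ≤ hz.order α g :=
      Finset.le_inf fun γ' h' => by exact_mod_cast h2 γ' h'
    refine le_trans ?_ (add_le_add hfβ hgγ)
    rw [← ENNReal.coe_add, ← weight_add]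
    by_contra! hlt
    have hmem := (hz.mem_weightIdeal_iff_le_order hα (f * g) _).mpr le_rfl
    refine hz.notMem_of_weight_lt hα (U := hz.support f ×ˢ hz.support g) (fun p => p.1 + p.2)
      (fun p => (hz.coeff f p.1 : A) * hz.coeff g p.2) (k := (β, γ)) (Finset.mk_mem_product hβ hγ)
      ((Units.isUnit _).mul (Units.isUnit _)) ?_ ?_ hlt ?_
    · rintro ⟨β', γ'⟩ h
      rw [Finset.mem_product] at h
      simp only [weight_add]
      exact add_le_add (h1 _ h.1) (h2 _ h.2)
    · rintro ⟨β', γ'⟩ h he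
      rw [Finset.mem_product] at h
      obtain ⟨rfl, rfl⟩ := h3 β' h.1 γ' h.2 he
      rfl
    · convert hmem using 1
      conv_rhs => rw [← hz.sum_coeff f, ← hz.sum_coeff g, Finset.sum_mul_sum,
        ← Finset.sum_product']
      refine Finset.sum_congr rfl fun p _ => ?_
      rw [monomial_add]
      ring
  · rw [← hz.mem_weightIdeal_iff_le_order hα]
    exact mul_mem_weightIdeal ((hz.mem_weightIdeal_iff_le_order hα f _).mpr le_rfl)
      ((hz.mem_weightIdeal_iff_le_order hα g _).mpr le_rfl)

/-- Both sides are continuous in the weights, and `α + e` is positive for `e > 0`; let `e` tend to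
0. -/
theorem IsParamSystem.order_mul (hz : IsParamSystem z) (α : ι → ℝ≥0) (f g : A) :
    hz.order α (f * g) = hz.order α f + hz.order α g := by
  have h1 := ((hz.continuous_order (f * g)).tendsto α).comp (tendsto_add_weight α)
  have h2 := (((hz.continuous_order f).add (hz.continuous_order g)).tendsto α).comp
    (tendsto_add_weight α)
  refine tendsto_nhds_unique_of_eventuallyEq h1 h2 ?_
  filter_upwards [self_mem_nhdsWithin] with e he
  exact hz.order_mul_of_pos (fun i => add_pos_of_nonneg_of_pos zero_le he) f g

theorem IsParamSystem.min_le_order_add (hz : IsParamSystem z) (α : ι → ℝ≥0) (f g : A) :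
    min (hz.order α f) (hz.order α g) ≤ hz.order α (f + g) := by
  have h1 := ((hz.continuous_order (f + g)).tendsto α).comp (tendsto_add_weight α)
  have h2 := (((hz.continuous_order f).min (hz.continuous_order g)).tendsto α).comp
    (tendsto_add_weight α)
  refine le_of_tendsto_of_tendsto h2 h1 ?_
  filter_upwards [self_mem_nhdsWithin] with e he
  have hα : ∀ i, 0 < α i + e := fun i => add_pos_of_nonneg_of_pos zero_le he
  refine (hz.mem_weightIdeal_iff_le_order hα (f + g) _).mp (add_mem ?_ ?_)
  · exact (hz.mem_weightIdeal_iff_le_order hα f _).mpr (min_le_left _ _)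
  · exact (hz.mem_weightIdeal_iff_le_order hα g _).mpr (min_le_right _ _)

theorem IsParamSystem.order_one (hz : IsParamSystem z) (α : ι → ℝ≥0) : hz.order α 1 = 0 := by
  have h := hz.order_mul α 1 1
  rw [one_mul] at h
  by_contra h0
  have := ENNReal.lt_add_right (hz.order_ne_top α one_ne_zero) h0
  exact this.ne h

/-- The monomial valuation with weights `α` in the regular system of parameters `z`. -/
noncomputable def IsParamSystem.valuation (hz : IsParamSystem z) (α : ι → ℝ≥0) :
    AddValuation A ℝ≥0∞ :=
  AddValuation.of (hz.order α) (hz.order_zero α) (hz.order_one α) (hz.min_le_order_add α)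
    (hz.order_mul α)

theorem IsParamSystem.valuation_apply (hz : IsParamSystem z) (α : ι → ℝ≥0) (f : A) :
    hz.valuation α f = hz.order α f := rfl

theorem addValuation_unit {A : Type*} [CommRing A] (v : AddValuation A ℝ≥0∞) {c : A}
    (hc : IsUnit c) : v c = 0 := by
  obtain ⟨d, hd⟩ := hc.exists_right_inv
  have h := v.map_mul c d
  rw [hd, v.map_one] at h
  exact (add_eq_zero.mp h.symm).1

theorem addValuation_prod {A κ : Type*} [CommRing A] (v : AddValuation A ℝ≥0∞) (U : Finset κ)
    (f : κ → A) : v (∏ i ∈ U, f i) = ∑ i ∈ U, v (f i) := by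
  classical
  induction U using Finset.induction_on with
  | empty => simp
  | insert i U hi ih => rw [Finset.prod_insert hi, Finset.sum_insert hi, v.map_mul, ih]

theorem addValuation_monomial {A : Type u} [CommRing A] (v : AddValuation A ℝ≥0∞) (z : ι → A)
    (β : ι → ℕ) : v (monomial z β) = ∑ i, v (z i) * β i := by
  rw [monomial, addValuation_prod]
  exact Finset.sum_congr rfl fun i _ => by rw [v.map_pow, nsmul_eq_mul, mul_comm]

theorem coe_weight (α : ι → ℝ≥0) (β : ι → ℕ) :
    (weight α β : ℝ≥0∞) = ∑ i, (α i : ℝ≥0∞) * β i := by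
  simp [weight]

/-- A monomial of nonzero weight is divisible by a parameter of positive weight. This makes the
denominators of a localization at such parameters have value 0. -/
theorem IsParamSystem.valuation_eq_zero (hz : IsParamSystem z) {α : ι → ℝ≥0} {f : A}
    (hf : f ∉ Ideal.span (z '' {i | 0 < α i})) : hz.valuation α f = 0 := by
  by_contra h
  refine hf ?_
  rw [← hz.sum_coeff f]
  refine Ideal.sum_mem _ fun β hβ => Ideal.mul_mem_left _ _ ?_
  have hw : weight α β ≠ 0 := fun h0 => h <| by
    have h1 : hz.order α f ≤ weight α β := Finset.inf_le hβ
    rw [h0, ENNReal.coe_zero] at h1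
    exact le_antisymm h1 zero_le
  obtain ⟨i, -, hi⟩ := Finset.exists_ne_zero_of_sum_ne_zero hw
  have hi' : α i ≠ 0 ∧ β i ≠ 0 := by simpa using hi
  have h1 : z i ∈ Ideal.span (z '' {i | 0 < α i}) :=
    Ideal.subset_span (Set.mem_image_of_mem z (pos_iff_ne_zero.mpr hi'.1))
  exact Ideal.mem_of_dvd _ ((dvd_pow_self _ hi'.2).trans
    (Finset.dvd_prod_of_mem (fun i => z i ^ β i) (Finset.mem_univ i))) h1

/-- Minimality of the monomial valuation. -/
theorem IsParamSystem.valuation_le (hz : IsParamSystem z) {α : ι → ℝ≥0} {B : Type*} [CommRing B]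
    (φ : A →+* B) (w : AddValuation B ℝ≥0∞) (hw : ∀ i, (α i : ℝ≥0∞) ≤ w (φ (z i))) (f : A) :
    hz.valuation α f ≤ w (φ f) := by
  change _ ≤ w.comap φ f
  conv_rhs => rw [← hz.sum_coeff f]
  refine (w.comap φ).map_le_sum fun β hβ => ?_
  rw [AddValuation.map_mul, addValuation_monomial, addValuation_unit _ (Units.isUnit _), zero_add]
  refine (Finset.inf_le hβ).trans ?_
  rw [coe_weight]
  exact Finset.sum_le_sum fun i _ => mul_le_mul_left (hw i) _

/-- For positive weights, `z i` is its own expansion, and `mem_weightIdeal_iff` applies to any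
expansion, not only the chosen one. The general case is a limit. -/
theorem IsParamSystem.valuation_apply_param (hz : IsParamSystem z) (α : ι → ℝ≥0) (i : ι) :
    hz.valuation α (z i) = α i := by
  classical
  rw [hz.valuation_apply]
  have key : ∀ α : ι → ℝ≥0, (∀ i, 0 < α i) → hz.order α (z i) = α i := fun α hα => by
    have e : ∑ β ∈ {Pi.single i 1}, (((1 : (ι → ℕ) → Aˣ) β : Aˣ) : A) * monomial z β = z i := by
      simp [monomial_single]
    refine eq_of_forall_le_iff fun t => ?_
    rw [← hz.mem_weightIdeal_iff_le_order hα]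
    conv_lhs => rw [← e]
    rw [hz.mem_weightIdeal_iff hα]
    simp [weight_single]
  have h1 := ((hz.continuous_order (z i)).tendsto α).comp (tendsto_add_weight α)
  have h2 := ((ENNReal.continuous_coe.comp (continuous_apply i)).tendsto α).comp
    (tendsto_add_weight α)
  refine tendsto_nhds_unique_of_eventuallyEq h1 h2 ?_
  filter_upwards [self_mem_nhdsWithin] with e he
  exact key _ fun i => add_pos_of_nonneg_of_pos zero_le he

theorem IsParamSystem.valuation_ne_top (hz : IsParamSystem z) (α : ι → ℝ≥0) {f : A} (hf : f ≠ 0) :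
    hz.valuation α f ≠ ⊤ := hz.order_ne_top α hf

end Valuation

/-! ### Absolute values on fraction fields -/

section AbsoluteValue

variable {A F : Type*} [CommRing A] [IsDomain A] [Field F]

open Classical in
/-- The multiplicative valuation `exp (-v)`. -/
noncomputable def expNegValuation (v : AddValuation A ℝ≥0∞) (hv : ∀ f, f ≠ 0 → v f ≠ ⊤) :
    Valuation A ℝ≥0 where
  toFun f := if f = 0 then 0 else (Real.exp (-(v f).toReal)).toNNReal
  map_zero' := by simp
  map_one' := by simp
  map_mul' f g := by
    by_cases hf : f = 0
    · simp [hf]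
    by_cases hg : g = 0
    · simp [hg]
    simp [hf, hg, v.map_mul, ENNReal.toReal_add (hv f hf) (hv g hg), neg_add_rev, Real.exp_add,
      mul_comm, Real.toNNReal_mul (Real.exp_pos _).le]
  map_add_le_max' f g := by
    by_cases hf : f = 0
    · simp [hf]
    by_cases hg : g = 0
    · simp [hg]
    by_cases hfg : f + g = 0
    · simp [hfg]
    have h := v.map_add f g
    simp only [hf, hg, hfg, if_false, le_max_iff]
    rcases min_le_iff.mp h with h | h
    · exact Or.inl (Real.toNNReal_le_toNNReal
        (Real.exp_le_exp.mpr (neg_le_neg (ENNReal.toReal_mono (hv _ hfg) h))))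
    · exact Or.inr (Real.toNNReal_le_toNNReal
        (Real.exp_le_exp.mpr (neg_le_neg (ENNReal.toReal_mono (hv _ hfg) h))))

theorem expNegValuation_apply (v : AddValuation A ℝ≥0∞) (hv : ∀ f, f ≠ 0 → v f ≠ ⊤) {f : A}
    (hf : f ≠ 0) : (expNegValuation v hv f : ℝ) = Real.exp (-(v f).toReal) := by
  classical
  have h : expNegValuation v hv f = if f = 0 then 0 else (Real.exp (-(v f).toReal)).toNNReal := by
    simp [expNegValuation]
  rw [h, if_neg hf, Real.coe_toNNReal _ (Real.exp_pos _).le]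

theorem exists_absoluteValue (ψ : A →+* F) (hψ : Function.Injective ψ)
    (hfrac : ∀ x, ∃ a b, b ≠ 0 ∧ x = ψ a / ψ b) (v : AddValuation A ℝ≥0∞)
    (hv : ∀ f, f ≠ 0 → v f ≠ ⊤) :
    ∃ N : AbsoluteValue F ℝ, ∀ f, f ≠ 0 → N (ψ f) = Real.exp (-(v f).toReal) := by
  let _ : Algebra A F := ψ.toAlgebra
  have : FaithfulSMul A F := (faithfulSMul_iff_algebraMap_injective A F).mpr hψ
  have : IsFractionRing A F := IsFractionRing.of_field A F fun x => by
    obtain ⟨a, b, -, h⟩ := hfrac x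
    exact ⟨a, b, h⟩
  have hS : nonZeroDivisors A ≤ (expNegValuation v hv).supp.primeCompl := by
    intro f hf h0
    have hf0 := nonZeroDivisors.ne_zero hf
    have h1 : expNegValuation v hv f = 0 := h0
    have h2 := expNegValuation_apply v hv hf0
    rw [h1] at h2
    exact (Real.exp_pos _).ne h2
  let w := (expNegValuation v hv).extendToLocalization hS F
  refine ⟨⟨⟨fun x => (w x : ℝ), fun x y => by simp⟩, fun x => (w x).2, fun x => ?_, fun x y => ?_⟩,
    fun f hf => ?_⟩
  · simp
  · have h := w.map_add x y
    change (w (x + y) : ℝ) ≤ w x + w y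
    exact_mod_cast h.trans (max_le_add_of_nonneg zero_le zero_le)
  · rw [← expNegValuation_apply v hv hf]
    change (w (ψ f) : ℝ) = _
    congr 1
    exact Valuation.extendToLocalization_apply_map_apply _ hS F f

theorem absoluteValue_ext {A F : Type*} [CommRing A] [Field F] (ψ : A →+* F)
    (hfrac : ∀ x, ∃ a b, b ≠ 0 ∧ x = ψ a / ψ b) {N N' : AbsoluteValue F ℝ}
    (h : ∀ f, N (ψ f) = N' (ψ f)) : N = N' := by
  ext x
  obtain ⟨a, b, -, rfl⟩ := hfrac x
  rw [map_div₀, map_div₀, h, h]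

/-- Points of the analytification are not ultrametric by definition; this supplies the property
needed for a valuation ring. Over a common denominator it reduces to elements of `A`. -/
theorem add_le_max_of_addValuation (ψ : A →+* F)
    (hfrac : ∀ x, ∃ a b, b ≠ 0 ∧ x = ψ a / ψ b) (v : AddValuation A ℝ≥0∞)
    (hv : ∀ f, f ≠ 0 → v f ≠ ⊤) {N : AbsoluteValue F ℝ}
    (hN : ∀ f, f ≠ 0 → N (ψ f) = Real.exp (-(v f).toReal)) (x y : F) :
    N (x + y) ≤ max (N x) (N y) := by
  have hN' : ∀ f, N (ψ f) = expNegValuation v hv f := fun f => by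
    by_cases hf : f = 0
    · simp [hf]
    · rw [hN f hf, expNegValuation_apply v hv hf]
  obtain ⟨a, b, hb, rfl⟩ := hfrac x
  obtain ⟨c, d, hd, rfl⟩ := hfrac y
  by_cases hb' : ψ b = 0
  · simp [hb']
  by_cases hd' : ψ d = 0
  · simp [hd']
  have h1 : ψ a / ψ b + ψ c / ψ d = ψ (a * d + c * b) / ψ (b * d) := by
    rw [map_add, map_mul, map_mul, map_mul]
    field_simp
  have h2 : ψ a / ψ b = ψ (a * d) / ψ (b * d) := by
    rw [map_mul, map_mul]
    field_simp
  have h3 : ψ c / ψ d = ψ (c * b) / ψ (b * d) := by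
    rw [map_mul, map_mul]
    field_simp
  rw [h1, h2, h3, map_div₀ N, map_div₀ N, map_div₀ N, max_div_div_right (N.nonneg _)]
  gcongr
  rw [hN', hN', hN']
  exact_mod_cast (expNegValuation v hv).map_add _ _

end AbsoluteValue

section Field

variable (R : Type u) [CommRing R] [IsDomain R] [IsDiscreteValuationRing R]
variable {K : Type u} [Field K] [Algebra R K] [IsFractionRing R K]

theorem fieldAbs_of_isUnit {a : R} (ha : IsUnit a) : fieldAbs R K (algebraMap R K a) = 1 :=
  (IsDedekindDomain.HeightOneSpectrum.adicAbv_coe_eq_one_iff _ _ _).mpr fun h =>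
    (mem_nonunits_iff.mp ((mem_maximalIdeal a).mp h)) ha

theorem fieldAbs_of_irreducible {p : R} (hp : Irreducible p) :
    fieldAbs R K (algebraMap R K p) = Real.exp (-1) := by
  let w : IsDedekindDomain.HeightOneSpectrum R :=
    ⟨maximalIdeal R, inferInstance, IsDiscreteValuationRing.not_a_field R⟩
  have h := w.intValuation_singleton hp.ne_zero hp.maximalIdeal_eq
  have key : ∀ (b : ℝ≥0) (hb : 1 < b),
      ((WithZeroMulInt.toNNReal (ne_zero_of_lt hb) (w.valuation K (algebraMap R K p)) : ℝ≥0) : ℝ) =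
        (b : ℝ)⁻¹ := fun b hb => by
    rw [IsDedekindDomain.HeightOneSpectrum.valuation_of_algebraMap, h,
      WithZeroMulInt.toNNReal_neg_apply _ WithZero.exp_ne_zero]
    change ((b ^ (-1 : ℤ) : ℝ≥0) : ℝ) = _
    rw [zpow_neg_one, NNReal.coe_inv]
  exact (key ⟨Real.exp 1, (Real.exp_pos 1).le⟩ (Real.one_lt_exp_iff.mpr one_pos)).trans
    (Real.exp_neg 1).symm

/-- An absolute value on `K` that has the right values on units and uniformizers of `R` is the
canonical one. -/
theorem eq_fieldAbs {p : R} (hp : Irreducible p) {N : K → ℝ} (hmul : ∀ a b, N (a * b) = N a * N b)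
    (h0 : N 0 = 0) (hu : ∀ a : R, IsUnit a → N (algebraMap R K a) = 1)
    (h1 : N (algebraMap R K p) = Real.exp (-1)) (a : K) : N a = fieldAbs R K a := by
  let N' : K →*₀ ℝ := ⟨⟨N, h0⟩, by simpa using hu 1 isUnit_one, hmul⟩
  have key : ∀ r : R, N' (algebraMap R K r) = fieldAbs R K (algebraMap R K r) := fun r => by
    by_cases hr : r = 0
    · simp [hr]
    obtain ⟨n, c, rfl⟩ := IsDiscreteValuationRing.eq_unit_mul_pow_irreducible hr hp
    have e1 : N' (algebraMap R K p) = Real.exp (-1) := h1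
    have e2 : N' (algebraMap R K c) = 1 := hu c c.isUnit
    simp only [map_mul, map_pow, e1, e2, fieldAbs_of_isUnit R c.isUnit,
      fieldAbs_of_irreducible R hp]
  obtain ⟨x, y, -, rfl⟩ := IsFractionRing.div_surjective (A := R) a
  change N' _ = _
  rw [map_div₀, map_div₀, key, key]

end Field

/-! ### Generizations of a point and primes of its local ring -/

section Stalk

variable {X : Scheme.{u}}

/-- The prime ideal of the local ring at `x` that corresponds to a generization `y` of `x`. -/
noncomputable def stalkPrime {x y : X} (h : y ⤳ x) : Ideal (X.presheaf.stalk x) :=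
  (maximalIdeal (X.presheaf.stalk y)).comap (X.presheaf.stalkSpecializes h).hom

instance {x y : X} (h : y ⤳ x) : (stalkPrime h).IsPrime :=
  inferInstanceAs ((maximalIdeal (X.presheaf.stalk y)).comap _).IsPrime

theorem mem_stalkPrime {x y : X} {h : y ⤳ x} {f : X.presheaf.stalk x} :
    f ∈ stalkPrime h ↔
      (X.presheaf.stalkSpecializes h).hom f ∈ maximalIdeal (X.presheaf.stalk y) := Iff.rfl

theorem fromSpecStalk_stalkPrime {x y : X} (h : y ⤳ x) :
    X.fromSpecStalk x ⟨stalkPrime h, inferInstance⟩ = y := by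
  have h1 := X.SpecMap_stalkSpecializes_fromSpecStalk h
  have h2 := X.fromSpecStalk_closedPoint (x := y)
  exact (congrArg (fun g : Spec (X.presheaf.stalk y) ⟶ X => g (closedPoint _)) h1).trans h2

/-- The spectrum of the local ring embeds in `X` with the generizations of `x` as image. -/
theorem exists_stalkPrime_eq {x : X} (P : Ideal (X.presheaf.stalk x)) [hP : P.IsPrime] :
    ∃ (y : X) (h : y ⤳ x), stalkPrime h = P := by
  have h : X.fromSpecStalk x ⟨P, hP⟩ ⤳ x := by
    have : X.fromSpecStalk x ⟨P, hP⟩ ∈ Set.range (X.fromSpecStalk x) := ⟨_, rfl⟩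
    rwa [Scheme.range_fromSpecStalk] at this
  refine ⟨_, h, ?_⟩
  have := (X.fromSpecStalk x).isEmbedding.injective (fromSpecStalk_stalkPrime h)
  exact congrArg PrimeSpectrum.asIdeal this

theorem specializes_iff_stalkPrime_le {x y y' : X} (h : y ⤳ x) (h' : y' ⤳ x) :
    y ⤳ y' ↔ stalkPrime h ≤ stalkPrime h' := by
  have e := (X.fromSpecStalk x).isEmbedding.isInducing.specializes_iff
    (x := ⟨stalkPrime h, inferInstance⟩) (y := ⟨stalkPrime h', inferInstance⟩)
  rw [fromSpecStalk_stalkPrime h, fromSpecStalk_stalkPrime h'] at e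
  exact e.trans (PrimeSpectrum.le_iff_specializes _ _).symm

theorem stalkPrime_self {x : X} (h : x ⤳ x) :
    stalkPrime h = maximalIdeal (X.presheaf.stalk x) := by
  obtain ⟨y, hy, e⟩ := exists_stalkPrime_eq (maximalIdeal (X.presheaf.stalk x))
  refine le_antisymm (le_maximalIdeal (Ideal.IsPrime.ne_top inferInstance)) ?_
  rw [← e]
  exact (specializes_iff_stalkPrime_le hy h).mp hy

/-- The local ring at a generization is a localization: every element is a fraction. -/
theorem exists_mul_stalkSpecializes_eq {x y : X} (h : y ⤳ x) (b : X.presheaf.stalk y) :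
    ∃ a s : X.presheaf.stalk x, IsUnit ((X.presheaf.stalkSpecializes h).hom s) ∧
      b * (X.presheaf.stalkSpecializes h).hom s = (X.presheaf.stalkSpecializes h).hom a := by
  obtain ⟨_, ⟨U, hU, rfl⟩, hxU, -⟩ :=
    X.isBasis_affineOpens.exists_subset_of_mem_open (Set.mem_univ x) isOpen_univ
  have hyU : y ∈ U := h.mem_open U.2 hxU
  let _ : Algebra Γ(X, U) (X.presheaf.stalk y) := X.presheaf.algebra_section_stalk ⟨y, hyU⟩
  have := hU.isLocalization_stalk ⟨y, hyU⟩
  obtain ⟨⟨f, s⟩, e⟩ := IsLocalization.surj (hU.primeIdealOf ⟨y, hyU⟩).asIdeal.primeCompl b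
  have key : ∀ g : Γ(X, U), (X.presheaf.stalkSpecializes h).hom (X.presheaf.germ U x hxU g) =
      algebraMap Γ(X, U) (X.presheaf.stalk y) g := fun g => by
    rw [← CommRingCat.comp_apply, TopCat.Presheaf.germ_stalkSpecializes]
    rfl
  refine ⟨X.presheaf.germ U x hxU f, X.presheaf.germ U x hxU s, ?_, ?_⟩
  · rw [key]
    exact IsLocalization.map_units _ s
  · rw [key, key]
    exact e

theorem stalkSpecializes_injective {x y : X} (h : y ⤳ x) [IsDomain (X.presheaf.stalk x)] :
    Function.Injective (X.presheaf.stalkSpecializes h).hom := by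
  obtain ⟨_, ⟨U, hU, rfl⟩, hxU, -⟩ :=
    X.isBasis_affineOpens.exists_subset_of_mem_open (Set.mem_univ x) isOpen_univ
  have hyU : y ∈ U := h.mem_open U.2 hxU
  have key : ∀ g : Γ(X, U), (X.presheaf.stalkSpecializes h).hom (X.presheaf.germ U x hxU g) =
      X.presheaf.germ U y hyU g := fun g => by
    rw [← CommRingCat.comp_apply, TopCat.Presheaf.germ_stalkSpecializes]
  rw [injective_iff_map_eq_zero]
  intro a ha
  let _ : Algebra Γ(X, U) (X.presheaf.stalk y) := X.presheaf.algebra_section_stalk ⟨y, hyU⟩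
  let _ : Algebra Γ(X, U) (X.presheaf.stalk x) := X.presheaf.algebra_section_stalk ⟨x, hxU⟩
  have := hU.isLocalization_stalk ⟨y, hyU⟩
  have := hU.isLocalization_stalk ⟨x, hxU⟩
  obtain ⟨⟨f, s⟩, e⟩ := IsLocalization.surj (hU.primeIdealOf ⟨x, hxU⟩).asIdeal.primeCompl a
  have e : a * X.presheaf.germ U x hxU s.1 = X.presheaf.germ U x hxU f := e
  have hs : IsUnit (X.presheaf.germ U x hxU s.1) :=
    IsLocalization.map_units (X.presheaf.stalk x) s
  have hf : X.presheaf.germ U y hyU f = 0 := by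
    rw [← key, ← e, map_mul, ha, zero_mul]
  have hf' : algebraMap Γ(X, U) (X.presheaf.stalk y) f = 0 := hf
  rw [IsLocalization.map_eq_zero_iff (hU.primeIdealOf ⟨y, hyU⟩).asIdeal.primeCompl] at hf'
  obtain ⟨t, ht⟩ := hf'
  -- The denominator `t` is a unit at `y`, so its germ at `x` is nonzero and can be cancelled in the
  -- domain.
  have ht' : X.presheaf.germ U x hxU t.1 ≠ 0 := fun h0 => by
    have h1 : IsUnit (X.presheaf.germ U y hyU t.1) :=
      IsLocalization.map_units (X.presheaf.stalk y) t
    rw [← key, h0, map_zero] at h1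
    exact not_isUnit_zero h1
  have h2 : X.presheaf.germ U x hxU t.1 * X.presheaf.germ U x hxU f = 0 := by
    rw [← map_mul, ht, map_zero]
  have h3 := (mul_eq_zero.mp h2).resolve_left ht'
  rw [h3] at e
  exact (hs.mul_left_eq_zero).mp e

/-- The local ring at a point that corresponds to the zero ideal is a field. -/
theorem maximalIdeal_eq_bot_of_stalkPrime_eq_bot {x y : X} (h : y ⤳ x) (h0 : stalkPrime h = ⊥) :
    maximalIdeal (X.presheaf.stalk y) = ⊥ := by
  rw [eq_bot_iff]
  intro b hb
  obtain ⟨a, s, hs, e⟩ := exists_mul_stalkSpecializes_eq h b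
  have ha : a ∈ stalkPrime h := by
    rw [mem_stalkPrime, ← e]
    exact Ideal.mul_mem_right _ _ hb
  rw [h0, Ideal.mem_bot] at ha
  rw [ha, map_zero] at e
  exact (hs.mul_left_eq_zero).mp e

/-- Primes at a generization `y` of `x` are extended from the local ring at `x`. -/
theorem stalkPrime_eq_map {x y w : X} (h : y ⤳ x) (hw : w ⤳ y) (hwx : w ⤳ x) :
    stalkPrime hw = (stalkPrime hwx).map (X.presheaf.stalkSpecializes h).hom := by
  have hcomp : ∀ a, (X.presheaf.stalkSpecializes hw).hom ((X.presheaf.stalkSpecializes h).hom a) =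
      (X.presheaf.stalkSpecializes hwx).hom a := fun a => by
    rw [← CommRingCat.comp_apply, TopCat.Presheaf.stalkSpecializes_comp]
  apply le_antisymm
  · intro b hb
    obtain ⟨a, s, hs, e⟩ := exists_mul_stalkSpecializes_eq h b
    have ha : a ∈ stalkPrime hwx := by
      rw [mem_stalkPrime, ← hcomp, ← e, map_mul]
      exact Ideal.mul_mem_right _ _ hb
    rw [← Ideal.mul_unit_mem_iff_mem _ hs, e]
    exact Ideal.mem_map_of_mem _ ha
  · rw [Ideal.map_le_iff_le_comap]
    intro a ha
    rw [Ideal.mem_comap, mem_stalkPrime, hcomp]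
    exact ha

theorem stalkPrime_map_self {x y : X} (h : y ⤳ x) :
    maximalIdeal (X.presheaf.stalk y) =
      (stalkPrime h).map (X.presheaf.stalkSpecializes h).hom := by
  rw [← stalkPrime_self (specializes_refl y)]
  exact stalkPrime_eq_map h _ h

end Stalk

/-! ### Connected components in Noetherian spaces -/

section Topology

variable {T : Type*} [TopologicalSpace T] [QuasiSober T]

/-- If in a Noetherian space each point of a closed set has a most generic generization inside the set,
then the connected components of the set are irreducible. -/
theorem connectedComponentIn_eq_closure [TopologicalSpace.NoetherianSpace T] {S : Set T}
    (hS : IsClosed S)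
    (h : ∀ x ∈ S, ∃ ξ ∈ S, ξ ⤳ x ∧ ∀ y ∈ S, y ⤳ x → ξ ⤳ y) {x ξ : T} (hx : x ∈ S) (hξ : ξ ∈ S)
    (hξx : ξ ⤳ x) (hgen : ∀ y ∈ S, y ⤳ x → ξ ⤳ y) :
    connectedComponentIn S x = closure {ξ} := by
  have hsub : closure {ξ} ⊆ S := hS.closure_subset_iff.mpr (by simpa)
  have hgen' : ∀ y ∈ S, y ⤳ ξ → ξ ⤳ y := fun y hy h => hgen y hy (h.trans hξx)
  obtain ⟨F, hF, hFc, hFi, hFS⟩ :=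
    TopologicalSpace.NoetherianSpace.exists_finite_set_isClosed_irreducible hS
  -- The union of the finitely many irreducible pieces not contained in `closure {ξ}`. It will be
  -- disjoint from `closure {ξ}`: at a common point, the most generic generization specializes to
  -- both `ξ` and the generic point of the piece, which puts the piece inside `closure {ξ}`.
  set U : Set T := ⋃ Z ∈ {Z ∈ F | ¬ Z ⊆ closure {ξ}}, Z with hU
  have hUc : IsClosed U := (hF.subset (Set.sep_subset _ _)).isClosed_biUnion fun Z hZ => hFc Z hZ.1
  have hdisj : Disjoint (closure {ξ}) U := by
    rw [Set.disjoint_left]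
    intro y hy hyU
    obtain ⟨Z, ⟨hZF, hZ⟩, hyZ⟩ := Set.mem_iUnion₂.mp hyU
    obtain ⟨η, hη⟩ := QuasiSober.sober (hFi Z hZF) (hFc Z hZF)
    obtain ⟨ζ, hζS, -, hζ⟩ := h y (hsub hy)
    have h1 : ζ ⤳ ξ := hζ ξ hξ (specializes_iff_mem_closure.mpr hy)
    have h2 : ζ ⤳ η := hζ η (hFS ▸ ⟨Z, hZF, hη.mem⟩) (hη.specializes hyZ)
    refine hZ ?_
    rw [← hη.def]
    exact ((hgen' ζ hζS h1).trans h2).closure_subset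
  have hcov : S ⊆ closure {ξ} ∪ U := fun y hy => by
    rw [hFS] at hy
    obtain ⟨Z, hZF, hyZ⟩ := hy
    by_cases hZ : Z ⊆ closure {ξ}
    · exact Or.inl (hZ hyZ)
    · exact Or.inr (Set.mem_biUnion (show Z ∈ {Z ∈ F | ¬ Z ⊆ closure {ξ}} from ⟨hZF, hZ⟩) hyZ)
  have hxξ : x ∈ closure {ξ} := specializes_iff_mem_closure.mp hξx
  apply Set.Subset.antisymm
  · rcases (isPreconnected_iff_subset_of_disjoint_closed.mp
      (isPreconnected_connectedComponentIn (F := S) (x := x))) _ _ isClosed_closure hUc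
      ((connectedComponentIn_subset S x).trans hcov)
      (by rw [hdisj.inter_eq, Set.inter_empty]) with h1 | h1
    · exact h1
    · exact absurd (h1 (mem_connectedComponentIn hx)) (Set.disjoint_left.mp hdisj hxξ)
  · exact (isPreconnected_singleton.closure).subset_connectedComponentIn hxξ hsub

end Topology

/-! ### Special and generic fibre of a model -/

theorem isLocalizationAway_of_irreducible {R K : Type*} [CommRing R] [IsDomain R]
    [IsDiscreteValuationRing R] [Field K] [Algebra R K] [IsFractionRing R K] {p : R}
    (hp : Irreducible p) : IsLocalization.Away p K := by
  have hp0 : algebraMap R K p ≠ 0 := by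
    rw [Ne, IsFractionRing.to_map_eq_zero_iff]
    exact hp.ne_zero
  refine ⟨?_, ?_, ?_⟩
  · rintro ⟨_, n, rfl⟩
    simpa using (isUnit_iff_ne_zero.mpr hp0).pow n
  · intro x
    obtain ⟨a, b, hb, rfl⟩ := IsFractionRing.div_surjective (A := R) x
    have hb0 := nonZeroDivisors.ne_zero hb
    obtain ⟨n, c, rfl⟩ := IsDiscreteValuationRing.eq_unit_mul_pow_irreducible hb0 hp
    refine ⟨(a * (c⁻¹ : Rˣ), ⟨p ^ n, n, rfl⟩), ?_⟩
    have hc : algebraMap R K c ≠ 0 := (c.isUnit.map (algebraMap R K)).ne_zero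
    have e : algebraMap R K (c⁻¹ : Rˣ) * algebraMap R K c = 1 := by
      rw [← map_mul, Units.inv_mul, map_one]
    simp only [map_mul, map_pow]
    field_simp
    linear_combination (-algebraMap R K a) * e
  · intro a b h
    exact ⟨1, by rw [IsFractionRing.injective R K h]⟩

namespace Model

set_option linter.unusedSectionVars false

variable {R : Type u} [CommRing R] [IsDomain R] [IsDiscreteValuationRing R]
variable {K : Type u} [Field K] [Algebra R K] [IsFractionRing R K]
variable {X : Scheme.{u}} {sX : X ⟶ Spec (.of K)} (M : Model R sX)

theorem isNoetherian_total : IsNoetherian M.total := by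
  have := M.locallyOfFiniteType
  have := M.quasiCompact
  have : IsLocallyNoetherian M.total := LocallyOfFiniteType.isLocallyNoetherian M.str
  have : CompactSpace M.total := QuasiCompact.compactSpace_of_compactSpace M.str
  exact {}

/-- `K` is `R` with a uniformizer inverted, and open immersions are stable under base change. -/
theorem isOpenImmersion_incl : IsOpenImmersion M.incl := by
  obtain ⟨p, hp⟩ := IsDiscreteValuationRing.exists_irreducible R
  have := isLocalizationAway_of_irreducible (K := K) hp
  have : IsOpenImmersion (Spec.map (CommRingCat.ofHom (algebraMap R K))) :=
    IsOpenImmersion.of_isLocalization p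
  exact MorphismProperty.of_isPullback M.isPullback.flip this

/-- `Spec R` has only one point besides the closed one, and compatible pairs of points lift to the
fibre product. -/
theorem exists_incl_eq {x : M.total} (hx : x ∉ M.specialFiber) : ∃ p, M.incl p = x := by
  obtain ⟨q, hq⟩ : ∃ q : Spec (.of K),
      (Spec.map (CommRingCat.ofHom (algebraMap R K))) q = M.str x := by
    refine ⟨(⟨⊥, Ideal.isPrime_bot⟩ : PrimeSpectrum K), ?_⟩
    have h1 : (M.str x : PrimeSpectrum R).asIdeal = ⊥ := by
      by_contra h0
      have h2 : (M.str x : PrimeSpectrum R).asIdeal = maximalIdeal R :=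
        IsLocalRing.eq_maximalIdeal ((M.str x : PrimeSpectrum R).2.isMaximal h0)
      exact hx (PrimeSpectrum.ext h2)
    refine PrimeSpectrum.ext ?_
    rw [h1]
    change Ideal.comap (algebraMap R K) ⊥ = ⊥
    rw [← RingHom.ker_eq_comap_bot, (RingHom.injective_iff_ker_eq_bot _).mp
      (IsFractionRing.injective R K)]
  obtain ⟨p, hp, -⟩ := Scheme.exists_preimage_of_isPullback M.isPullback x q hq.symm
  exact ⟨p, hp⟩

theorem toStalk_comp {x y : M.total} (h : y ⤳ x) :
    M.toStalk x ≫ M.total.presheaf.stalkSpecializes h = M.toStalk y := by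
  apply Spec.map_injective
  rw [Spec.map_comp, toStalk, toStalk, Spec.map_preimage, Spec.map_preimage,
    Scheme.SpecMap_stalkSpecializes_fromSpecStalk_assoc]

theorem map_specialIdeal {x y : M.total} (h : y ⤳ x) :
    (M.specialIdeal x).map (M.total.presheaf.stalkSpecializes h).hom = M.specialIdeal y := by
  rw [specialIdeal, specialIdeal, Ideal.map_map, ← CommRingCat.hom_comp, toStalk_comp]

theorem mem_specialFiber_iff (x : M.total) :
    x ∈ M.specialFiber ↔ M.specialIdeal x ≤ maximalIdeal (M.total.presheaf.stalk x) := by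
  have h1 : M.str x = Spec.map (M.toStalk x) (closedPoint _) := by
    rw [toStalk, Spec.map_preimage]
    exact congrArg M.str (M.total.fromSpecStalk_closedPoint (x := x)).symm
  have h2 : (M.str x : PrimeSpectrum R).asIdeal =
      (maximalIdeal (M.total.presheaf.stalk x)).comap (M.toStalk x).hom := by
    rw [h1]
    rfl
  rw [specialIdeal, Ideal.map_le_iff_le_comap, ← h2]
  constructor
  · intro h
    have h : M.str x = closedPoint R := h
    rw [h]
    exact le_rfl
  · intro h
    refine PrimeSpectrum.ext ?_
    exact ((maximalIdeal.isMaximal R).eq_of_le (M.str x : PrimeSpectrum R).2.ne_top h).symm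

theorem mem_specialFiber_iff_of_specializes {x y : M.total} (h : y ⤳ x) :
    y ∈ M.specialFiber ↔ M.specialIdeal x ≤ stalkPrime h := by
  rw [mem_specialFiber_iff, ← M.map_specialIdeal h, Ideal.map_le_iff_le_comap]
  rfl

theorem isClosed_specialFiber : IsClosed M.specialFiber :=
  (isClosed_singleton_closedPoint R).preimage M.str.continuous

end Model

/-- A regular local ring has a regular system of parameters. -/
theorem exists_isParamSystem (A : Type u) [CommRing A] [IsRegularLocalRing A] :
    ∃ (d : ℕ) (z : Fin d → A), IsParamSystem z := by
  obtain ⟨s, hs, hspan⟩ := Submodule.FG.exists_span_finset_card_eq_spanFinrank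
    (p := maximalIdeal A) (IsNoetherian.noetherian _)
  refine ⟨s.card, fun i => s.equivFin.symm i, ?_, ?_⟩
  · rw [← hspan]
    congr 1
    ext a
    constructor
    · rintro ⟨i, rfl⟩
      exact (s.equivFin.symm i).2
    · intro ha
      exact ⟨s.equivFin ⟨a, ha⟩, by simp⟩
  · rw [Fintype.card_fin, hs, IsRegularLocalRing.spanFinrank_maximalIdeal]

theorem isDomain_of_isRegularLocalRing (A : Type u) [CommRing A] [IsRegularLocalRing A] :
    IsDomain A := by
  obtain ⟨d, z, hz⟩ := exists_isParamSystem A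
  exact hz.isDomain

/-! ### The generic point and the function field -/

namespace Model

set_option linter.unusedSectionVars false

variable {R : Type u} [CommRing R] [IsDomain R] [IsDiscreteValuationRing R]
variable {K : Type u} [Field K] [Algebra R K] [IsFractionRing R K]
variable {X : Scheme.{u}} {sX : X ⟶ Spec (.of K)} (M : Model R sX)

theorem evalAt_comp {p : X} {ξ : M.total} (h : M.incl p ⤳ ξ) :
    M.toStalk ξ ≫ M.evalAt p ξ h =
      CommRingCat.ofHom (algebraMap R K) ≫ toResidueField sX p := by
  apply Spec.map_injective
  have h1 : Spec.map (toResidueField sX p) = X.fromSpecResidueField p ≫ sX := Spec.map_preimage _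
  have h2 : Spec.map (M.toStalk ξ) = M.total.fromSpecStalk ξ ≫ M.str := Spec.map_preimage _
  rw [Spec.map_comp, Spec.map_comp, h1, h2, Category.assoc, ← M.isPullback.w, evalAt, Spec.map_comp,
    Spec.map_comp, Scheme.fromSpecResidueField]
  simp only [Category.assoc, Scheme.SpecMap_stalkSpecializes_fromSpecStalk_assoc,
    Scheme.SpecMap_stalkMap_fromSpecStalk_assoc]

theorem toResidueField_algebraMap {p : X} {ξ : M.total} (h : M.incl p ⤳ ξ) (a : R) :
    (toResidueField sX p).hom (algebraMap R K a) =
      (M.evalAt p ξ h).hom ((M.toStalk ξ).hom a) := by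
  have := congrArg (fun g => g.hom a) (M.evalAt_comp h)
  exact this.symm

theorem evalAt_stalkSpecializes {p : X} {x y : M.total} (h : M.incl p ⤳ y) (hyx : y ⤳ x)
    (h' : M.incl p ⤳ x) (f : M.total.presheaf.stalk x) :
    (M.evalAt p y h).hom ((M.total.presheaf.stalkSpecializes hyx).hom f) =
      (M.evalAt p x h').hom f := by
  rw [← CommRingCat.comp_apply, evalAt, evalAt, TopCat.Presheaf.stalkSpecializes_comp_assoc]

variable {M}

theorem IsSncd.isDomain_stalk (hM : M.IsSncd) (x : M.total) :
    IsDomain (M.total.presheaf.stalk x) :=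
  have := hM.regular x
  isDomain_of_isRegularLocalRing _

theorem IsSncd.isNoetherianRing_stalk (hM : M.IsSncd) (x : M.total) :
    IsNoetherianRing (M.total.presheaf.stalk x) :=
  have := hM.regular x
  inferInstance

theorem IsSncd.exists_param (hM : M.IsSncd) {x : M.total} (hx : x ∈ M.specialFiber) :
    ∃ (d : ℕ) (z : Fin d → M.total.presheaf.stalk x) (N : Fin d → ℕ), IsParamSystem z ∧
      M.specialIdeal x = Ideal.span {∏ j, z j ^ N j} := by
  obtain ⟨d, z, N, hd, hz, hN⟩ := hM.snc x hx
  exact ⟨d, z, N, ⟨hz, by rw [hd, Fintype.card_fin]⟩, hN⟩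

end Model

theorem IsParamSystem.ne_zero {A : Type u} {ι : Type v} [CommRing A] [IsLocalRing A]
    [IsNoetherianRing A] [Fintype ι] {z : ι → A} (hz : IsParamSystem z) (i : ι) : z i ≠ 0 := by
  have h := hz.notMem_span (Finset.notMem_empty i)
  rintro h0
  exact h (h0 ▸ zero_mem _)

namespace Model

set_option linter.unusedSectionVars false

variable {R : Type u} [CommRing R] [IsDomain R] [IsDiscreteValuationRing R]
variable {K : Type u} [Field K] [Algebra R K] [IsFractionRing R K]
variable {X : Scheme.{u}} {sX : X ⟶ Spec (.of K)} {M : Model R sX}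

/-- The generator is a product of nonzero elements of a domain. This keeps the generic point of the
model outside the special fibre. -/
theorem IsSncd.specialIdeal_ne_bot (hM : M.IsSncd) {x : M.total} (hx : x ∈ M.specialFiber) :
    M.specialIdeal x ≠ ⊥ := by
  have := hM.isDomain_stalk x
  have := hM.isNoetherianRing_stalk x
  obtain ⟨d, z, N, hz, hN⟩ := hM.exists_param hx
  rw [hN, Ne, Ideal.span_singleton_eq_bot]
  exact Finset.prod_ne_zero_iff.mpr fun j _ => pow_ne_zero _ (hz.ne_zero j)

theorem IsSncd.isDomain_stalk_incl (hM : M.IsSncd) (p : X) : IsDomain (X.presheaf.stalk p) := by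
  have := M.isOpenImmersion_incl
  have := hM.isDomain_stalk (M.incl p)
  exact (asIso (M.incl.stalkMap p)).commRingCatIsoToRingEquiv.symm.toMulEquiv.isDomain _

/-- The zero ideal of each local ring, a domain, gives a most generic generization, so connected
components are irreducible; `X` is connected. -/
theorem IsSncd.exists_isGenericPoint [ConnectedSpace X] (hM : M.IsSncd) :
    ∃ η : X, IsGenericPoint η (Set.univ : Set X) := by
  have := M.isOpenImmersion_incl
  have := M.isNoetherian_total
  have hN : TopologicalSpace.NoetherianSpace X :=
    M.incl.isOpenEmbedding.isInducing.noetherianSpace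
  have h : ∀ x ∈ (Set.univ : Set X), ∃ ξ ∈ (Set.univ : Set X), ξ ⤳ x ∧
      ∀ y ∈ (Set.univ : Set X), y ⤳ x → ξ ⤳ y := fun x _ => by
    have := hM.isDomain_stalk_incl x
    obtain ⟨ξ, hξ, e⟩ := exists_stalkPrime_eq (⊥ : Ideal (X.presheaf.stalk x))
    exact ⟨ξ, trivial, hξ, fun y _ hy => (specializes_iff_stalkPrime_le hξ hy).mpr (e ▸ bot_le)⟩
  obtain ⟨x⟩ : Nonempty X := inferInstance
  obtain ⟨ξ, -, hξx, hξ⟩ := h x trivial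
  refine ⟨ξ, ?_⟩
  have e := connectedComponentIn_eq_closure isClosed_univ h trivial trivial hξx hξ
  rw [connectedComponentIn_univ, PreconnectedSpace.connectedComponent_eq_univ] at e
  exact e.symm

/-- The point of the zero ideal is not in the special fibre, hence comes from `X`, and then must be
the generic point. -/
theorem IsSncd.exists_stalkPrime_eq_bot (hM : M.IsSncd) {η : X}
    (hη : IsGenericPoint η (Set.univ : Set X)) (ξ : M.total) :
    ∃ h : M.incl η ⤳ ξ, stalkPrime h = ⊥ := by
  have := hM.isDomain_stalk ξ
  obtain ⟨y, hy, e⟩ := exists_stalkPrime_eq (⊥ : Ideal (M.total.presheaf.stalk ξ))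
  have hys : y ∉ M.specialFiber := fun h => by
    have hξ : ξ ∈ M.specialFiber := hy.mem_closed M.isClosed_specialFiber h
    rw [M.mem_specialFiber_iff_of_specializes hy, e, le_bot_iff] at h
    exact hM.specialIdeal_ne_bot hξ h
  obtain ⟨p, rfl⟩ := M.exists_incl_eq hys
  have h1 : M.incl η ⤳ M.incl p := (hη.specializes trivial).map M.incl.continuous
  have h2 : M.incl p ⤳ M.incl η :=
    (specializes_iff_stalkPrime_le hy (h1.trans hy)).mpr (e ▸ bot_le)
  have h3 : M.incl η = M.incl p := (h1.antisymm h2).eq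
  refine ⟨h1.trans hy, ?_⟩
  rw [← le_bot_iff, ← e]
  exact (specializes_iff_stalkPrime_le (h1.trans hy) hy).mp h1

theorem IsSncd.incl_specializes (hM : M.IsSncd) {η : X}
    (hη : IsGenericPoint η (Set.univ : Set X)) (ξ : M.total) : M.incl η ⤳ ξ :=
  (hM.exists_stalkPrime_eq_bot hη ξ).1

theorem evalAt_eq {p : X} {ξ : M.total} (h : M.incl p ⤳ ξ) (f : M.total.presheaf.stalk ξ) :
    (M.evalAt p ξ h).hom f = (M.incl.stalkMap p ≫ X.residue p).hom
      ((M.total.presheaf.stalkSpecializes h).hom f) := rfl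

/-- The local ring at `M.incl η` is a field, so nothing is lost on passing to the residue field.
With `exists_evalAt_div`, the residue field is the fraction field of the local ring at `ξ`. -/
theorem IsSncd.evalAt_injective (hM : M.IsSncd) {η : X}
    (hη : IsGenericPoint η (Set.univ : Set X)) {ξ : M.total} (h : M.incl η ⤳ ξ) :
    Function.Injective (M.evalAt η ξ h).hom := by
  have := hM.isDomain_stalk ξ
  obtain ⟨h', e⟩ := hM.exists_stalkPrime_eq_bot hη ξ
  have hbot := maximalIdeal_eq_bot_of_stalkPrime_eq_bot h' e
  rw [injective_iff_map_eq_zero]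
  intro f hf
  rw [evalAt_eq, ← RingHom.mem_ker] at hf
  have h1 := le_maximalIdeal (RingHom.ker_ne_top (M.incl.stalkMap η ≫ X.residue η).hom) hf
  rw [hbot, Ideal.mem_bot] at h1
  exact (injective_iff_map_eq_zero _).mp (stalkSpecializes_injective h) f h1

theorem exists_evalAt_div {η : X} {ξ : M.total} (h : M.incl η ⤳ ξ)
    (x : X.residueField η) :
    ∃ a b, b ≠ 0 ∧ x = (M.evalAt η ξ h).hom a / (M.evalAt η ξ h).hom b := by
  have := M.isOpenImmersion_incl
  obtain ⟨c, rfl⟩ := X.residue_surjective η x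
  obtain ⟨b, rfl⟩ := (ConcreteCategory.bijective_of_isIso (M.incl.stalkMap η)).2 c
  obtain ⟨a, s, hs, e⟩ := exists_mul_stalkSpecializes_eq h b
  have hu : (M.evalAt η ξ h).hom s ≠ 0 := (hs.map (M.incl.stalkMap η ≫ X.residue η).hom).ne_zero
  refine ⟨a, s, fun h0 => hu (by rw [h0, map_zero]), ?_⟩
  rw [eq_div_iff hu, evalAt_eq, evalAt_eq, ← e, map_mul]
  rfl

end Model

/-! ### Local domains with principal maximal ideal -/

section DiscreteValuation

set_option linter.unusedSectionVars false

variable {B : Type u} [CommRing B] [IsDomain B] [IsLocalRing B] [IsNoetherianRing B] {t : B}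

theorem isPrincipalIdealRing_of_span (ht : Ideal.span {t} = maximalIdeal B) :
    IsPrincipalIdealRing B :=
  ((tfae_of_isNoetherianRing_of_isLocalRing_of_isDomain B).out 4 0).mp
    (show (maximalIdeal B).IsPrincipal from ⟨⟨t, ht.symm⟩⟩)

theorem irreducible_of_span (ht : Ideal.span {t} = maximalIdeal B) (h0 : t ≠ 0) :
    Irreducible t := by
  refine Prime.irreducible ((Ideal.span_singleton_prime h0).mp ?_)
  rw [ht]
  infer_instance

theorem ord_pow_of_span (ht : Ideal.span {t} = maximalIdeal B) (h0 : t ≠ 0) (n : ℕ) :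
    Ring.ord B (t ^ n) = n := by
  have := isPrincipalIdealRing_of_span ht
  rw [Ring.ord_pow (mem_nonZeroDivisors_of_ne_zero h0),
    Ring.ord_of_irreducible (irreducible_of_span ht h0), nsmul_one]

theorem exists_eq_unit_mul_pow (ht : Ideal.span {t} = maximalIdeal B) (h0 : t ≠ 0) {f : B}
    (hf : f ≠ 0) : ∃ (n : ℕ) (c : Bˣ), f = c * t ^ n := by
  have := isPrincipalIdealRing_of_span ht
  have : IsDiscreteValuationRing B := ⟨fun h => h0 (by
    rw [← Ideal.mem_bot, ← h, ← ht]
    exact Ideal.mem_span_singleton_self t)⟩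
  exact IsDiscreteValuationRing.eq_unit_mul_pow_irreducible hf (irreducible_of_span ht h0)

end DiscreteValuation

/-! ### Components, strata and charts -/

namespace Model

set_option linter.unusedSectionVars false

variable {R : Type u} [CommRing R] [IsDomain R] [IsDiscreteValuationRing R]
variable {K : Type u} [Field K] [Algebra R K] [IsFractionRing R K]
variable {X : Scheme.{u}} {sX : X ⟶ Spec (.of K)} {M : Model R sX}

theorem Component.isClosed (i : M.Component) : IsClosed i.1 := by
  have h : closure i.1 ⊆ i.1 := i.2.2 ⟨i.2.1.1.closure,
    M.isClosed_specialFiber.closure_subset_iff.mpr i.2.1.2⟩ subset_closure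
  exact closure_subset_iff_isClosed.mp h

theorem Component.isGenericPoint (i : M.Component) : IsGenericPoint (M.genericPt i) i.1 := by
  have h := i.2.1.1.isGenericPoint_genericPoint_closure
  rwa [i.isClosed.closure_eq] at h

theorem genericPt_mem_specialFiber (i : M.Component) : M.genericPt i ∈ M.specialFiber :=
  i.2.1.2 i.isGenericPoint.mem

theorem Component.mem_iff (i : M.Component) {x : M.total} : x ∈ i.1 ↔ M.genericPt i ⤳ x :=
  i.isGenericPoint.specializes_iff_mem.symm

theorem eq_genericPt {i : M.Component} {y : M.total} (hy : y ∈ M.specialFiber)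
    (h : y ⤳ M.genericPt i) : y = M.genericPt i := by
  have h1 : i.1 ⊆ closure {y} := by
    rw [← i.isGenericPoint.def]
    exact h.closure_subset
  have h2 := i.2.2 ⟨isIrreducible_singleton.closure,
    M.isClosed_specialFiber.closure_subset_iff.mpr (by simpa using hy)⟩ h1
  have h3 : M.genericPt i ⤳ y := i.mem_iff.mp (h2 (subset_closure rfl))
  exact (h.antisymm h3).eq

theorem component_ext {i j : M.Component} (h : M.genericPt i = M.genericPt j) : i = j := by
  refine Subtype.ext ?_
  rw [← i.isGenericPoint.def, ← j.isGenericPoint.def, h]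

theorem idealAt_eq {i : M.Component} {x : M.total} (h : M.genericPt i ⤳ x) :
    M.idealAt i.1 x = stalkPrime h := by
  apply le_antisymm
  · exact iInf_le_of_le (M.genericPt i) (iInf_le_of_le h (iInf_le_of_le i.isGenericPoint.mem le_rfl))
  · refine le_iInf fun y => le_iInf fun hy => le_iInf fun hyi => ?_
    exact (specializes_iff_stalkPrime_le h hy).mp (i.mem_iff.mp hyi)

theorem mem_stratum {J : Finset M.Component} {x : M.total} :
    x ∈ M.stratum J ↔ ∀ i ∈ J, M.genericPt i ⤳ x := by
  simp only [stratum, Set.mem_iInter, Component.mem_iff]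

theorem isClosed_stratum (J : Finset M.Component) : IsClosed (M.stratum J) :=
  isClosed_biInter fun i _ => i.isClosed

theorem mem_specialFiber_of_mem_stratum {J : Finset M.Component} (hJ : J.Nonempty) {x : M.total}
    (hx : x ∈ M.stratum J) : x ∈ M.specialFiber := by
  obtain ⟨i, hi⟩ := hJ
  exact i.2.1.2 (i.mem_iff.mpr (mem_stratum.mp hx i hi))

section Point

variable {x : M.total} [IsNoetherianRing (M.total.presheaf.stalk x)] {d : ℕ}
  {z : Fin d → M.total.presheaf.stalk x} {N : Fin d → ℕ}

/-- The components through a point are given by members of the system of parameters. -/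
theorem exists_span_eq_stalkPrime (hz : IsParamSystem z)
    (hN : M.specialIdeal x = Ideal.span {∏ j, z j ^ N j}) {i : M.Component}
    (h : M.genericPt i ⤳ x) : ∃ j, N j ≠ 0 ∧ Ideal.span {z j} = stalkPrime h := by
  have h1 := (M.mem_specialFiber_iff_of_specializes h).mp (M.genericPt_mem_specialFiber i)
  rw [hN, Ideal.span_singleton_le_iff_mem, Ideal.IsPrime.prod_mem_iff] at h1
  obtain ⟨j, -, hj⟩ := h1
  have hNj : N j ≠ 0 := fun h0 => by
    rw [h0, pow_zero] at hj
    exact (Ideal.ne_top_iff_one _).mp (Ideal.IsPrime.ne_top inferInstance) hj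
  have hzj : z j ∈ stalkPrime h := Ideal.IsPrime.mem_of_pow_mem inferInstance _ hj
  refine ⟨j, hNj, ?_⟩
  have hp := hz.isPrime_span {j}
  rw [Finset.coe_singleton, Set.image_singleton] at hp
  -- The prime `(z j)` belongs to a point of the special fibre that specializes to the generic point
  -- of the component; by maximality of the component the two points agree.
  obtain ⟨y, hy, e⟩ := exists_stalkPrime_eq (Ideal.span {z j})
  have hys : y ∈ M.specialFiber := by
    rw [M.mem_specialFiber_iff_of_specializes hy, e, hN, Ideal.span_singleton_le_span_singleton]
    exact (dvd_pow_self _ hNj).trans (Finset.dvd_prod_of_mem (fun j => z j ^ N j) (Finset.mem_univ j))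
  have hyi : y ⤳ M.genericPt i := by
    rw [specializes_iff_stalkPrime_le hy h, e, Ideal.span_singleton_le_iff_mem]
    exact hzj
  obtain rfl := eq_genericPt hys hyi
  exact e.symm

/-- At the generic point of the component `z j` is a uniformizer and the other parameters are units,
so the special fibre is cut out by `z j ^ N j`, and the length is `N j`. -/
theorem mult_eq (hM : M.IsSncd) (hz : IsParamSystem z)
    (hN : M.specialIdeal x = Ideal.span {∏ j, z j ^ N j}) {i : M.Component}
    (h : M.genericPt i ⤳ x) {j : Fin d} (hj : Ideal.span {z j} = stalkPrime h) :
    M.mult i = N j := by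
  classical
  have := hM.isDomain_stalk x
  have := hM.isDomain_stalk (M.genericPt i)
  have := hM.isNoetherianRing_stalk (M.genericPt i)
  set φ := (M.total.presheaf.stalkSpecializes h).hom
  have ht : Ideal.span {φ (z j)} = maximalIdeal _ := by
    rw [stalkPrime_map_self h, ← hj, Ideal.map_span, Set.image_singleton]
  have ht0 : φ (z j) ≠ 0 := fun h0 =>
    hz.ne_zero j (stalkSpecializes_injective h (h0.trans (map_zero φ).symm))
  have hunit : ∀ k, k ≠ j → IsUnit (φ (z k)) := fun k hk => by
    by_contra hn
    have h1 : z k ∈ stalkPrime h := hn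
    have h2 := hz.notMem_span (T := {j}) (i := k) (by simpa using hk)
    rw [Finset.coe_singleton, Set.image_singleton, hj] at h2
    exact h2 h1
  have hs : M.specialIdeal (M.genericPt i) = Ideal.span {φ (z j) ^ N j} := by
    rw [← M.map_specialIdeal h, hN, Ideal.map_span, Set.image_singleton, map_prod,
      ← Finset.mul_prod_erase _ _ (Finset.mem_univ j), map_pow]
    refine Ideal.span_singleton_mul_right_unit ?_ _
    refine Finset.prod_induction _ IsUnit (fun _ _ => IsUnit.mul) isUnit_one fun k hk => ?_
    rw [map_pow]
    exact (hunit k (Finset.ne_of_mem_erase hk)).pow _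
  have ho := ord_pow_of_span ht ht0 (N j)
  rw [Ring.ord, ← hs] at ho
  rw [mult, ho, ENat.toNat_natCast]

/-- A point of a stratum has a most generic generization in the stratum; its ideal is generated by the
local equations of the components. -/
theorem exists_generic_of_param (hz : IsParamSystem z) {J : Finset M.Component}
    (hx : ∀ i ∈ J, M.genericPt i ⤳ x) (j : J → Fin d)
    (hj : ∀ i : J, Ideal.span {z (j i)} = stalkPrime (hx i.1 i.2)) :
    ∃ (ξ : M.total) (h : ξ ⤳ x), ξ ∈ M.stratum J ∧ (∀ y ∈ M.stratum J, y ⤳ x → ξ ⤳ y) ∧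
      stalkPrime h = Ideal.span (z '' Set.range j) := by
  classical
  have hp := hz.isPrime_span (Finset.univ.image j)
  rw [Finset.coe_image, Finset.coe_univ, Set.image_univ] at hp
  obtain ⟨ξ, hξ, e⟩ := exists_stalkPrime_eq (Ideal.span (z '' Set.range j))
  refine ⟨ξ, hξ, mem_stratum.mpr fun i hi => ?_, fun y hy hyx => ?_, e⟩
  · rw [specializes_iff_stalkPrime_le (hx i hi) hξ, e, ← hj ⟨i, hi⟩]
    exact Ideal.span_mono (Set.singleton_subset_iff.mpr
      (Set.mem_image_of_mem z (Set.mem_range_self (⟨i, hi⟩ : J))))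
  · rw [specializes_iff_stalkPrime_le hξ hyx, e, Ideal.span_le]
    rintro _ ⟨_, ⟨i, rfl⟩, rfl⟩
    have h1 := (specializes_iff_stalkPrime_le (hx i.1 i.2) hyx).mp (mem_stratum.mp hy i.1 i.2)
    exact h1 (hj i ▸ Ideal.mem_span_singleton_self _)

end Point

theorem IsSncd.exists_generic (hM : M.IsSncd) {J : Finset M.Component} (hJ : J.Nonempty) :
    ∀ x ∈ M.stratum J, ∃ ξ ∈ M.stratum J, ξ ⤳ x ∧ ∀ y ∈ M.stratum J, y ⤳ x → ξ ⤳ y := by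
  intro x hx
  have := hM.isNoetherianRing_stalk x
  obtain ⟨d, z, N, hz, hN⟩ := hM.exists_param (mem_specialFiber_of_mem_stratum hJ hx)
  have hx' := mem_stratum.mp hx
  choose j hj using fun i : J => exists_span_eq_stalkPrime hz hN (hx' i.1 i.2)
  obtain ⟨ξ, h1, h2, h3, -⟩ := exists_generic_of_param hz hx' j fun i => (hj i).2
  exact ⟨ξ, h2, h1, h3⟩

theorem isComponentOf_closure_iff {S : Set M.total} (hS : IsClosed S) {ξ : M.total} :
    IsComponentOf (closure {ξ}) S ↔ ξ ∈ S ∧ ∀ y ∈ S, y ⤳ ξ → ξ ⤳ y := by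
  constructor
  · intro h
    refine ⟨h.1.2 (subset_closure rfl), fun y hy hyξ => ?_⟩
    have h1 : closure {y} ≤ closure {ξ} := h.2
      ⟨isIrreducible_singleton.closure, hS.closure_subset_iff.mpr (by simpa using hy)⟩
      hyξ.closure_subset
    exact specializes_iff_mem_closure.mpr (h1 (subset_closure rfl))
  · rintro ⟨h1, h2⟩
    refine ⟨⟨isIrreducible_singleton.closure, hS.closure_subset_iff.mpr (by simpa using h1)⟩,
      fun W hW hle => ?_⟩
    obtain ⟨η, hη⟩ := QuasiSober.sober hW.1.closure isClosed_closure
    have h3 : η ⤳ ξ := hη.specializes (subset_closure (hle (subset_closure rfl)))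
    have h4 : η ∈ S := hS.closure_subset_iff.mpr hW.2 hη.mem
    refine subset_closure.trans ?_
    rw [← hη.def]
    exact (h2 η h4 h3).closure_subset

/-- At a generic point of a stratum, the local equations of the components form a regular system of
parameters, and the special fibre is given by the monomial with the multiplicities as exponents. -/
theorem IsSncd.exists_chart (hM : M.IsSncd) {J : Finset M.Component} (hJ : J.Nonempty) {ξ : M.total}
    (hξ : IsComponentOf (closure {ξ}) (M.stratum J)) :
    ∃ z : J → M.total.presheaf.stalk ξ, IsParamSystem z ∧
      (∀ i, Ideal.span {z i} = M.idealAt i.1.1 ξ) ∧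
      M.specialIdeal ξ = Ideal.span {∏ i, z i ^ M.mult i.1} ∧ ∀ i : J, 0 < M.mult i.1 := by
  classical
  rw [isComponentOf_closure_iff (isClosed_stratum J)] at hξ
  have := hM.isNoetherianRing_stalk ξ
  obtain ⟨d, z, N, hz, hN⟩ := hM.exists_param (mem_specialFiber_of_mem_stratum hJ hξ.1)
  have hx' := mem_stratum.mp hξ.1
  choose j hj using fun i : J => exists_span_eq_stalkPrime hz hN (hx' i.1 i.2)
  obtain ⟨ξ', h1, h2, h3, h4⟩ := exists_generic_of_param hz hx' j fun i => (hj i).2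
  obtain rfl : ξ = ξ' := ((hξ.2 ξ' h2 h1).antisymm h1).eq
  have hinj : Function.Injective j := fun i i' hii => by
    refine Subtype.ext (component_ext ?_)
    have e : stalkPrime (hx' i.1 i.2) = stalkPrime (hx' i'.1 i'.2) := by
      rw [← (hj i).2, ← (hj i').2, hii]
    exact (((specializes_iff_stalkPrime_le _ _).mpr e.le).antisymm
      ((specializes_iff_stalkPrime_le _ _).mpr e.ge)).eq
  -- As `ξ` is generic in the stratum, the parameters in the range of `j` generate the whole maximal
  -- ideal, which contains every `z k`; `notMem_span` leaves no further parameter.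
  have hsurj : Function.Surjective j := fun k => by
    by_contra hk
    have hk' : k ∉ Finset.univ.image j := by simpa using hk
    have h5 := hz.notMem_span hk'
    rw [Finset.coe_image, Finset.coe_univ, Set.image_univ, ← h4, stalkPrime_self] at h5
    exact h5 (hz.mem k)
  let e : J ≃ Fin d := Equiv.ofBijective j ⟨hinj, hsurj⟩
  have hmult : ∀ i : J, M.mult i.1 = N (j i) := fun i => mult_eq hM hz hN (hx' i.1 i.2) (hj i).2
  refine ⟨fun i => z (j i), ⟨?_, ?_⟩, fun i => ?_, ?_, fun i => ?_⟩
  · rw [← hz.span_eq, ← hsurj.range_comp z]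
    rfl
  · rw [Fintype.card_congr e]
    exact hz.card_le
  · rw [idealAt_eq (hx' i.1 i.2), (hj i).2]
  · rw [hN, ← e.prod_comp]
    simp only [hmult]
    rfl
  · rw [hmult]
    exact Nat.pos_of_ne_zero (hj i).1

end Model

/-! ### Monomial points -/

/-- A real valuation extends to a localization if it vanishes on the denominators. -/
theorem exists_addValuation_extension {A B : Type*} [CommRing A] [CommRing B] (φ : A →+* B)
    (hφ : Function.Injective φ) (hfrac : ∀ b, ∃ a s, IsUnit (φ s) ∧ b * φ s = φ a)
    (v : AddValuation A ℝ≥0∞) (hv : ∀ s, IsUnit (φ s) → v s = 0) :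
    ∃ w : AddValuation B ℝ≥0∞, ∀ a, w (φ a) = v a := by
  choose n d hd e using hfrac
  have key : ∀ b a s, IsUnit (φ s) → b * φ s = φ a → v (n b) = v a := fun b a s hs h => by
    have h1 : n b * s = a * d b := hφ (by
      rw [map_mul, map_mul, ← e, ← h]
      ring)
    have h2 := congrArg v h1
    rwa [v.map_mul, v.map_mul, hv s hs, hv _ (hd b), add_zero, add_zero] at h2
  refine ⟨AddValuation.of (fun b => v (n b)) ?_ ?_ ?_ ?_, fun a => ?_⟩
  · rw [key 0 0 1 (by simp) (by simp), v.map_zero]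
  · rw [key 1 1 1 (by simp) (by simp), v.map_one]
  · intro b c
    change min (v (n b)) (v (n c)) ≤ v (n (b + c))
    rw [key (b + c) (n b * d c + n c * d b) (d b * d c)
      (by rw [map_mul]; exact (hd b).mul (hd c))
      (by rw [map_mul, map_add, map_mul, map_mul, ← e, ← e]; ring)]
    refine le_trans (le_of_eq ?_) (v.map_add _ _)
    rw [v.map_mul, v.map_mul, hv _ (hd b), hv _ (hd c), add_zero, add_zero]
  · intro b c
    change v (n (b * c)) = v (n b) + v (n c)
    rw [key (b * c) (n b * n c) (d b * d c) (by rw [map_mul]; exact (hd b).mul (hd c))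
      (by rw [map_mul, map_mul, ← e, ← e]; ring), v.map_mul]
  · exact key (φ a) a 1 (by simp) (by simp)

namespace Model

set_option linter.unusedSectionVars false

variable {R : Type u} [CommRing R] [IsDomain R] [IsDiscreteValuationRing R]
variable {K : Type u} [Field K] [Algebra R K] [IsFractionRing R K]
variable {X : Scheme.{u}} {sX : X ⟶ Spec (.of K)} {M : Model R sX}

/-- `x` is the birational point whose absolute value is `exp (-v)` on the local ring at `ξ`. -/
structure HasValuation (ξ : M.total) (v : AddValuation (M.total.presheaf.stalk ξ) ℝ≥0∞)
    (x : Analytification R sX) : Prop where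
  birational : x.IsBirational
  abs_eq : ∃ h : M.incl x.pt ⤳ ξ, ∀ f, f ≠ 0 →
    x.abs ((M.evalAt x.pt ξ h).hom f) = Real.exp (-(v f).toReal)

theorem HasValuation.unique {ξ : M.total} {v : AddValuation (M.total.presheaf.stalk ξ) ℝ≥0∞}
    {x x' : Analytification R sX} (h : HasValuation ξ v x) (h' : HasValuation ξ v x') : x = x' := by
  obtain ⟨hb, hs, ha⟩ := h
  obtain ⟨hb', hs', ha'⟩ := h'
  obtain ⟨p, N, hN⟩ := x
  obtain ⟨p', N', hN'⟩ := x'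
  obtain rfl : p = p' := hb.eq hb'
  congr 1
  refine absoluteValue_ext (M.evalAt p ξ hs).hom (exists_evalAt_div hs) fun f => ?_
  by_cases hf : f = 0
  · simp [hf]
  · exact (ha f hf).trans (ha' f hf).symm

/-- Passage to a generization. -/
theorem HasValuation.generization (hM : M.IsSncd) {ξ ξ' : M.total} (h : ξ' ⤳ ξ)
    {v : AddValuation (M.total.presheaf.stalk ξ) ℝ≥0∞}
    {w : AddValuation (M.total.presheaf.stalk ξ') ℝ≥0∞}
    (hw : ∀ f, w ((M.total.presheaf.stalkSpecializes h).hom f) = v f)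
    {x : Analytification R sX} (hx : HasValuation ξ v x) : HasValuation ξ' w x := by
  obtain ⟨hb, hs, ha⟩ := hx
  have hs' := hM.incl_specializes hb ξ'
  refine ⟨hb, hs', fun f hf => ?_⟩
  obtain ⟨a, s, hsu, e⟩ := exists_mul_stalkSpecializes_eq h f
  have := hM.isDomain_stalk ξ'
  have hs0 : s ≠ 0 := fun h0 => by
    rw [h0, map_zero] at hsu
    exact not_isUnit_zero hsu
  have ha0 : a ≠ 0 := fun h0 => by
    rw [h0, map_zero] at e
    exact hf ((hsu.mul_left_eq_zero).mp e)
  have hvs : v s = 0 := by rw [← hw, addValuation_unit _ hsu]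
  have hva : w f = v a := by
    rw [← hw, ← e, w.map_mul, addValuation_unit _ hsu, add_zero]
  have h1 := congrArg (fun b => x.abs ((M.evalAt x.pt ξ' hs').hom b)) e
  simp only [map_mul] at h1
  rw [M.evalAt_stalkSpecializes hs' h hs, M.evalAt_stalkSpecializes hs' h hs, ha s hs0, ha a ha0,
    hvs] at h1
  rw [hva]
  simpa using h1

theorem IsMonomialPoint.exists_hasValuation {J : Finset M.Component} {α : J → ℝ} {ξ : M.total}
    {x : Analytification R sX} (h : M.IsMonomialPoint J α ξ x) :
    ∃ v, M.IsMonomialValuation J α ξ v ∧ HasValuation ξ v x := by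
  obtain ⟨hs, v, hv, hx⟩ := h.abs_eq
  exact ⟨v, hv, h.birational, hs, hx⟩

theorem IsMonomialPoint.unique {J : Finset M.Component} {α : J → ℝ} {ξ : M.total}
    {x x' : Analytification R sX} (h : M.IsMonomialPoint J α ξ x)
    (h' : M.IsMonomialPoint J α ξ x') : x = x' := by
  obtain ⟨v, hv, hx⟩ := h.exists_hasValuation
  obtain ⟨v', hv', hx'⟩ := h'.exists_hasValuation
  obtain rfl : v = v' := AddValuation.ext fun f => le_antisymm (hv.2 v' hv'.1 f) (hv'.2 v hv.1 f)
  exact hx.unique hx'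

/-- The data of a generic point of a stratum, together with a compatible system of parameters. -/
structure IsChart (M : Model R sX) (J : Finset M.Component) (ξ : M.total)
    (z : J → M.total.presheaf.stalk ξ) : Prop where
  param : IsParamSystem z
  specializes : ∀ i ∈ J, M.genericPt i ⤳ ξ
  span_eq : ∀ i : J, Ideal.span {z i} = stalkPrime (specializes i.1 i.2)
  specialIdeal_eq : M.specialIdeal ξ = Ideal.span {∏ i, z i ^ M.mult i.1}
  mult_pos : ∀ i : J, 0 < M.mult i.1

theorem IsSncd.exists_isChart (hM : M.IsSncd) {J : Finset M.Component} (hJ : J.Nonempty)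
    {ξ : M.total} (hξ : IsComponentOf (closure {ξ}) (M.stratum J)) : ∃ z, IsChart M J ξ z := by
  obtain ⟨z, h1, h2, h3, h4⟩ := hM.exists_chart hJ hξ
  have hs := mem_stratum.mp ((isComponentOf_closure_iff (isClosed_stratum J)).mp hξ).1
  exact ⟨z, h1, hs, fun i => (h2 i).trans (idealAt_eq _), h3, h4⟩

section Chart

variable {J : Finset M.Component} {ξ : M.total} [IsNoetherianRing (M.total.presheaf.stalk ξ)]
  {z : J → M.total.presheaf.stalk ξ}

/-- The special fibre at `ξ` is a monomial in the equations of the components in `J`, so no other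
component passes through `ξ`. Hence `ξ` determines `J`. -/
theorem IsChart.mem_of_specializes (hc : IsChart M J ξ z) {i : M.Component}
    (hi : M.genericPt i ⤳ ξ) : i ∈ J := by
  have h1 := (M.mem_specialFiber_iff_of_specializes hi).mp (M.genericPt_mem_specialFiber i)
  rw [hc.specialIdeal_eq, Ideal.span_singleton_le_iff_mem, Ideal.IsPrime.prod_mem_iff] at h1
  obtain ⟨j, -, hj⟩ := h1
  have hzj : z j ∈ stalkPrime hi := Ideal.IsPrime.mem_of_pow_mem inferInstance _ hj
  have h2 : M.genericPt j.1 ⤳ M.genericPt i := by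
    rw [specializes_iff_stalkPrime_le (hc.specializes j.1 j.2) hi, ← hc.span_eq,
      Ideal.span_singleton_le_iff_mem]
    exact hzj
  rw [← component_ext (eq_genericPt (genericPt_mem_specialFiber j.1) h2)]
  exact j.2

/-- The birational point with prescribed weights. -/
theorem IsChart.exists_hasValuation [ConnectedSpace X] (hM : M.IsSncd) (hc : IsChart M J ξ z)
    {α : J → ℝ≥0} (hα : ∑ i, α i * M.mult i.1 = 1) :
    ∃ x : Analytification R sX, HasValuation ξ (hc.param.valuation α) x := by
  have := hM.isDomain_stalk ξ
  obtain ⟨η, hη⟩ := hM.exists_isGenericPoint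
  have hs := hM.incl_specializes hη ξ
  obtain ⟨N, hN⟩ := exists_absoluteValue (M.evalAt η ξ hs).hom (hM.evalAt_injective hη hs)
    (exists_evalAt_div hs) (hc.param.valuation α) (fun f => hc.param.valuation_ne_top α)
  obtain ⟨p, hp⟩ := IsDiscreteValuationRing.exists_irreducible R
  refine ⟨⟨η, N, fun a => ?_⟩, hη, hs, hN⟩
  refine eq_fieldAbs R hp (N := fun a => N ((toResidueField sX η).hom a)) (by simp) (by simp)
    (fun a ha => ?_) ?_ a
  · have hu : IsUnit ((M.toStalk ξ).hom a) := ha.map _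
    rw [M.toResidueField_algebraMap hs, hN _ hu.ne_zero, addValuation_unit _ hu]
    simp
  · have hsp : M.specialIdeal ξ = Ideal.span {(M.toStalk ξ).hom p} := by
      rw [specialIdeal, hp.maximalIdeal_eq, Ideal.map_span, Set.image_singleton]
    rw [hc.specialIdeal_eq, Ideal.span_singleton_eq_span_singleton] at hsp
    obtain ⟨c, hc'⟩ := hsp
    have h0 : ∏ i, z i ^ M.mult i.1 ≠ 0 :=
      Finset.prod_ne_zero_iff.mpr fun j _ => pow_ne_zero _ (hc.param.ne_zero j)
    -- The uniformizer is a unit times `∏ z i ^ N i`, so its value is `∑ α i * N i`: here the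
    -- normalization of the weights enters.
    have hv : hc.param.valuation α ((M.toStalk ξ).hom p) = 1 := by
      rw [← hc', AddValuation.map_mul, addValuation_unit _ c.isUnit, add_zero]
      refine (addValuation_monomial _ z _).trans ?_
      simp only [hc.param.valuation_apply_param]
      exact_mod_cast hα
    rw [M.toResidueField_algebraMap hs, hN _ (by rw [← hc']; exact mul_ne_zero h0 c.ne_zero), hv]
    simp

/-- The point with weights `α` at a chart is monomial for the stratum of those components that have
positive weight. -/
theorem HasValuation.isMonomialPoint (hM : M.IsSncd) (hc : IsChart M J ξ z)
    {β : M.Component → ℝ≥0} (hβ : ∑ i : J, β i.1 * M.mult i.1 = 1) {x : Analytification R sX}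
    (hx : HasValuation ξ (hc.param.valuation fun i => β i.1) x) {J' : Finset M.Component}
    (hJ' : ∀ i, i ∈ J' ↔ i ∈ J ∧ 0 < β i) {ξ' : M.total} (h : ξ' ⤳ ξ)
    (hξ' : IsComponentOf (closure {ξ'}) (M.stratum J')) :
    M.IsMonomialPoint J' (fun i => β i.1) ξ' x := by
  classical
  have := hM.isDomain_stalk ξ
  have := hM.isDomain_stalk ξ'
  have hsum : ∑ i ∈ J', β i * M.mult i = 1 := by
    rw [← hβ, Finset.sum_coe_sort J fun i => β i * (M.mult i : ℝ≥0)]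
    refine Finset.sum_subset (fun i hi => ((hJ' i).mp hi).1) fun i hi hi' => ?_
    have : β i = 0 := by
      by_contra h0
      exact hi' ((hJ' i).mpr ⟨hi, pos_iff_ne_zero.mpr h0⟩)
    rw [this, zero_mul]
  have hne : J'.Nonempty := by
    rw [Finset.nonempty_iff_ne_empty]
    rintro rfl
    simp at hsum
  have hspec : ∀ i ∈ J', M.genericPt i ⤳ ξ' :=
    mem_stratum.mp ((isComponentOf_closure_iff (isClosed_stratum J')).mp hξ').1
  set φ := (M.total.presheaf.stalkSpecializes h).hom with hφ
  have hmem : ∀ i (hi : i ∈ J'), z ⟨i, ((hJ' i).mp hi).1⟩ ∈ stalkPrime h := fun i hi => by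
    have h1 := (specializes_iff_stalkPrime_le (hc.specializes i ((hJ' i).mp hi).1) h).mp
      (hspec i hi)
    refine h1 ?_
    rw [← hc.span_eq ⟨i, _⟩]
    exact Ideal.mem_span_singleton_self _
  have hv0 : ∀ s, IsUnit (φ s) → hc.param.valuation (fun i => β i.1) s = 0 := fun s hs => by
    refine hc.param.valuation_eq_zero fun hsm => ?_
    have h1 : s ∈ stalkPrime h := by
      refine (Ideal.span_le.mpr ?_) hsm
      rintro _ ⟨i, hi, rfl⟩
      exact hmem i.1 ((hJ' _).mpr ⟨i.2, hi⟩)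
    exact (mem_nonunits_iff.mp ((mem_maximalIdeal _).mp (mem_stalkPrime.mp h1))) hs
  -- The components of zero weight need not pass through `ξ'`; since denominators have value 0, the
  -- valuation extends to the local ring there.
  obtain ⟨w, hw⟩ := exists_addValuation_extension φ (stalkSpecializes_injective h)
    (exists_mul_stalkSpecializes_eq h) _ hv0
  have hideal : ∀ i : J', M.idealAt i.1.1 ξ' = Ideal.span {φ (z ⟨i.1, ((hJ' _).mp i.2).1⟩)} :=
    fun i => by
      rw [idealAt_eq (hspec i.1 i.2), stalkPrime_eq_map h (hspec i.1 i.2)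
        (hc.specializes i.1 ((hJ' _).mp i.2).1), ← hc.span_eq ⟨i.1, ((hJ' _).mp i.2).1⟩,
        Ideal.map_span, Set.image_singleton]
  refine ⟨hne, fun i => ((hJ' _).mp i.2).2, ?_, hξ', hx.birational, ?_⟩
  · rw [Finset.sum_coe_sort J' fun i => (β i : ℝ) * M.mult i]
    exact_mod_cast hsum
  obtain ⟨-, hs', hxw⟩ := hx.generization hM h hw
  refine ⟨hs', w, ⟨⟨fun f hf => ?_, fun i t ht => ?_⟩, fun w' hw' f => ?_⟩, hxw⟩
  · obtain ⟨a, s, hsu, e⟩ := exists_mul_stalkSpecializes_eq h f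
    have h1 := congrArg w e
    rw [w.map_mul, hf, ← hφ, hw, top_add] at h1
    have ha : a = 0 := by
      by_contra ha
      exact hc.param.valuation_ne_top _ ha ((hw a).symm.trans h1.symm)
    rw [ha, map_zero] at e
    exact (hsu.mul_left_eq_zero).mp e
  · rw [hideal, Ideal.span_singleton_eq_span_singleton] at ht
    obtain ⟨c, hc'⟩ := ht.symm
    rw [← hc', w.map_mul, addValuation_unit _ c.isUnit, add_zero, hw,
      hc.param.valuation_apply_param]
    simp
  · obtain ⟨a, s, hsu, e⟩ := exists_mul_stalkSpecializes_eq h f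
    have h1 := congrArg w e
    have h2 := congrArg w' e
    rw [AddValuation.map_mul, addValuation_unit _ hsu, add_zero] at h1 h2
    rw [h1, h2, ← hφ, hw]
    -- Minimality at `ξ'` reduces to minimality at `ξ`, for the pullback of `w'`: a parameter of
    -- zero weight imposes no condition.
    refine hc.param.valuation_le φ w' (fun i => ?_) a
    by_cases hi : 0 < β i.1
    · rw [hw'.2 ⟨i.1, (hJ' _).mpr ⟨i.2, hi⟩⟩ _ (hideal _).symm]
      simp
    · have : β i.1 = 0 := by simpa using hi
      simp [this]

end Chart

end Model

/-! ### Simplices and construction of the canonical map -/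

open Classical in
theorem map_inclusion_apply {κ : Type*} {S T : Finset κ} (h : S ⊆ T) (y : stdSimplex ℝ S) (i : T) :
    stdSimplex.map (fun i : S => (⟨i.1, h i.2⟩ : T)) y i = if h : i.1 ∈ S then y ⟨i.1, h⟩ else 0 := by
  rw [stdSimplex.map_coe, FunOnFinite.linearMap_apply_apply]
  split_ifs with hi
  · rw [Finset.sum_eq_single ⟨i, hi⟩]
    · rintro ⟨j, hj⟩ hj' hne
      have e : j = i.1 := congrArg Subtype.val (Finset.mem_filter.mp hj').2
      exact absurd (Subtype.ext e) hne
    · simp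
  · refine Finset.sum_eq_zero fun j hj => ?_
    exact absurd (congrArg Subtype.val (Finset.mem_filter.mp hj).2 ▸ j.2) hi

namespace Model

set_option linter.unusedSectionVars false

variable {R : Type u} [CommRing R] [IsDomain R] [IsDiscreteValuationRing R]
variable {K : Type u} [Field K] [Algebra R K] [IsFractionRing R K]
variable {X : Scheme.{u}} {sX : X ⟶ Spec (.of K)} {M : Model R sX}

theorem IsSncd.connectedComponentIn_stratum (hM : M.IsSncd) {J : Finset M.Component}
    (hJ : J.Nonempty) {x ξ : M.total} (hx : x ∈ M.stratum J)
    (hξ : IsComponentOf (closure {ξ}) (M.stratum J)) (hξx : ξ ⤳ x) :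
    connectedComponentIn (M.stratum J) x = closure {ξ} := by
  have := M.isNoetherian_total
  obtain ⟨ζ, hζ, hζx, hgen⟩ := hM.exists_generic hJ x hx
  rw [isComponentOf_closure_iff (isClosed_stratum J)] at hξ
  obtain rfl : ζ = ξ := ((hgen ξ hξ.1 hξx).antisymm
    (hξ.2 ζ hζ (hgen ξ hξ.1 hξx))).eq
  exact connectedComponentIn_eq_closure (isClosed_stratum J) (hM.exists_generic hJ) hx hζ hζx hgen

theorem IsSncd.exists_isComponentOf (hM : M.IsSncd) {J : Finset M.Component} (hJ : J.Nonempty)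
    {x : M.total} (hx : x ∈ M.stratum J) :
    ∃ ξ, IsComponentOf (closure {ξ}) (M.stratum J) ∧ ξ ⤳ x := by
  obtain ⟨ξ, h1, h2, h3⟩ := hM.exists_generic hJ x hx
  exact ⟨ξ, (isComponentOf_closure_iff (isClosed_stratum J)).mpr
    ⟨h1, fun y hy hyξ => h3 y hy (hyξ.trans h2)⟩, h2⟩

/-- The simplex that corresponds to a generic point of a stratum. -/
def IsSncd.simplex (hM : M.IsSncd) {J : Finset M.Component} (hJ : J.Nonempty) {ξ : M.total}
    (hξ : IsComponentOf (closure {ξ}) (M.stratum J)) : M.Simplex :=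
  ⟨J, hJ, closure {ξ}, ξ, hξ.1.2 (subset_closure rfl),
    (hM.connectedComponentIn_stratum hJ (hξ.1.2 (subset_closure rfl)) hξ (specializes_refl ξ)).symm⟩

theorem Simplex.exists_isGenericPoint (hM : M.IsSncd) (σ : M.Simplex) :
    ∃ ξ, IsGenericPoint ξ σ.C ∧ IsComponentOf (closure {ξ}) (M.stratum σ.J) := by
  obtain ⟨x, hx, e⟩ := σ.isConnectedComponent
  obtain ⟨ξ, hξ, hξx⟩ := hM.exists_isComponentOf σ.nonempty hx
  refine ⟨ξ, ?_, hξ⟩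
  rw [e, hM.connectedComponentIn_stratum σ.nonempty hx hξ hξx]
  exact isGenericPoint_closure

theorem Simplex.ext_of_eq {σ τ : M.Simplex} (hJ : σ.J = τ.J) (hC : σ.C = τ.C) : σ = τ := by
  obtain ⟨J, _, C, _⟩ := σ
  obtain ⟨J', _, C', _⟩ := τ
  obtain rfl : J = J' := hJ
  obtain rfl : C = C' := hC
  rfl

section Weights

open Classical in
/-- The weights `y i / N i` that belong to barycentric coordinates `y`, extended by zero. -/
noncomputable def Simplex.weights (σ : M.Simplex) (y : stdSimplex ℝ σ.J) (i : M.Component) : ℝ≥0 :=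
  if h : i ∈ σ.J then (y ⟨i, h⟩ / M.mult i).toNNReal else 0

theorem Simplex.coe_weights (σ : M.Simplex) (y : stdSimplex ℝ σ.J) (i : σ.J) :
    (σ.weights y i.1 : ℝ) = y i / M.mult i.1 := by
  rw [weights, dif_pos i.2]
  exact Real.coe_toNNReal _ (div_nonneg (y.2.1 i) (Nat.cast_nonneg _))

theorem Simplex.weights_of_notMem (σ : M.Simplex) (y : stdSimplex ℝ σ.J) {i : M.Component}
    (hi : i ∉ σ.J) : σ.weights y i = 0 := by
  rw [weights, dif_neg hi]

theorem Simplex.continuous_weights (σ : M.Simplex) (i : M.Component) :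
    Continuous fun y => σ.weights y i := by
  by_cases hi : i ∈ σ.J
  · simp only [weights, dif_pos hi]
    exact continuous_real_toNNReal.comp
      (((continuous_apply (⟨i, hi⟩ : σ.J)).comp continuous_subtype_val).div_const _)
  · simp only [weights, dif_neg hi]
    exact continuous_const

theorem Simplex.sum_weights (σ : M.Simplex) (y : stdSimplex ℝ σ.J) (hm : ∀ i : σ.J, 0 < M.mult i.1) :
    ∑ i : σ.J, σ.weights y i.1 * M.mult i.1 = 1 := by
  have h : ((∑ i : σ.J, σ.weights y i.1 * M.mult i.1 : ℝ≥0) : ℝ) = 1 := by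
    push_cast
    rw [← y.2.2]
    refine Finset.sum_congr rfl fun i _ => ?_
    rw [σ.coe_weights, div_mul_cancel₀ _ (by exact_mod_cast (hm i).ne')]
    rfl
  exact_mod_cast h

theorem Simplex.weights_map {τ σ : M.Simplex} (hJ : τ.J ⊆ σ.J) (y : stdSimplex ℝ τ.J) :
    σ.weights (stdSimplex.map (fun i : τ.J => (⟨i.1, hJ i.2⟩ : σ.J)) y) = τ.weights y := by
  classical
  funext i
  by_cases hi : i ∈ σ.J
  · rw [weights, dif_pos hi]
    rw [map_inclusion_apply hJ, weights]
    split_ifs <;> simp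
  · rw [weights, dif_neg hi, weights, dif_neg fun h => hi (hJ h)]

end Weights

/-- Every point of the dual complex lies in the interior of a simplex. -/
theorem IsSncd.exists_interior (hM : M.IsSncd) (p : M.DualComplex) :
    ∃ (σ : M.Simplex) (y : stdSimplex ℝ σ.J), (∀ i, 0 < y i) ∧ p = DualComplex.mk M σ y := by
  classical
  obtain ⟨⟨σ, y⟩, rfl⟩ := Quot.exists_rep p
  -- The vertices with positive coordinate span the face whose interior contains the point.
  let J' : Finset M.Component := σ.J.filter fun i => ∃ h : i ∈ σ.J, 0 < y ⟨i, h⟩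
  have hJ' : J' ⊆ σ.J := Finset.filter_subset _ _
  have hpos : ∀ i : J', 0 < y ⟨i.1, hJ' i.2⟩ := fun i => (Finset.mem_filter.mp i.2).2.2
  have hzero : ∀ i : σ.J, i.1 ∉ J' → y i = 0 := fun i hi => by
    by_contra h0
    exact hi (Finset.mem_filter.mpr ⟨i.2, i.2, lt_of_le_of_ne (y.2.1 i) (Ne.symm h0)⟩)
  have hne : J'.Nonempty := by
    rw [Finset.nonempty_iff_ne_empty]
    intro h0
    have h1 : ∑ i, y i = 0 := Finset.sum_eq_zero fun i _ => hzero i (by simp [h0])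
    rw [stdSimplex.sum_eq_one] at h1
    exact one_ne_zero h1
  let f : J' → σ.J := fun i => ⟨i.1, hJ' i.2⟩
  have hf : Function.Injective f := fun i j h => Subtype.ext (congrArg (fun k : σ.J => k.1) h)
  have hsum : ∑ i, y (f i) = 1 := by
    rw [← stdSimplex.sum_eq_one y]
    exact Fintype.sum_of_injective f hf _ _ (fun i hi => hzero i fun h => hi ⟨⟨i.1, h⟩, rfl⟩)
      fun _ => rfl
  let y' : stdSimplex ℝ J' := ⟨fun i => y (f i), fun i => y.2.1 _, hsum⟩
  obtain ⟨ξ, hξ, hξc⟩ := σ.exists_isGenericPoint hM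
  have hmem : ξ ∈ M.stratum J' := mem_stratum.mpr fun i hi =>
    mem_stratum.mp (hξc.1.2 (subset_closure rfl)) i (hJ' hi)
  obtain ⟨ξ', hξ', h⟩ := hM.exists_isComponentOf hne hmem
  refine ⟨hM.simplex hne hξ', y', hpos, ?_⟩
  have hC : σ.C ⊆ closure {ξ'} := by
    rw [← hξ.def]
    exact h.closure_subset
  have hy : stdSimplex.map f y' = y := by
    refine stdSimplex.ext (funext fun i => ?_)
    refine (map_inclusion_apply hJ' y' i).trans ?_
    split_ifs with hi
    · rfl
    · exact (hzero i hi).symm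
  have := FaceRel.face (hM.simplex hne hξ') σ hJ' hC y'
  exact ((Quot.sound this).trans (congrArg (fun w => Quot.mk M.FaceRel ⟨σ, w⟩) hy)).symm

/-- `F` sends barycentric coordinates in the simplex `σ` to the points with the corresponding weights
at the generic point of `σ.C`. -/
def IsSimplexMap (σ : M.Simplex) (F : stdSimplex ℝ σ.J → Analytification R sX) : Prop :=
  ∃ (ξ : M.total) (_ : IsNoetherianRing (M.total.presheaf.stalk ξ))
    (z : σ.J → M.total.presheaf.stalk ξ) (hc : IsChart M σ.J ξ z), IsGenericPoint ξ σ.C ∧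
    IsComponentOf (closure {ξ}) (M.stratum σ.J) ∧
    ∀ y, HasValuation ξ (hc.param.valuation fun i => σ.weights y i.1) (F y)

theorem IsSncd.exists_isSimplexMap [ConnectedSpace X] (hM : M.IsSncd) (σ : M.Simplex) :
    ∃ F : stdSimplex ℝ σ.J → Analytification R sX, IsSimplexMap σ F := by
  obtain ⟨ξ, hξ, hξc⟩ := σ.exists_isGenericPoint hM
  have hn := hM.isNoetherianRing_stalk ξ
  obtain ⟨z, hc⟩ := hM.exists_isChart σ.nonempty hξc
  choose F hF using fun y => hc.exists_hasValuation hM (σ.sum_weights y hc.mult_pos)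
  exact ⟨F, ξ, hn, z, hc, hξ, hξc, hF⟩

theorem IsSimplexMap.isMonomialPoint (hM : M.IsSncd) {σ : M.Simplex}
    {F : stdSimplex ℝ σ.J → Analytification R sX} (hF : IsSimplexMap σ F) (y : stdSimplex ℝ σ.J)
    {J' : Finset M.Component} (hJ' : ∀ i, i ∈ J' ↔ 0 < σ.weights y i) {ξ' : M.total}
    (hξ' : IsComponentOf (closure {ξ'}) (M.stratum J')) (hC : σ.C ⊆ closure {ξ'}) :
    M.IsMonomialPoint J' (fun i => σ.weights y i.1) ξ' (F y) := by
  obtain ⟨ξ, _, z, hc, hξ, hξc, hv⟩ := hF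
  refine (hv y).isMonomialPoint hM hc (σ.sum_weights y hc.mult_pos) (fun i => ?_)
    (specializes_iff_mem_closure.mpr (hC hξ.mem)) hξ'
  rw [hJ']
  refine ⟨fun h => ⟨?_, h⟩, fun h => h.2⟩
  by_contra hi
  rw [σ.weights_of_notMem y hi] at h
  exact lt_irrefl _ h

theorem IsSimplexMap.exists_isMonomialPoint (hM : M.IsSncd) {σ : M.Simplex}
    {F : stdSimplex ℝ σ.J → Analytification R sX} (hF : IsSimplexMap σ F) (y : stdSimplex ℝ σ.J) :
    ∃ (J' : Finset M.Component) (ξ' : M.total), (∀ i, i ∈ J' ↔ 0 < σ.weights y i) ∧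
      IsComponentOf (closure {ξ'}) (M.stratum J') ∧ σ.C ⊆ closure {ξ'} := by
  classical
  obtain ⟨ξ, _, z, hc, hξ, hξc, -⟩ := hF
  have hsum := σ.sum_weights y hc.mult_pos
  have hJ' : ∀ i, i ∈ σ.J.filter (fun i => 0 < σ.weights y i) ↔ 0 < σ.weights y i := fun i => by
    rw [Finset.mem_filter]
    refine ⟨fun h => h.2, fun h => ⟨?_, h⟩⟩
    by_contra hi
    rw [σ.weights_of_notMem y hi] at h
    exact lt_irrefl _ h
  obtain ⟨i, -, hi⟩ := Finset.exists_ne_zero_of_sum_ne_zero (hsum.trans_ne one_ne_zero)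
  have hne : (σ.J.filter (fun i => 0 < σ.weights y i)).Nonempty :=
    ⟨i.1, (hJ' _).mpr (pos_iff_ne_zero.mpr (left_ne_zero_of_mul hi))⟩
  have hmem : ξ ∈ M.stratum (σ.J.filter (fun i => 0 < σ.weights y i)) :=
    mem_stratum.mpr fun i hi =>
      mem_stratum.mp (hξc.1.2 (subset_closure rfl)) i (Finset.filter_subset _ _ hi)
  obtain ⟨ξ', hξ', h⟩ := hM.exists_isComponentOf hne hmem
  refine ⟨_, ξ', hJ', hξ', ?_⟩
  rw [← hξ.def]
  exact h.closure_subset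

theorem IsSimplexMap.mem_skeleton (hM : M.IsSncd) {σ : M.Simplex}
    {F : stdSimplex ℝ σ.J → Analytification R sX} (hF : IsSimplexMap σ F) (y : stdSimplex ℝ σ.J) :
    F y ∈ M.skeleton := by
  obtain ⟨J', ξ', h1, h2, h3⟩ := hF.exists_isMonomialPoint hM y
  exact ⟨J', _, ξ', hF.isMonomialPoint hM y h1 h2 h3⟩

/-- Extension by zero changes neither the weights nor their support, so both sides are the monomial
point of the same stratum with the same weights. -/
theorem IsSimplexMap.map_eq (hM : M.IsSncd) {τ σ : M.Simplex} (hJ : τ.J ⊆ σ.J) (hC : σ.C ⊆ τ.C)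
    {F : stdSimplex ℝ τ.J → Analytification R sX} (hF : IsSimplexMap τ F)
    {G : stdSimplex ℝ σ.J → Analytification R sX} (hG : IsSimplexMap σ G) (y : stdSimplex ℝ τ.J) :
    F y = G (stdSimplex.map (fun i : τ.J => (⟨i.1, hJ i.2⟩ : σ.J)) y) := by
  obtain ⟨J', ξ', h1, h2, h3⟩ := hF.exists_isMonomialPoint hM y
  have h := hF.isMonomialPoint hM y h1 h2 h3
  rw [← Simplex.weights_map hJ y] at h h1
  exact h.unique (hG.isMonomialPoint hM _ h1 h2 (hC.trans h3))

theorem IsSimplexMap.isMonomialPoint_of_pos (hM : M.IsSncd) {σ : M.Simplex}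
    {F : stdSimplex ℝ σ.J → Analytification R sX} (hF : IsSimplexMap σ F) (y : stdSimplex ℝ σ.J)
    (hy : ∀ i, 0 < y i) : ∃ ξ : M.total, IsGenericPoint ξ σ.C ∧
      M.IsMonomialPoint σ.J (fun i => y i / M.mult i.1) ξ (F y) := by
  have hF' := hF
  obtain ⟨ξ, _, z, hc, hξ, hξc, -⟩ := hF'
  refine ⟨ξ, hξ, ?_⟩
  simp only [← σ.coe_weights]
  refine hF.isMonomialPoint hM y (fun i => ⟨fun hi => ?_, fun h => ?_⟩) hξc hξ.def.symm.subset
  · rw [← NNReal.coe_pos, σ.coe_weights y ⟨i, hi⟩]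
    exact div_pos (hy _) (by exact_mod_cast hc.mult_pos ⟨i, hi⟩)
  · by_contra hi
    rw [σ.weights_of_notMem y hi] at h
    exact lt_irrefl _ h

/-- Monomial points on a single component are divisorial. -/
theorem IsMonomialPoint.isDivisorialPoint (hM : M.IsSncd) {i : M.Component}
    {α : ({i} : Finset M.Component) → ℝ} {ξ : M.total} {x : Analytification R sX}
    (h : M.IsMonomialPoint {i} α ξ x) : M.IsDivisorialPoint i x := by
  have hst := (isComponentOf_closure_iff (isClosed_stratum _)).mp h.generic
  have hi : M.genericPt i ∈ M.stratum {i} := mem_stratum.mpr fun j hj => by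
    rw [Finset.mem_singleton.mp hj]
  have hiξ := mem_stratum.mp hst.1 i (Finset.mem_singleton_self i)
  obtain rfl : M.genericPt i = ξ := (hiξ.antisymm (hst.2 _ hi hiξ)).eq
  have := hM.isNoetherianRing_stalk (M.genericPt i)
  have := hM.isDomain_stalk (M.genericPt i)
  obtain ⟨z, hc⟩ := hM.exists_isChart (Finset.singleton_nonempty i) h.generic
  let j : ({i} : Finset M.Component) := ⟨i, Finset.mem_singleton_self i⟩
  have hj : ∀ k : ({i} : Finset M.Component), k = j := fun k =>
    Subtype.ext (Finset.mem_singleton.mp k.2)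
  have hz : Ideal.span {z j} = stalkPrime hiξ := hc.span_eq j
  have hmax : Ideal.span {z j} = maximalIdeal _ := hz.trans (stalkPrime_self _)
  obtain ⟨hs, v, hv, hx⟩ := h.abs_eq
  have hvz : v (z j) = ENNReal.ofReal (α j) := hv.1.2 j _ (hz.trans (idealAt_eq hiξ).symm)
  -- With a single component the normalization forces the weight.
  have hα : α j = 1 / M.mult i := by
    have h1 := h.sum_eq_one
    rw [Fintype.sum_eq_single j fun k hk => absurd (hj k) hk] at h1
    rw [eq_div_iff]
    · exact h1
    · rintro h0
      rw [show M.mult j.1 = M.mult i from rfl, h0, mul_zero] at h1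
      exact zero_ne_one h1
  refine ⟨h.birational, hs, fun f hf => ?_⟩
  obtain ⟨n, c, rfl⟩ := exists_eq_unit_mul_pow hmax (hc.param.ne_zero j) hf
  have hord : Ring.ord (M.total.presheaf.stalk (M.genericPt i)) (c * z j ^ n) = n := by
    rw [Ring.ord_mul _ (mem_nonZeroDivisors_of_ne_zero (pow_ne_zero _ (hc.param.ne_zero j))),
      Ring.ord_of_isUnit c.isUnit, zero_add, ord_pow_of_span hmax (hc.param.ne_zero j)]
  rw [hx _ hf, hord, v.map_mul, addValuation_unit _ c.isUnit, zero_add, v.map_pow, hvz, hα]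
  simp [div_eq_mul_inv]

theorem IsSncd.exists_isCanonicalMap [ConnectedSpace X] (hM : M.IsSncd) :
    ∃ Φ : M.DualComplex → M.skeleton, M.IsCanonicalMap Φ ∧
      ∀ σ, IsSimplexMap σ fun y => (Φ (DualComplex.mk M σ y)).1 := by
  choose F hF using hM.exists_isSimplexMap (M := M)
  let Φ : M.DualComplex → M.skeleton := Quot.lift
    (fun p => ⟨F p.1 p.2, (hF p.1).mem_skeleton hM p.2⟩) fun p q h => Subtype.ext (by
      obtain ⟨τ, σ, hJ, hC, y⟩ := h
      exact (hF τ).map_eq hM hJ hC (hF σ) y)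
  refine ⟨Φ, ⟨fun σ i hi y => ?_, fun σ y hy => (hF σ).isMonomialPoint_of_pos hM y hy⟩, hF⟩
  -- The only coordinate of a one-vertex simplex is 1, so the vertex is an interior point and the
  -- statement on divisorial points follows from the one on monomial points.
  obtain ⟨J, hJ, C, hC⟩ := σ
  obtain rfl : J = {i} := hi
  refine ((hF _).isMonomialPoint_of_pos hM y fun k => ?_).elim fun ξ h => h.2.isDivisorialPoint hM
  have h1 := stdSimplex.sum_eq_one y
  rw [Fintype.sum_eq_single k fun k' hk' => absurd (Subtype.ext
    ((Finset.mem_singleton.mp k'.2).trans (Finset.mem_singleton.mp k.2).symm)) hk'] at h1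
  rw [h1]
  exact one_pos

theorem IsCanonicalMap.unique (hM : M.IsSncd) {Φ Ψ : M.DualComplex → M.skeleton}
    (hΦ : M.IsCanonicalMap Φ) (hΨ : M.IsCanonicalMap Ψ) : Φ = Ψ := by
  funext p
  obtain ⟨σ, y, hy, rfl⟩ := hM.exists_interior p
  obtain ⟨ξ, h1, h2⟩ := hΦ.interior σ y hy
  obtain ⟨ξ', h1', h2'⟩ := hΨ.interior σ y hy
  obtain rfl : ξ = ξ' := h1.eq h1'
  exact Subtype.ext (h2.unique h2')

end Model

theorem finite_isComponentOf {T : Type*} [TopologicalSpace T] [TopologicalSpace.NoetherianSpace T]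
    {S : Set T} (hS : IsClosed S) : {Z | IsComponentOf Z S}.Finite := by
  obtain ⟨F, hF, hFc, hFi, hFS⟩ :=
    TopologicalSpace.NoetherianSpace.exists_finite_set_isClosed_irreducible hS
  refine hF.subset fun Z hZ => ?_
  obtain ⟨W, hW, hZW⟩ := isIrreducible_iff_sUnion_isClosed.mp hZ.1.1 hF.toFinset
    (fun W hW => hFc W (hF.mem_toFinset.mp hW)) (by rw [hF.coe_toFinset, ← hFS]; exact hZ.1.2)
  rw [hF.mem_toFinset] at hW
  have hWS : W ⊆ S := hFS ▸ Set.subset_sUnion_of_mem hW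
  have h : W ⊆ Z := hZ.2 ⟨hFi W hW, hWS⟩ hZW
  rwa [hZW.antisymm h]

/-! ### Uniqueness of the centre, and bijectivity -/

theorem isDominant_Spec_of_injective {A B : Type u} [CommRing A] [CommRing B] (φ : A →+* B)
    (hφ : Function.Injective φ) : IsDominant (Spec.map (CommRingCat.ofHom φ)) := by
  refine ⟨(PrimeSpectrum.denseRange_comap_iff_ker_le_nilRadical φ).mpr ?_⟩
  rw [(RingHom.injective_iff_ker_eq_bot φ).mp hφ]
  exact bot_le

/-- A non-archimedean absolute value as a valuation. -/
def valuationOfAbs {F : Type*} [Field F] (N : AbsoluteValue F ℝ)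
    (hN : ∀ a b, N (a + b) ≤ max (N a) (N b)) : Valuation F ℝ≥0 where
  toFun a := ⟨N a, N.nonneg a⟩
  map_zero' := NNReal.eq (map_zero N)
  map_one' := NNReal.eq (map_one N)
  map_mul' a b := NNReal.eq (map_mul N a b)
  map_add_le_max' a b := hN a b

namespace Model

set_option linter.unusedSectionVars false

variable {R : Type u} [CommRing R] [IsDomain R] [IsDiscreteValuationRing R]
variable {K : Type u} [Field K] [Algebra R K] [IsFractionRing R K]
variable {X : Scheme.{u}} {sX : X ⟶ Spec (.of K)} {M : Model R sX}

section Center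

variable {x : Analytification R sX}

theorem SpecMap_evalAt (M : Model R sX) {p : X} {ξ : M.total} (h : M.incl p ⤳ ξ) :
    Spec.map (M.evalAt p ξ h) ≫ M.total.fromSpecStalk ξ = X.fromSpecResidueField p ≫ M.incl := by
  rw [evalAt, Spec.map_comp, Spec.map_comp, Scheme.fromSpecResidueField]
  simp only [Category.assoc, Scheme.SpecMap_stalkSpecializes_fromSpecStalk,
    Scheme.SpecMap_stalkMap_fromSpecStalk]

/-- The morphism from the spectrum of the valuation ring of `x` whose closed point is the centre. -/
theorem exists_centerMap (hna : ∀ a b, x.abs (a + b) ≤ max (x.abs a) (x.abs b)) {ξ : M.total}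
    (h : M.incl x.pt ⤳ ξ) (hle : ∀ f, x.abs ((M.evalAt x.pt ξ h).hom f) ≤ 1)
    (hlt : ∀ f ∈ maximalIdeal _, x.abs ((M.evalAt x.pt ξ h).hom f) < 1) :
    ∃ g : Spec (.of (valuationOfAbs x.abs hna).valuationSubring) ⟶ M.total,
      Spec.map (CommRingCat.ofHom (valuationOfAbs x.abs hna).valuationSubring.subtype) ≫ g =
        X.fromSpecResidueField x.pt ≫ M.incl ∧
      g (closedPoint (valuationOfAbs x.abs hna).valuationSubring) = ξ := by
  set V := (valuationOfAbs x.abs hna).valuationSubring with hV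
  let ψ : M.total.presheaf.stalk ξ →+* V := (M.evalAt x.pt ξ h).hom.codRestrict V hle
  -- A non-unit has absolute value less than 1, so its inverse cannot lie in the valuation ring.
  have hψ : IsLocalHom ψ := ⟨fun f hf => by
    by_contra hn
    obtain ⟨c, hc⟩ := hf.exists_right_inv
    have h1 : x.abs ((M.evalAt x.pt ξ h).hom f) * x.abs (c : X.residueField x.pt) = 1 := by
      rw [← map_mul, ← map_one x.abs]
      exact congrArg (fun a : V => x.abs (a : X.residueField x.pt)) hc
    have h2 : x.abs (c : X.residueField x.pt) ≤ 1 := c.2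
    have h3 := hlt f hn
    have h4 := mul_le_mul h3.le h2 (x.abs.nonneg _) zero_le_one
    nlinarith [x.abs.nonneg ((M.evalAt x.pt ξ h).hom f), x.abs.nonneg (c : X.residueField x.pt)]⟩
  refine ⟨Spec.map (CommRingCat.ofHom ψ) ≫ M.total.fromSpecStalk ξ, ?_, ?_⟩
  · rw [← SpecMap_evalAt M h, ← Category.assoc, ← Spec.map_comp]
    rfl
  · have h1 : Spec.map (CommRingCat.ofHom ψ) (closedPoint V) = closedPoint _ :=
      comap_closedPoint ψ
    exact (congrArg (M.total.fromSpecStalk ξ) h1).trans M.total.fromSpecStalk_closedPoint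

/-- A non-archimedean point has at most one centre, since the model is separated. -/
theorem center_unique (hna : ∀ a b, x.abs (a + b) ≤ max (x.abs a) (x.abs b)) {ξ ξ' : M.total}
    (h : M.incl x.pt ⤳ ξ) (hle : ∀ f, x.abs ((M.evalAt x.pt ξ h).hom f) ≤ 1)
    (hlt : ∀ f ∈ maximalIdeal _, x.abs ((M.evalAt x.pt ξ h).hom f) < 1)
    (h' : M.incl x.pt ⤳ ξ') (hle' : ∀ f, x.abs ((M.evalAt x.pt ξ' h').hom f) ≤ 1)
    (hlt' : ∀ f ∈ maximalIdeal _, x.abs ((M.evalAt x.pt ξ' h').hom f) < 1) : ξ = ξ' := by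
  obtain ⟨g, hg, rfl⟩ := exists_centerMap hna h hle hlt
  obtain ⟨g', hg', rfl⟩ := exists_centerMap hna h' hle' hlt'
  have := M.isSeparated
  have := isDominant_Spec_of_injective (valuationOfAbs x.abs hna).valuationSubring.subtype
    Subtype.val_injective
  -- Uniqueness in the valuative criterion: both maps restrict to the same map on the dense generic
  -- point, so they agree, first over `Spec R` and then on the separated model.
  have hs : g ≫ M.str = g' ≫ M.str := ext_of_isDominant
    (Spec.map (CommRingCat.ofHom (valuationOfAbs x.abs hna).valuationSubring.subtype))
    (by rw [reassoc_of% hg, reassoc_of% hg'])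
  have e : g = g' := ext_of_isDominant_of_isSeparated M.str hs _ (hg.trans hg'.symm)
  rw [e]

end Center

section Monomial

variable {J : Finset M.Component} {α : J → ℝ} {ξ : M.total} {x : Analytification R sX}

/-- Collects what allows the data to be recovered from `x`: `ξ` is a centre, as the maximal ideal is
generated by parameters of positive value, and the local equations reveal the weights. -/
theorem IsMonomialPoint.exists_spec (hM : M.IsSncd) (h : M.IsMonomialPoint J α ξ x) :
    (∀ a b, x.abs (a + b) ≤ max (x.abs a) (x.abs b)) ∧ ∃ hs : M.incl x.pt ⤳ ξ,
      (∀ f, x.abs ((M.evalAt x.pt ξ hs).hom f) ≤ 1) ∧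
      (∀ f ∈ maximalIdeal _, x.abs ((M.evalAt x.pt ξ hs).hom f) < 1) ∧
      ∀ (i : J) t, Ideal.span {t} = M.idealAt i.1.1 ξ →
        x.abs ((M.evalAt x.pt ξ hs).hom t) = Real.exp (-α i) := by
  have := hM.isDomain_stalk ξ
  have := hM.isNoetherianRing_stalk ξ
  obtain ⟨hs, v, hv, hx⟩ := h.abs_eq
  obtain ⟨z, hc⟩ := hM.exists_isChart h.nonempty h.generic
  have hvt : ∀ f, f ≠ 0 → v f ≠ ⊤ := fun f hf h0 => hf (hv.1.1 f h0)
  have hid : ∀ i : J, Ideal.span {z i} = M.idealAt i.1.1 ξ := fun i =>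
    (hc.span_eq i).trans (idealAt_eq _).symm
  have hvm : ∀ f ∈ maximalIdeal (M.total.presheaf.stalk ξ), v f ≠ 0 := fun f hf => by
    rw [← hc.param.span_eq] at hf
    refine Submodule.span_induction (p := fun f _ => v f ≠ 0) ?_ ?_ ?_ ?_ hf
    · rintro _ ⟨i, rfl⟩
      rw [hv.1.2 i _ (hid i)]
      exact (ENNReal.ofReal_pos.mpr (h.pos i)).ne'
    · simp
    · intro a b _ _ ha hb h0
      have h1 := v.map_add a b
      rw [h0] at h1
      rcases min_le_iff.mp h1 with h1 | h1
      · exact ha (le_antisymm h1 zero_le)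
      · exact hb (le_antisymm h1 zero_le)
    · intro a b _ hb h0
      rw [smul_eq_mul, v.map_mul] at h0
      exact hb (add_eq_zero.mp h0).2
  refine ⟨add_le_max_of_addValuation (M.evalAt x.pt ξ hs).hom (exists_evalAt_div hs) v hvt hx, hs,
    fun f => ?_, fun f hf => ?_, fun i t ht => ?_⟩
  · by_cases h0 : f = 0
    · simp [h0]
    · rw [hx f h0]
      simp
  · by_cases h0 : f = 0
    · simp [h0]
    · rw [hx f h0, Real.exp_lt_one_iff, neg_lt_zero]
      exact ENNReal.toReal_pos (hvm f hf) (hvt f h0)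
  · have ht0 : t ≠ 0 := by
      rintro rfl
      rw [← hid i, Ideal.span_singleton_eq_span_singleton] at ht
      exact hc.param.ne_zero i (associated_zero_iff_eq_zero _ |>.mp ht.symm)
    rw [hx t ht0, hv.1.2 i t ht, ENNReal.toReal_ofReal (h.pos i).le]

theorem IsMonomialPoint.center_unique (hM : M.IsSncd) (h : M.IsMonomialPoint J α ξ x)
    {J' : Finset M.Component} {α' : J' → ℝ} {ξ' : M.total} (h' : M.IsMonomialPoint J' α' ξ' x) :
    ξ = ξ' := by
  obtain ⟨hna, hs, h1, h2, -⟩ := h.exists_spec hM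
  obtain ⟨-, hs', h1', h2', -⟩ := h'.exists_spec hM
  exact Model.center_unique hna hs h1 h2 hs' h1' h2'

theorem IsMonomialPoint.components_unique (hM : M.IsSncd) (h : M.IsMonomialPoint J α ξ x)
    {J' : Finset M.Component} {α' : J' → ℝ} (h' : M.IsMonomialPoint J' α' ξ x) : J = J' := by
  have := hM.isNoetherianRing_stalk ξ
  obtain ⟨z, hc⟩ := hM.exists_isChart h.nonempty h.generic
  obtain ⟨z', hc'⟩ := hM.exists_isChart h'.nonempty h'.generic
  ext i
  exact ⟨fun hi => hc'.mem_of_specializes (hc.specializes i hi),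
    fun hi => hc.mem_of_specializes (hc'.specializes i hi)⟩

theorem IsMonomialPoint.weights_unique (hM : M.IsSncd) (h : M.IsMonomialPoint J α ξ x)
    {α' : J → ℝ} (h' : M.IsMonomialPoint J α' ξ x) : α = α' := by
  obtain ⟨-, hs, -, -, h1⟩ := h.exists_spec hM
  obtain ⟨-, hs', -, -, h1'⟩ := h'.exists_spec hM
  obtain ⟨z, hc⟩ := hM.exists_isChart h.nonempty h.generic
  funext i
  have hid := (hc.span_eq i).trans (idealAt_eq _).symm
  have e := (h1 i _ hid).symm.trans (h1' i _ hid)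
  exact neg_injective (Real.exp_injective e)

end Monomial

section Bijective

variable {Φ : M.DualComplex → M.skeleton}

theorem IsCanonicalMap.injective (hM : M.IsSncd) (hΦ : M.IsCanonicalMap Φ) :
    Function.Injective Φ := by
  intro p q hpq
  obtain ⟨σ, y, hy, rfl⟩ := hM.exists_interior p
  obtain ⟨τ, w, hw, rfl⟩ := hM.exists_interior q
  obtain ⟨ξ, h1, h2⟩ := hΦ.interior σ y hy
  obtain ⟨ξ', h1', h2'⟩ := hΦ.interior τ w hw
  rw [← hpq] at h2'
  obtain rfl := h2.center_unique hM h2'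
  obtain rfl : σ = τ := Simplex.ext_of_eq (h2.components_unique hM h2') (h1.def.symm.trans h1'.def)
  have e := h2.weights_unique hM h2'
  obtain ⟨z, hc⟩ := hM.exists_isChart h2.nonempty h2.generic
  congr 1
  refine stdSimplex.ext (funext fun i => ?_)
  exact (div_left_inj' (by exact_mod_cast (hc.mult_pos i).ne')).mp (congrFun e i)

theorem IsCanonicalMap.surjective (hM : M.IsSncd) (hΦ : M.IsCanonicalMap Φ) :
    Function.Surjective Φ := by
  rintro ⟨x, J, α, ξ, h⟩
  obtain ⟨z, hc⟩ := hM.exists_isChart h.nonempty h.generic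
  have hm : ∀ i : J, (0 : ℝ) < M.mult i.1 := fun i => by exact_mod_cast hc.mult_pos i
  let y : stdSimplex ℝ J :=
    ⟨fun i => α i * M.mult i.1, fun i => (mul_pos (h.pos i) (hm i)).le, h.sum_eq_one⟩
  refine ⟨DualComplex.mk M (hM.simplex h.nonempty h.generic) y, Subtype.ext ?_⟩
  obtain ⟨ξ', h1, h2⟩ := hΦ.interior (hM.simplex h.nonempty h.generic) y
    fun i => mul_pos (h.pos i) (hm i)
  have hξ : ξ' = ξ := IsGenericPoint.eq h1 isGenericPoint_closure
  rw [hξ] at h2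
  have e : (fun i : J => y i / M.mult i.1) = α :=
    funext fun i => mul_div_cancel_right₀ _ (hm i).ne'
  have h3 : M.IsMonomialPoint J (fun i => y i / M.mult i.1) ξ
      (Φ (DualComplex.mk M (hM.simplex h.nonempty h.generic) y)).1 := h2
  rw [e] at h3
  exact h3.unique h

end Bijective

/-! ### Continuity, separation and compactness -/

section Topology

/-- All values lie over the generic point, where a regular function is a fraction `a / b` of germs
at `ξ`. Its absolute value is a quotient of exponentials of orders, which are continuous in the
weights. -/
theorem IsSimplexMap.continuous {σ : M.Simplex} {F : stdSimplex ℝ σ.J → Analytification R sX}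
    (hF : IsSimplexMap σ F) : Continuous F := by
  classical
  obtain ⟨ξ, _, z, hc, hξ, hξc, hv⟩ := hF
  have hcw : Continuous fun y : stdSimplex ℝ σ.J => fun i : σ.J => σ.weights y i.1 :=
    continuous_pi fun i => σ.continuous_weights i.1
  have hexp : ∀ f : M.total.presheaf.stalk ξ, f ≠ 0 → Continuous fun y : stdSimplex ℝ σ.J =>
      Real.exp (-(hc.param.order (fun i => σ.weights y i.1) f).toReal) := fun f hf => by
    refine Real.continuous_exp.comp (Continuous.neg ?_)
    refine continuous_iff_continuousAt.mpr fun y => ?_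
    exact (ENNReal.tendsto_toReal (hc.param.order_ne_top _ hf)).comp
      (((hc.param.continuous_order f).comp hcw).tendsto y)
  have hpt : ∀ y y', (F y).pt = (F y').pt := fun y y' => (hv y).birational.eq (hv y').birational
  refine continuous_generateFrom_iff.mpr ?_
  rintro s (⟨U, rfl⟩ | ⟨U, f, V, hV, rfl⟩)
  · rw [isOpen_iff_forall_mem_open]
    intro y hy
    exact ⟨Set.univ, fun y' _ => (congrArg (fun p => p ∈ U) (hpt y' y)).mpr hy, isOpen_univ,
      trivial⟩
  · by_cases hne : ∃ y, (F y).pt ∈ U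
    · obtain ⟨y₀, hy₀⟩ := hne
      have hU : ∀ y, (F y).pt ∈ U := fun y => (congrArg (fun p => p ∈ U) (hpt y y₀)).mpr hy₀
      obtain ⟨hs, -⟩ := (hv y₀).abs_eq
      obtain ⟨a, b, hb, e⟩ := exists_evalAt_div hs ((X.evaluation U _ hy₀).hom f)
      -- The case `a = 0` is separate because `(⊤ : ℝ≥0∞).toReal` is 0, so the exponential would
      -- give 1.
      have key : ∀ (x : Analytification R sX) (v : AddValuation (M.total.presheaf.stalk ξ) ℝ≥0∞)
          (hx : HasValuation ξ v x) (h : x.pt ∈ U), x.abs ((X.evaluation U x.pt h).hom f) =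
            (if a = 0 then 0 else Real.exp (-(v a).toReal)) / Real.exp (-(v b).toReal) := by
        intro x v hx h
        have hp : (F y₀).pt = x.pt := (hv y₀).birational.eq hx.birational
        obtain ⟨p, N, hN⟩ := x
        obtain ⟨-, hs', hx⟩ := hx
        dsimp only at hp hs' hx h ⊢
        subst hp
        rw [e, map_div₀, hx b hb]
        split_ifs with ha
        · simp [ha]
        · rw [hx a ha]
      have e1 : F ⁻¹' {x | ∃ h : x.pt ∈ U, x.abs ((X.evaluation U x.pt h).hom f) ∈ V} =
          (fun y => (if a = 0 then 0 else
            Real.exp (-(hc.param.order (fun i => σ.weights y i.1) a).toReal)) /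
            Real.exp (-(hc.param.order (fun i => σ.weights y i.1) b).toReal)) ⁻¹' V := by
        ext y
        constructor
        · rintro ⟨h, hy⟩
          rw [key _ _ (hv y) h] at hy
          exact hy
        · intro hy
          refine ⟨hU y, ?_⟩
          rw [key _ _ (hv y) (hU y)]
          exact hy
      rw [e1]
      refine hV.preimage (Continuous.div ?_ (hexp b hb) fun y => (Real.exp_pos _).ne')
      split_ifs with ha
      · exact continuous_const
      · exact hexp a ha
    · convert isOpen_empty
      ext y
      exact ⟨fun ⟨h, _⟩ => hne ⟨y, h⟩, fun h => h.elim⟩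

theorem isBirational_of_mem_skeleton {x : Analytification R sX} (hx : x ∈ M.skeleton) :
    x.IsBirational := by
  obtain ⟨J, α, ξ, h⟩ := hx
  exact h.birational

/-- All points of the skeleton lie over the generic point, so distinct ones differ on some regular
function near it; its absolute value separates them. -/
theorem t2Space_skeleton (M : Model R sX) : T2Space M.skeleton := by
  refine ⟨fun x x' hne => ?_⟩
  obtain ⟨U, f, hU, hU', hf⟩ : ∃ (U : X.Opens) (f : Γ(X, U)) (h : x.1.pt ∈ U) (h' : x'.1.pt ∈ U),
      x.1.abs ((X.evaluation U _ h).hom f) ≠ x'.1.abs ((X.evaluation U _ h').hom f) := by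
    by_contra! hall
    refine hne (Subtype.ext ?_)
    have hb := isBirational_of_mem_skeleton x.2
    have hb' := isBirational_of_mem_skeleton x'.2
    generalize x.1 = x at hall hb
    generalize x'.1 = x' at hall hb'
    obtain ⟨p, N, hN⟩ := x
    obtain ⟨p', N', hN'⟩ := x'
    obtain rfl : p = p' := hb.eq hb'
    congr 1
    ext c
    obtain ⟨g, rfl⟩ := X.residue_surjective p c
    obtain ⟨U, hU, f, rfl⟩ := X.presheaf.exists_germ_eq g
    exact hall U f hU hU
  obtain ⟨V, V', hV, hV', hx, hx', hd⟩ := t2_separation hf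
  have hopen : ∀ W : Set ℝ, IsOpen W → IsOpen {w : M.skeleton |
      ∃ h : w.1.pt ∈ U, w.1.abs ((X.evaluation U w.1.pt h).hom f) ∈ W} := fun W hW =>
    IsOpen.preimage continuous_subtype_val
      (show IsOpen {w : Analytification R sX |
        ∃ h : w.pt ∈ U, w.abs ((X.evaluation U w.pt h).hom f) ∈ W} from
        TopologicalSpace.isOpen_generateFrom_of_mem (Or.inr ⟨U, f, W, hW, rfl⟩))
  refine ⟨_, _, hopen V hV, hopen V' hV', ⟨hU, hx⟩, ⟨hU', hx'⟩, ?_⟩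
  rw [Set.disjoint_left]
  rintro w ⟨h, hw⟩ ⟨h', hw'⟩
  exact Set.disjoint_left.mp hd hw hw'

theorem finite_component (M : Model R sX) : Finite M.Component := by
  have := M.isNoetherian_total
  exact (finite_isComponentOf M.isClosed_specialFiber).to_subtype

/-- There are finitely many components, and the connected components of a stratum are irreducible
components of a closed subset of a Noetherian space. -/
theorem IsSncd.finite_simplex (hM : M.IsSncd) : Finite M.Simplex := by
  have := M.isNoetherian_total
  have := M.finite_component
  have : ∀ J : Finset M.Component, Finite {Z // IsComponentOf Z (M.stratum J)} := fun J =>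
    (finite_isComponentOf (isClosed_stratum J)).to_subtype
  have hC : ∀ σ : M.Simplex, IsComponentOf σ.C (M.stratum σ.J) := fun σ => by
    obtain ⟨ξ, h1, h2⟩ := σ.exists_isGenericPoint hM
    rwa [h1.def] at h2
  refine Finite.of_injective (β := Σ J : Finset M.Component, {Z // IsComponentOf Z (M.stratum J)})
    (fun σ => ⟨σ.J, σ.C, hC σ⟩) ?_
  rintro ⟨J, _, C, _⟩ ⟨J', _, C', _⟩ h
  obtain ⟨rfl, h⟩ := Sigma.mk.inj h
  obtain rfl : C = C' := congrArg Subtype.val (eq_of_heq h)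
  rfl

theorem IsSncd.compactSpace_dualComplex (hM : M.IsSncd) : CompactSpace M.DualComplex := by
  have := hM.finite_simplex
  exact inferInstanceAs (CompactSpace (Quot M.FaceRel))

theorem IsCanonicalMap.continuous [ConnectedSpace X] (hM : M.IsSncd)
    {Φ : M.DualComplex → M.skeleton} (hΦ : M.IsCanonicalMap Φ) : Continuous Φ := by
  obtain ⟨Ψ, hΨ, hF⟩ := hM.exists_isCanonicalMap
  -- By uniqueness the map is the constructed one, whose restriction to each simplex is known to be
  -- continuous.
  obtain rfl := hΦ.unique hM hΨ
  refine continuous_coinduced_dom.mpr (continuous_sigma fun σ => ?_)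
  exact Continuous.subtype_mk (hF σ).continuous _

end Topology

theorem IsCanonicalMap.isHomeomorph [ConnectedSpace X] (hM : M.IsSncd)
    {Φ : M.DualComplex → M.skeleton} (hΦ : M.IsCanonicalMap Φ) : IsHomeomorph Φ := by
  have := t2Space_skeleton M
  have := hM.compactSpace_dualComplex
  exact isHomeomorph_iff_continuous_bijective.mpr
    ⟨hΦ.continuous hM, hΦ.injective hM, hΦ.surjective hM⟩

end Model

end BerkovichSkeleton

theorem mainTheorem8 {R K : Type u} [CommRing R] [IsDomain R] [IsDiscreteValuationRing R]
    [IsAdicComplete (IsLocalRing.maximalIdeal R) R] [Field K] [Algebra R K] [IsFractionRing R K]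
    {X : Scheme.{u}} (sX : X ⟶ Spec (.of K)) [IsSeparated sX] [LocallyOfFiniteType sX]
    [QuasiCompact sX] [Smooth sX] [ConnectedSpace X]
    (M : BerkovichSkeleton.Model R sX) (hM : M.IsSncd) :
    (∃! Φ : M.DualComplex → M.skeleton, M.IsCanonicalMap Φ) ∧
    ∀ Φ : M.DualComplex → M.skeleton, M.IsCanonicalMap Φ → IsHomeomorph Φ := by
  obtain ⟨Φ, hΦ, -⟩ := hM.exists_isCanonicalMap
  exact ⟨⟨Φ, hΦ, fun Ψ hΨ => hΨ.unique hM hΦ⟩, fun Ψ hΨ => hΨ.isHomeomorph hM⟩
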